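/- Let $l\in\{1,2\}$, $\kappa\in\mathbb R$, and let $T_l=-\frac{d^2}{dr^2}+\frac{l(l+1)}{r^2}$ on $(0,\infty)$. Let $T_{l\kappa}^2$ be the operator in $L^2((0,\infty),dr)$ which acts as the fourth-order operation $T_l^2=T_l\circ T_l$ on those $v\in L^2(0,\infty)$ that are $C^3$ on $(0,\infty)$, with $(T_lv)'$ locally absolutely continuous and $T_l^2v\in L^2(0,\infty)$, and satisfy the boundary conditions at zero $$l=1:\quad v''(0)=-\tfrac{2\sqrt2}{3}\,\kappa\, v'(0),\quad v(0)=v'''(0)=0;\qquad (\mathrm{NB1})$$ $$l=2:\quad v'''(0)=-\tfrac{2\sqrt2}{5}\,\kappa^3\, v(0),\quad v'(0)=v''(0)=0,\qquad (\mathrm{NB2})$$ where $v^{(k)}(0)=\lim_{r\to0+}v^{(k)}(r)$ and these limits are required to exist for $k=0,1,2,3$. Let $D_l w(r)=r^{l+1}\bigl(\frac1r\frac{d}{dr}\bigr)^l\frac{w(r)}{r}$. Let $z\in\mathbb C$ with $0<\arg z<\frac{\pi}{2}$ and, if $\kappa>0$, $z^4\neq-\kappa^4$. Put $$l=1:\quad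 d=(i-1)z+\sqrt2\kappa,\quad \alpha_+=-\frac{(i+1)z+\sqrt2\kappa}{d},\quad \beta_+=\frac{2z}{d},\quad \alpha_-=\frac{(i+1)z-\sqrt2\kappa}{d},\quad \beta_-=-\frac{2iz}{d},$$ $$W_-=-2iz^3,\quad W_+=-2z^3;$$ $$l=2:\quad d=(i+1)z^3+\sqrt2\kappa^3,\quad \alpha_+=-\frac{(i-1)z^3+\sqrt2\kappa^3}{d},\quad \beta_+=-\frac{2z^3}{d},\quad \alpha_-=-\frac{(1-i)z^3+\sqrt2\kappa^3}{d},\quad \beta_-=-\frac{2iz^3}{d},$$ $$W_-=-2iz^5,\quad W_+=2z^5;$$ and $$g_+=D_le^{-zr},\quad g_-=D_le^{izr},\quad \tilde h_+=D_l(e^{zr}+\alpha_+e^{-zr}),\quad \tilde h_-=D_l(e^{-izr}+\alpha_-e^{izr}),$$ $$h_+=\tilde h_++\beta_+g_-=D_l(e^{zr}+\alpha_+e^{-zr}+\beta_+e^{izr}),\qquad h_-=\tilde h_-+\beta_-g_+=D_l(e^{-izr}+\alpha_-e^{izr}+\beta_-e^{-zr}).$$ With the Heaviside function $\theta$ normalized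 by $\theta(x)+\theta(-x)=1$, put $$R(r,s;z)=\frac{1}{2z^2W_-}\bigl(h_-(r)g_-(s)\theta(s-r)+h_-(s)g_-(r)\theta(r-s)\bigr)-\frac{1}{2z^2W_+}\bigl(h_+(r)g_+(s)\theta(s-r)+h_+(s)g_+(r)\theta(r-s)\bigr).\qquad(\mathrm{ResK})$$ Then $d\ne0$, and the following hold. 1. On $(0,\infty)$: $(T_l\pm z^2)\tilde h_\pm=0$, $(T_l\pm z^2)g_\pm=0$ and $\tilde h_\pm'g_\pm-\tilde h_\pm g_\pm'=W_\pm$. The functions $h_\pm$ satisfy the boundary condition (NB1) if $l=1$, (NB2) if $l=2$. 2. $R(r,s;z)=R(s,r;z)$ for all $r,s>0$. 3. For every $s>0$ the functions $R(\cdot,s;z)$ and $R(s,\cdot\,;z)$ satisfy the boundary condition (NB1) if $l=1$, (NB2) if $l=2$. 4. There is $c>0$ such that for every $s>0$ both $R(r,s;z)$ and $R(s,r;z)$ are $O(e^{-cr})$ as $r\to\infty$. 5. For every $s>0$ the function $R(\cdot,s;z)$ is locally integrable on $(0,\infty)$ and satisfies $(T_l^2-z^4)R(\cdot,s;z)=\delta(\cdot-s)$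 in the sense of distributions on $(0,\infty)$. 6. $R$ is the kernel of the resolvent of $T_{l\kappa}^2$ at $z^4$: the operator $T_{l\kappa}^2-z^4$ has a bounded everywhere defined two-sided inverse in $L^2(0,\infty)$, and for every $f\in L^2(0,\infty)$ it is given by $$\bigl((T_{l\kappa}^2-z^4)^{-1}f\bigr)(r)=\int_0^\infty R(r,s;z)f(s)\,ds\quad\text{for almost every } r>0,$$ where the integral converges absolutely for every $r>0$. -/

import Mathlib

open Set Filter Topology MeasureTheory
open scoped ContDiff

namespace ResKernel

noncomputable section

/-! ### Differential operations on functions on the half-line -/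

/-- The radial differential operation `T_l u = -u'' + l(l+1)/r² u`. -/
def radialT (l : ℕ) (u : ℝ → ℂ) (r : ℝ) : ℂ :=
  -iteratedDeriv 2 u r + (l : ℂ) * ((l : ℂ) + 1) / (r : ℂ) ^ 2 * u r

/-- The operation `D_l w = r^{l+1} ((1/r) d/dr)^l (w/r)`. -/
def opD (l : ℕ) (w : ℝ → ℂ) (r : ℝ) : ℂ :=
  (r : ℂ) ^ (l + 1) *
    ((fun (f : ℝ → ℂ) (x : ℝ) => (1 / (x : ℂ)) * deriv f x)^[l] fun x => w x / (x : ℂ)) r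

/-- The wronskian `u' v - u v'`. -/
def wronskian (u v : ℝ → ℂ) (r : ℝ) : ℂ := deriv u r * v r - u r * deriv v r

/-- The boundary condition at zero with parameter `κ`. For `l = 1` it reads
`v''(0) = -(2√2/3) κ v'(0)`, `v(0) = v'''(0) = 0`; for `l = 2` it reads
`v'''(0) = -(2√2/5) κ³ v(0)`, `v'(0) = v''(0) = 0`.  Values at `0` are limits as `r → 0+`,
and the existence of all four limits is part of the condition. Only `l = 1, 2` are used. -/
def BoundaryCondition (l : ℕ) (κ : ℝ) (v : ℝ → ℂ) : Prop :=
  match l with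
  | 1 => ∃ c : ℂ,
      Tendsto v (𝓝[>] 0) (𝓝 0) ∧
      Tendsto (deriv v) (𝓝[>] 0) (𝓝 c) ∧
      Tendsto (iteratedDeriv 2 v) (𝓝[>] 0) (𝓝 (-(2 * (√2 : ℝ) / 3) * κ * c)) ∧
      Tendsto (iteratedDeriv 3 v) (𝓝[>] 0) (𝓝 0)
  | 2 => ∃ c : ℂ,
      Tendsto v (𝓝[>] 0) (𝓝 c) ∧
      Tendsto (deriv v) (𝓝[>] 0) (𝓝 0) ∧
      Tendsto (iteratedDeriv 2 v) (𝓝[>] 0) (𝓝 0) ∧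
      Tendsto (iteratedDeriv 3 v) (𝓝[>] 0) (𝓝 (-(2 * (√2 : ℝ) / 5) * (κ : ℂ) ^ 3 * c))
  | _ => False

/-! ### The operator `T_{lκ}²` in `L²(0, ∞)` -/

/-- The Hilbert space `L²((0, ∞), dr)`. -/
abbrev HalfLineL2 : Type := Lp ℂ 2 (volume.restrict (Ioi (0 : ℝ)))

/-- The integrated form of `-ψ'' + l(l+1)/r² ψ = f` on `(0, ∞)`. For `ψ` continuously differentiable
and `f` locally integrable on `(0, ∞)` it says that `ψ'` is locally absolutely continuous
and that `T_l ψ = f` almost everywhere. -/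
def SolvesTAE (l : ℕ) (ψ f : ℝ → ℂ) : Prop :=
  ∀ a b : ℝ, 0 < a → a ≤ b →
    deriv ψ b - deriv ψ a =
      ∫ r in a..b, ((l : ℂ) * ((l : ℂ) + 1) / (r : ℂ) ^ 2 * ψ r - f r)

/-- `φ` is a regular representative of an element of the domain of `T_{lκ}²`, on which the fourth
order operation takes the value `f`: `φ` is `C³` on `(0, ∞)`, the derivative of
`T_l φ` is locally absolutely continuous, `T_l (T_l φ) = f` almost everywhere,
and `φ` satisfies the boundary condition at zero. -/
structure IsDomainRep (l : ℕ) (κ : ℝ) (φ f : ℝ → ℂ) : Prop where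
  contDiffOn : ContDiffOn ℝ 3 φ (Ioi 0)
  solves : SolvesTAE l (radialT l φ) f
  boundary : BoundaryCondition l κ φ

theorem contDiffAt_of_pos {φ : ℝ → ℂ} (h : ContDiffOn ℝ 3 φ (Ioi 0)) {r : ℝ} (hr : 0 < r) :
    ContDiffAt ℝ 3 φ r :=
  h.contDiffAt (Ioi_mem_nhds hr)

theorem iteratedDeriv_add_of_pos {φ ψ : ℝ → ℂ} (hφ : ContDiffOn ℝ 3 φ (Ioi 0))
    (hψ : ContDiffOn ℝ 3 ψ (Ioi 0)) {k : ℕ} (hk : k ≤ 3) {r : ℝ} (hr : 0 < r) :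
    iteratedDeriv k (φ + ψ) r = iteratedDeriv k φ r + iteratedDeriv k ψ r :=
  iteratedDeriv_add ((contDiffAt_of_pos hφ hr).of_le (by exact_mod_cast hk))
    ((contDiffAt_of_pos hψ hr).of_le (by exact_mod_cast hk))

theorem radialT_add_of_pos (l : ℕ) {φ ψ : ℝ → ℂ} (hφ : ContDiffOn ℝ 3 φ (Ioi 0))
    (hψ : ContDiffOn ℝ 3 ψ (Ioi 0)) {r : ℝ} (hr : 0 < r) :
    radialT l (φ + ψ) r = radialT l φ r + radialT l ψ r := by
  simp only [radialT, iteratedDeriv_add_of_pos hφ hψ (by norm_num : 2 ≤ 3) hr, Pi.add_apply]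
  ring

theorem radialT_smul (l : ℕ) (c : ℂ) (φ : ℝ → ℂ) : radialT l (c • φ) = c • radialT l φ := by
  funext r
  simp only [radialT, iteratedDeriv_const_smul_field, Pi.smul_apply, smul_eq_mul]
  ring

theorem radialT_contDiffOn (l : ℕ) {φ : ℝ → ℂ} (hφ : ContDiffOn ℝ 3 φ (Ioi 0)) :
    ContDiffOn ℝ 1 (radialT l φ) (Ioi 0) := by
  have h2 : ContDiffOn ℝ 1 (iteratedDeriv 2 φ) (Ioi 0) := by
    have h1 : ContDiffOn ℝ 2 (deriv φ) (Ioi 0) :=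
      hφ.deriv_of_isOpen isOpen_Ioi (by norm_num)
    have := h1.deriv_of_isOpen (m := 1) isOpen_Ioi (by norm_num)
    simpa [iteratedDeriv_succ, iteratedDeriv_zero] using this
  have hof : ContDiffOn ℝ 1 (fun r : ℝ => (r : ℂ)) (Ioi 0) :=
    Complex.ofRealCLM.contDiff.contDiffOn
  have hpot : ContDiffOn ℝ 1 (fun r : ℝ => (l : ℂ) * ((l : ℂ) + 1) / (r : ℂ) ^ 2) (Ioi 0) := by
    simp only [div_eq_mul_inv]
    refine contDiffOn_const.mul ((hof.pow 2).inv ?_)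
    intro r hr
    have : (r : ℂ) ≠ 0 := by exact_mod_cast (ne_of_gt hr)
    exact pow_ne_zero 2 this
  exact h2.neg.add (hpot.mul (hφ.of_le (by norm_num)))

theorem BoundaryCondition.add {l : ℕ} {κ : ℝ} {φ ψ : ℝ → ℂ}
    (hφ : ContDiffOn ℝ 3 φ (Ioi 0)) (hψ : ContDiffOn ℝ 3 ψ (Ioi 0))
    (h₁ : BoundaryCondition l κ φ) (h₂ : BoundaryCondition l κ ψ) :
    BoundaryCondition l κ (φ + ψ) := by
  have key : ∀ k ≤ 3, ∀ x y w : ℂ, Tendsto (iteratedDeriv k φ) (𝓝[>] 0) (𝓝 x) →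
      Tendsto (iteratedDeriv k ψ) (𝓝[>] 0) (𝓝 y) → x + y = w →
      Tendsto (iteratedDeriv k (φ + ψ)) (𝓝[>] 0) (𝓝 w) := by
    intro k hk x y w hx hy hw
    subst hw
    refine (hx.add hy).congr' ?_
    filter_upwards [self_mem_nhdsWithin] with r hr
    exact (iteratedDeriv_add_of_pos hφ hψ hk hr).symm
  have k0 := key 0 (by norm_num)
  have k1 := key 1 (by norm_num)
  have k2 := key 2 (by norm_num)
  have k3 := key 3 (by norm_num)
  rw [iteratedDeriv_zero, iteratedDeriv_zero, iteratedDeriv_zero] at k0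
  rw [iteratedDeriv_one, iteratedDeriv_one, iteratedDeriv_one] at k1
  match l, h₁, h₂ with
  | 1, ⟨c, a0, a1, a2, a3⟩, ⟨d, b0, b1, b2, b3⟩ =>
    exact ⟨c + d, k0 _ _ _ a0 b0 (by ring), k1 _ _ _ a1 b1 rfl, k2 _ _ _ a2 b2 (by ring),
      k3 _ _ _ a3 b3 (by ring)⟩
  | 2, ⟨c, a0, a1, a2, a3⟩, ⟨d, b0, b1, b2, b3⟩ =>
    exact ⟨c + d, k0 _ _ _ a0 b0 rfl, k1 _ _ _ a1 b1 (by ring), k2 _ _ _ a2 b2 (by ring),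
      k3 _ _ _ a3 b3 (by ring)⟩

theorem BoundaryCondition.smul {l : ℕ} {κ : ℝ} {φ : ℝ → ℂ} (e : ℂ)
    (h₁ : BoundaryCondition l κ φ) : BoundaryCondition l κ (e • φ) := by
  have key : ∀ k : ℕ, ∀ x w : ℂ, Tendsto (iteratedDeriv k φ) (𝓝[>] 0) (𝓝 x) →
      e * x = w → Tendsto (iteratedDeriv k (e • φ)) (𝓝[>] 0) (𝓝 w) := by
    intro k x w hx hw
    subst hw
    refine (hx.const_mul e).congr fun r => ?_
    simp
  have k0 := key 0
  have k1 := key 1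
  rw [iteratedDeriv_zero, iteratedDeriv_zero] at k0
  rw [iteratedDeriv_one, iteratedDeriv_one] at k1
  match l, h₁ with
  | 1, ⟨c, a0, a1, a2, a3⟩ =>
    exact ⟨e * c, k0 _ _ a0 (by ring), k1 _ _ a1 rfl, key _ _ _ a2 (by ring),
      key _ _ _ a3 (by ring)⟩
  | 2, ⟨c, a0, a1, a2, a3⟩ =>
    exact ⟨e * c, k0 _ _ a0 rfl, k1 _ _ a1 (by ring), key _ _ _ a2 (by ring),
      key _ _ _ a3 (by ring)⟩

theorem BoundaryCondition.zero {l : ℕ} (hl : l = 1 ∨ l = 2) (κ : ℝ) :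
    BoundaryCondition l κ (0 : ℝ → ℂ) := by
  have key : ∀ k : ℕ, ∀ w : ℂ, w = 0 →
      Tendsto (iteratedDeriv k (0 : ℝ → ℂ)) (𝓝[>] 0) (𝓝 w) := by
    intro k w hw
    subst hw
    refine tendsto_const_nhds.congr fun r => ?_
    simp
  have k0 := key 0
  have k1 := key 1
  rw [iteratedDeriv_zero] at k0
  rw [iteratedDeriv_one] at k1
  rcases hl with rfl | rfl
  · exact ⟨0, k0 _ rfl, k1 _ rfl, key _ _ (by ring), key _ _ rfl⟩
  · exact ⟨0, k0 _ rfl, k1 _ rfl, key _ _ rfl, key _ _ (by ring)⟩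

/-- An element of `L²(0, ∞)` is integrable on compact intervals in `(0, ∞)`. -/
theorem HalfLineL2.intervalIntegrable (f : HalfLineL2) {a b : ℝ} (ha : 0 < a) (hab : a ≤ b) :
    IntervalIntegrable f volume a b := by
  rw [intervalIntegrable_iff_integrableOn_Ioc_of_le hab]
  have hsub : Ioc a b ⊆ Ioi (0 : ℝ) := fun x hx => ha.trans hx.1
  have h1 : MemLp f 2 (volume.restrict (Ioc a b)) :=
    (Lp.memLp f).mono_measure (Measure.restrict_mono hsub le_rfl)
  exact h1.integrable (by norm_num)

theorem integrable_potential_mul (l : ℕ) {ψ : ℝ → ℂ} (hψ : ContinuousOn ψ (Ioi 0)) {a b : ℝ}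
    (ha : 0 < a) (hab : a ≤ b) :
    IntervalIntegrable (fun r : ℝ => (l : ℂ) * ((l : ℂ) + 1) / (r : ℂ) ^ 2 * ψ r) volume a b := by
  apply ContinuousOn.intervalIntegrable
  rw [uIcc_of_le hab]
  have hsub : Icc a b ⊆ Ioi (0 : ℝ) := fun x hx => ha.trans_le hx.1
  refine (continuousOn_const.div (Complex.continuous_ofReal.continuousOn.pow 2) ?_).mul
    (hψ.mono hsub)
  intro r hr
  have : (r : ℂ) ≠ 0 := by exact_mod_cast (ne_of_gt (hsub hr))
  exact pow_ne_zero 2 this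

theorem intervalIntegral_congr_half {f g : ℝ → ℂ}
    (h : f =ᵐ[volume.restrict (Ioi (0 : ℝ))] g) {a b : ℝ} (ha : 0 < a) (hab : a ≤ b) :
    ∫ r in a..b, f r = ∫ r in a..b, g r := by
  rw [intervalIntegral.integral_of_le hab, intervalIntegral.integral_of_le hab]
  have hsub : Ioc a b ⊆ Ioi (0 : ℝ) := fun x hx => ha.trans hx.1
  exact integral_congr_ae (ae_restrict_of_ae_restrict_of_subset hsub h)

theorem IsDomainRep.add {l : ℕ} {κ : ℝ} {φ₁ φ₂ : ℝ → ℂ} {f₁ f₂ : HalfLineL2}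
    (h₁ : IsDomainRep l κ φ₁ f₁) (h₂ : IsDomainRep l κ φ₂ f₂) :
    IsDomainRep l κ (φ₁ + φ₂) (f₁ + f₂ : HalfLineL2) := by
  refine ⟨h₁.contDiffOn.add h₂.contDiffOn, ?_, h₁.boundary.add h₁.contDiffOn h₂.contDiffOn
    h₂.boundary⟩
  have c₁ := radialT_contDiffOn l h₁.contDiffOn
  have c₂ := radialT_contDiffOn l h₂.contDiffOn
  have hd : ∀ r : ℝ, 0 < r → deriv (radialT l (φ₁ + φ₂)) r =
      deriv (radialT l φ₁) r + deriv (radialT l φ₂) r := by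
    intro r hr
    have he : radialT l (φ₁ + φ₂) =ᶠ[𝓝 r] radialT l φ₁ + radialT l φ₂ := by
      filter_upwards [Ioi_mem_nhds hr] with x hx
      exact radialT_add_of_pos l h₁.contDiffOn h₂.contDiffOn hx
    rw [he.deriv_eq, deriv_add]
    · exact (c₁.contDiffAt (Ioi_mem_nhds hr)).differentiableAt (by norm_num)
    · exact (c₂.contDiffAt (Ioi_mem_nhds hr)).differentiableAt (by norm_num)
  intro a b ha hab
  rw [hd a ha, hd b (ha.trans_le hab)]
  have e : ∀ᵐ r : ℝ ∂(volume.restrict (Ioi (0 : ℝ))),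
      (l : ℂ) * ((l : ℂ) + 1) / (r : ℂ) ^ 2 * radialT l (φ₁ + φ₂) r - (f₁ + f₂ : HalfLineL2) r =
      ((l : ℂ) * ((l : ℂ) + 1) / (r : ℂ) ^ 2 * radialT l φ₁ r - f₁ r) +
      ((l : ℂ) * ((l : ℂ) + 1) / (r : ℂ) ^ 2 * radialT l φ₂ r - f₂ r) := by
    filter_upwards [Lp.coeFn_add f₁ f₂, ae_restrict_mem measurableSet_Ioi] with r hr hr0
    rw [hr, radialT_add_of_pos l h₁.contDiffOn h₂.contDiffOn hr0, Pi.add_apply]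
    ring
  rw [intervalIntegral_congr_half e ha hab, intervalIntegral.integral_add,
    ← h₁.solves a b ha hab, ← h₂.solves a b ha hab]
  · ring
  · exact (integrable_potential_mul l c₁.continuousOn ha hab).sub
      (HalfLineL2.intervalIntegrable f₁ ha hab)
  · exact (integrable_potential_mul l c₂.continuousOn ha hab).sub
      (HalfLineL2.intervalIntegrable f₂ ha hab)

theorem IsDomainRep.smul {l : ℕ} {κ : ℝ} {φ : ℝ → ℂ} {f : HalfLineL2} (c : ℂ)
    (h : IsDomainRep l κ φ f) : IsDomainRep l κ (c • φ) (c • f : HalfLineL2) := by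
  refine ⟨h.contDiffOn.const_smul c, ?_, h.boundary.smul c⟩
  intro a b ha hab
  have e : ∀ᵐ r : ℝ ∂(volume.restrict (Ioi (0 : ℝ))),
      (l : ℂ) * ((l : ℂ) + 1) / (r : ℂ) ^ 2 * radialT l (c • φ) r - (c • f : HalfLineL2) r =
      c * ((l : ℂ) * ((l : ℂ) + 1) / (r : ℂ) ^ 2 * radialT l φ r - f r) := by
    filter_upwards [Lp.coeFn_smul c f] with r hr
    rw [hr, radialT_smul, Pi.smul_apply, Pi.smul_apply, smul_eq_mul, smul_eq_mul]
    ring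
  rw [intervalIntegral_congr_half e ha hab, intervalIntegral.integral_const_mul,
    ← h.solves a b ha hab, radialT_smul, deriv_const_smul_field, deriv_const_smul_field,
    smul_eq_mul, smul_eq_mul]
  ring

theorem IsDomainRep.zero {l : ℕ} (hl : l = 1 ∨ l = 2) (κ : ℝ) :
    IsDomainRep l κ (0 : ℝ → ℂ) (0 : HalfLineL2) := by
  have hT : radialT l (0 : ℝ → ℂ) = 0 := by
    have := radialT_smul l 0 (0 : ℝ → ℂ)
    simpa using this
  refine ⟨contDiffOn_const, ?_, BoundaryCondition.zero hl κ⟩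
  intro a b ha hab
  have e : ∀ᵐ r : ℝ ∂(volume.restrict (Ioi (0 : ℝ))),
      (l : ℂ) * ((l : ℂ) + 1) / (r : ℂ) ^ 2 * radialT l (0 : ℝ → ℂ) r - (0 : HalfLineL2) r =
      0 := by
    filter_upwards [Lp.coeFn_zero ℂ 2 (volume.restrict (Ioi (0 : ℝ)))] with r hr
    rw [hr, hT]
    simp
  rw [intervalIntegral_congr_half e ha hab, hT, intervalIntegral.integral_zero]
  have hd : deriv (0 : ℝ → ℂ) = 0 := by
    funext x
    exact deriv_const x (0 : ℂ)
  simp [hd]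

/-- The value of the fourth order operation is determined by the function. -/
theorem IsDomainRep.value_eq_zero {l : ℕ} {κ : ℝ} {φ : ℝ → ℂ} {f : HalfLineL2}
    (h : IsDomainRep l κ φ f) (h0 : φ =ᵐ[volume.restrict (Ioi (0 : ℝ))] 0) : f = 0 := by
  have hφ : EqOn φ 0 (Ioi 0) := by
    refine Measure.eqOn_open_of_ae_eq h0 isOpen_Ioi h.contDiffOn.continuousOn continuousOn_const
  have hT : EqOn (radialT l φ) 0 (Ioi 0) := by
    intro r hr
    have he : φ =ᶠ[𝓝 r] (0 : ℂ) • (0 : ℝ → ℂ) := by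
      filter_upwards [Ioi_mem_nhds hr] with x hx
      simpa using hφ hx
    have h2 : iteratedDeriv 2 φ r = 0 := by
      rw [(he.iteratedDeriv 2).eq_of_nhds, iteratedDeriv_const_smul_field, zero_smul]
    simp [radialT, h2, hφ hr]
  have hd : ∀ r : ℝ, 0 < r → deriv (radialT l φ) r = 0 := by
    intro r hr
    have he : radialT l φ =ᶠ[𝓝 r] fun _ => (0 : ℂ) := by
      filter_upwards [Ioi_mem_nhds hr] with x hx
      exact hT hx
    rw [he.deriv_eq, deriv_const]
  have hint : ∀ a b : ℝ, 0 < a → a ≤ b → ∫ r in a..b, f r = 0 := by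
    intro a b ha hab
    have e := h.solves a b ha hab
    rw [hd a ha, hd b (ha.trans_le hab)] at e
    have e' : ∫ r in a..b, ((l : ℂ) * ((l : ℂ) + 1) / (r : ℂ) ^ 2 * radialT l φ r - f r) =
        ∫ r in a..b, -f r := by
      refine intervalIntegral.integral_congr fun r hr => ?_
      rw [uIcc_of_le hab] at hr
      have : radialT l φ r = 0 := hT (ha.trans_le hr.1)
      simp [this]
    rw [e', intervalIntegral.integral_neg] at e
    simpa using e.symm
  have hae : ∀ n : ℕ, ∀ᵐ x : ℝ, x ∈ Ioo (1 / ((n : ℝ) + 1)) ((n : ℝ) + 1) → f x = 0 := by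
    intro n
    have hp : (0 : ℝ) < 1 / ((n : ℝ) + 1) := by positivity
    rcases le_total (1 / ((n : ℝ) + 1)) ((n : ℝ) + 1) with hle | hle
    · filter_upwards [(HalfLineL2.intervalIntegrable f hp hle).ae_hasDerivAt_integral]
        with x hx hxm
      have hx' := hx (by rw [uIcc_of_le hle]; exact ⟨hxm.1.le, hxm.2.le⟩)
        (1 / ((n : ℝ) + 1)) (by simp)
      have he : (fun y => ∫ t in (1 / ((n : ℝ) + 1))..y, f t) =ᶠ[𝓝 x] fun _ => (0 : ℂ) := by
        filter_upwards [Ioi_mem_nhds hxm.1] with y hy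
        exact hint _ _ hp (le_of_lt hy)
      exact (hx'.congr_of_eventuallyEq he.symm).unique (hasDerivAt_const x (0 : ℂ))
    · filter_upwards with x hxm
      exact absurd (hxm.1.trans hxm.2) (not_lt.mpr hle)
  apply Lp.ext
  refine EventuallyEq.trans ?_ (Lp.coeFn_zero ℂ 2 (volume.restrict (Ioi (0 : ℝ)))).symm
  refine (ae_restrict_iff' measurableSet_Ioi).mpr ?_
  filter_upwards [ae_all_iff.mpr hae] with x hx hx0
  obtain ⟨n, hn⟩ := exists_nat_gt (max x (1 / x))
  have hx0' : (0 : ℝ) < x := hx0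
  refine hx n ⟨?_, ?_⟩
  · have h1 : 1 / x < (n : ℝ) + 1 := ((le_max_right _ _).trans_lt hn).trans (by linarith)
    exact (one_div_lt (by positivity) hx0').mpr h1
  · exact ((le_max_left _ _).trans_lt hn).trans (by linarith)

/-- The graph of `T_{lκ}²`: pairs `(u, f)` in `L²(0, ∞)` such that `u` has a regular representative
satisfying the boundary condition, and `T_l² u = f`. -/
def graphTSq (l : ℕ) (hl : l = 1 ∨ l = 2) (κ : ℝ) : Submodule ℂ (HalfLineL2 × HalfLineL2) where
  carrier := {p | ∃ φ : ℝ → ℂ, p.1 =ᵐ[volume.restrict (Ioi (0 : ℝ))] φ ∧ IsDomainRep l κ φ p.2}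
  add_mem' := by
    rintro p q ⟨φ₁, e₁, h₁⟩ ⟨φ₂, e₂, h₂⟩
    exact ⟨φ₁ + φ₂, (Lp.coeFn_add p.1 q.1).trans (e₁.add e₂), h₁.add h₂⟩
  zero_mem' := ⟨0, Lp.coeFn_zero ℂ 2 _, IsDomainRep.zero hl κ⟩
  smul_mem' := by
    rintro c p ⟨φ, e, h⟩
    exact ⟨c • φ, (Lp.coeFn_smul c p.1).trans (e.const_smul c), h.smul c⟩

theorem graphTSq_single_valued (l : ℕ) (hl : l = 1 ∨ l = 2) (κ : ℝ) :
    ∀ p ∈ graphTSq l hl κ, p.1 = 0 → p.2 = 0 := by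
  rintro p ⟨φ, e, h⟩ hp
  refine h.value_eq_zero (e.symm.trans ?_)
  rw [hp]
  exact Lp.coeFn_zero ℂ 2 _

/-- The operator `T_{lκ}²` in `L²(0, ∞)`: the operation `(-d²/dr² + l(l+1)/r²)²` on
the square integrable functions `u` with `T_l² u` square integrable which satisfy the
boundary condition with parameter `κ`. -/
def operatorTSq (l : ℕ) (hl : l = 1 ∨ l = 2) (κ : ℝ) : HalfLineL2 →ₗ.[ℂ] HalfLineL2 :=
  (graphTSq l hl κ).toLinearPMap

theorem operatorTSq_graph (l : ℕ) (hl : l = 1 ∨ l = 2) (κ : ℝ) :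
    (operatorTSq l hl κ).graph = graphTSq l hl κ :=
  Submodule.toLinearPMap_graph_eq _ (graphTSq_single_valued l hl κ)

/-- The bounded operator `G` is the resolvent `(A - ζ)⁻¹`. -/
def IsResolventAt (A : HalfLineL2 →ₗ.[ℂ] HalfLineL2) (ζ : ℂ) (G : HalfLineL2 →L[ℂ] HalfLineL2) :
    Prop :=
  (∀ f : HalfLineL2, ∃ h : G f ∈ A.domain, A ⟨G f, h⟩ - ζ • G f = f) ∧
  ∀ u : A.domain, G (A u - ζ • (u : HalfLineL2)) = u

/-- `K` is the kernel of `G`: `(G f)(r) = ∫₀^∞ K(r,s) f(s) ds`, with absolutely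
convergent integrals. -/
def HasKernel (G : HalfLineL2 →L[ℂ] HalfLineL2) (K : ℝ → ℝ → ℂ) : Prop :=
  ∀ f : HalfLineL2,
    (∀ r : ℝ, 0 < r → IntegrableOn (fun s => K r s * f s) (Ioi 0)) ∧
    ∀ᵐ r ∂(volume.restrict (Ioi (0 : ℝ))), G f r = ∫ s in Ioi (0 : ℝ), K r s * f s

/-- `(T_l² - ζ) E = δ(r - s)` on `(0, ∞)` in the sense of distributions. The operation `T_l²`
has real coefficients and coincides with its formal transpose. -/
def IsFundamentalSolution (l : ℕ) (ζ : ℂ) (s : ℝ) (E : ℝ → ℂ) : Prop :=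
  LocallyIntegrableOn E (Ioi 0) ∧
  ∀ χ : ℝ → ℂ, ContDiff ℝ ∞ χ → HasCompactSupport χ → tsupport χ ⊆ Ioi 0 →
    ∫ r in Ioi (0 : ℝ), E r * (radialT l (radialT l χ) r - ζ * χ r) = χ s

/-! ### The explicit kernel -/

/-- The common denominator of the coefficients `α_±`, `β_±`. -/
def coeffDen (l : ℕ) (κ : ℝ) (z : ℂ) : ℂ :=
  if l = 1 then (Complex.I - 1) * z + (√2 : ℝ) * κ
  else (Complex.I + 1) * z ^ 3 + (√2 : ℝ) * (κ : ℂ) ^ 3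

def alphaPlus (l : ℕ) (κ : ℝ) (z : ℂ) : ℂ :=
  if l = 1 then -((Complex.I + 1) * z + (√2 : ℝ) * κ) / coeffDen l κ z
  else -((Complex.I - 1) * z ^ 3 + (√2 : ℝ) * (κ : ℂ) ^ 3) / coeffDen l κ z

def betaPlus (l : ℕ) (κ : ℝ) (z : ℂ) : ℂ :=
  if l = 1 then 2 * z / coeffDen l κ z
  else -(2 * z ^ 3) / coeffDen l κ z

def alphaMinus (l : ℕ) (κ : ℝ) (z : ℂ) : ℂ :=
  if l = 1 then ((Complex.I + 1) * z - (√2 : ℝ) * κ) / coeffDen l κ z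
  else -((1 - Complex.I) * z ^ 3 + (√2 : ℝ) * (κ : ℂ) ^ 3) / coeffDen l κ z

def betaMinus (l : ℕ) (κ : ℝ) (z : ℂ) : ℂ :=
  if l = 1 then -(2 * Complex.I * z) / coeffDen l κ z
  else -(2 * Complex.I * z ^ 3) / coeffDen l κ z

def wPlus (l : ℕ) (z : ℂ) : ℂ := if l = 1 then -2 * z ^ 3 else 2 * z ^ 5

def wMinus (l : ℕ) (z : ℂ) : ℂ :=
  if l = 1 then -2 * Complex.I * z ^ 3 else -2 * Complex.I * z ^ 5

/-- `g_+ = D_l e^{-zr}`. -/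
def gPlus (l : ℕ) (z : ℂ) : ℝ → ℂ := opD l fun r => Complex.exp (-(z * r))

/-- `g_- = D_l e^{izr}`. -/
def gMinus (l : ℕ) (z : ℂ) : ℝ → ℂ := opD l fun r => Complex.exp (Complex.I * z * r)

/-- `h̃_+ = D_l (e^{zr} + α_+ e^{-zr})`. -/
def hTildePlus (l : ℕ) (κ : ℝ) (z : ℂ) : ℝ → ℂ :=
  opD l fun r => Complex.exp (z * r) + alphaPlus l κ z * Complex.exp (-(z * r))

/-- `h̃_- = D_l (e^{-izr} + α_- e^{izr})`. -/
def hTildeMinus (l : ℕ) (κ : ℝ) (z : ℂ) : ℝ → ℂ :=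
  opD l fun r => Complex.exp (-(Complex.I * z * r)) +
    alphaMinus l κ z * Complex.exp (Complex.I * z * r)

/-- `h_+ = D_l (e^{zr} + α_+ e^{-zr} + β_+ e^{izr})`. -/
def hPlus (l : ℕ) (κ : ℝ) (z : ℂ) : ℝ → ℂ :=
  opD l fun r => Complex.exp (z * r) + alphaPlus l κ z * Complex.exp (-(z * r)) +
    betaPlus l κ z * Complex.exp (Complex.I * z * r)

/-- `h_- = D_l (e^{-izr} + α_- e^{izr} + β_- e^{-zr})`. -/
def hMinus (l : ℕ) (κ : ℝ) (z : ℂ) : ℝ → ℂ :=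
  opD l fun r => Complex.exp (-(Complex.I * z * r)) +
    alphaMinus l κ z * Complex.exp (Complex.I * z * r) +
    betaMinus l κ z * Complex.exp (-(z * r))

/-- The Heaviside function, normalized by `θ(x) + θ(-x) = 1`. -/
def theta (x : ℝ) : ℂ := if x < 0 then 0 else if x = 0 then 1 / 2 else 1

/-- The resolvent kernel `R(r, s; z)`. -/
def resolventKernel (l : ℕ) (κ : ℝ) (z : ℂ) (r s : ℝ) : ℂ :=
  1 / (2 * z ^ 2 * wMinus l z) *
      (hMinus l κ z r * gMinus l z s * theta (s - r) +
        hMinus l κ z s * gMinus l z r * theta (r - s)) -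
    1 / (2 * z ^ 2 * wPlus l z) *
      (hPlus l κ z r * gPlus l z s * theta (s - r) +
        hPlus l κ z s * gPlus l z r * theta (r - s))

end

end ResKernel

/-!
All functions in the theorem are combinations `∑ c_j D_l e^{a_j r}`, where `a_0, …, a_3` are the
fourth roots `z, iz, -z, -iz` of `z⁴`. Since `T_l D_l e^{ar} = -a² D_l e^{ar}`, the operation `T_l`
acts on the coefficients `c_j`, and every combination solves `T_l² u = z⁴ u` (`sol`, `sol_tau`,
`opD_sum_exp`). Writing `D_l e^{ar}` as a smooth function plus an explicit power of `r` (`jet`), the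
boundary condition at zero becomes two linear conditions on the moments `∑ c_j a_j^n`
(`boundaryCondition_sol_iff`), which `h_±` satisfy by the choice of `α_±`, `β_±`. The denominator
`d` vanishes only if `κ > 0` and `z⁴ = -κ⁴` (`coeffDen_ne_zero`).

The kernel is `∑ φ_i(min) ψ_i(max)` with `φ` proportional to `h_-, h_+` and `ψ = g_-, g_+`. As
`β_- / W_- = -β_+ / W_+`, the terms with `β_±` cancel in the jumps across the diagonal: the kernel
and its derivatives up to order two are continuous there, and the third derivative jumps by one
(`jump_one`, `jump_tau`, `jump_tau_one`). Lagrange's identity on both sides of the diagonal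
then gives the equation with the delta function.

Each `g_±` is singular like `r^{-l}` at zero. The kernel is therefore regrouped as
`(φ_0 + φ_1)(r) g_-(s) + φ_1(r) (g_+ - g_-)(s)`, where `φ_0 + φ_1` vanishes to order `l + 3` at zero
and `g_+ - g_-` is regular (`reg_phi_add`, `kernelLE_eq`). This yields the bound
`|R(r, s)| ≤ C e^{-m |r - s|}` with `m = min (re z) (im z)` (`norm_resolventKernel_le`), hence a
bounded operator `G` by Schur's test (`exists_hasKernel`), and the boundary condition for `G f`.
That `G f` solves `T_l² u - z⁴ u = f` is variation of constants (`greenJet`,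
`Admissible.isDomainRep_greenJet`).

It remains to see that `T_{lκ}² u = z⁴ u` has only the trivial solution in the domain. The functions
`T_l u ± z² u` solve second order equations, so by wronskians `u` is a combination of the four
`D_l e^{a_j r}` (`exists_eq_sol`); square integrability excludes the two growing ones
(`growing_coeff_eq_zero`), and then the boundary condition, because of `d ≠ 0`, excludes the two
decaying ones (`decaying_coeff_eq_zero`).
-/

namespace ResKernel

noncomputable section

/-! ### Products of smooth and absolutely continuous functions -/

/-- A primitive of a complex-valued integrable function is absolutely continuous. -/
theorem absolutelyContinuousOnInterval_of_primitive {F f : ℝ → ℂ} {a b : ℝ}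
    (h : IntervalIntegrable f volume a b)
    (hF : ∀ r ∈ uIcc a b, F r = F a + ∫ s in a..r, f s) :
    AbsolutelyContinuousOnInterval F a b := by
  have hre : IntervalIntegrable (fun x => (f x).re) volume a b := ⟨h.1.re, h.2.re⟩
  have him : IntervalIntegrable (fun x => (f x).im) volume a b := ⟨h.1.im, h.2.im⟩
  have hc : ∀ c : ℂ, AbsolutelyContinuousOnInterval (fun _ : ℝ => c) a b := fun c =>
    (contDiff_const.contDiffOn (s := uIcc a b)).absolutelyContinuousOnInterval
  have h1 := ((hre.absolutelyContinuousOnInterval_intervalIntegral left_mem_uIcc).smul (hc 1))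
  have h2 := ((him.absolutelyContinuousOnInterval_intervalIntegral left_mem_uIcc).smul
    (hc Complex.I))
  set K : ℝ → ℂ := fun x => F a + ((∫ v in a..x, (f v).re) • (1 : ℂ) +
    (∫ v in a..x, (f v).im) • Complex.I) with hK
  have key : AbsolutelyContinuousOnInterval K a b := (hc (F a)).add (h1.add h2)
  unfold AbsolutelyContinuousOnInterval at key ⊢
  refine key.congr' ?_
  have hval : ∀ x ∈ uIcc a b, K x = F x := by
    intro x hx
    have hi : IntervalIntegrable f volume a x := h.mono_set (uIcc_subset_uIcc_left hx)
    rw [hF x hx, hK]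
    apply Complex.ext
    · have := intervalIntegral.intervalIntegral_re hi
      simpa using this
    · have := intervalIntegral.intervalIntegral_im hi
      simpa using this
  filter_upwards [mem_inf_of_right (mem_principal_self _)] with E hE
  refine Finset.sum_congr rfl fun i hi => ?_
  rw [hval _ (hE.1 i hi).1, hval _ (hE.1 i hi).2]

/-- Integration by parts for a continuously differentiable factor `P` and an absolutely continuous
factor `M` with integrable derivative `m`. The difference of both sides, as a function of the upper
limit, is absolutely continuous with almost everywhere vanishing derivative. -/
theorem mul_sub_mul_eq_integral {P P' M m : ℝ → ℂ} {a b : ℝ} (hab : a ≤ b)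
    (hP : ∀ r ∈ Icc a b, HasDerivAt P (P' r) r) (hP' : ContinuousOn P' (Icc a b))
    (hm : IntervalIntegrable m volume a b)
    (hM : ∀ r ∈ Icc a b, M r - M a = ∫ s in a..r, m s) :
    IntervalIntegrable (fun r => P' r * M r + P r * m r) volume a b ∧
    P b * M b - P a * M a = ∫ r in a..b, (P' r * M r + P r * m r) := by
  have hu : uIcc a b = Icc a b := uIcc_of_le hab
  have hPc : ContinuousOn P (Icc a b) := fun r hr => (hP r hr).continuousAt.continuousWithinAt
  have hM' : ∀ r ∈ uIcc a b, M r = M a + ∫ s in a..r, m s := fun r hr => by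
    rw [← hM r (hu ▸ hr)]; ring
  have hMac := absolutelyContinuousOnInterval_of_primitive hm hM'
  have hMc : ContinuousOn M (Icc a b) := hu ▸ hMac.continuousOn
  have hPac : AbsolutelyContinuousOnInterval P a b := by
    refine absolutelyContinuousOnInterval_of_primitive (f := P') ?_ fun r hr => ?_
    · exact (hu.symm ▸ hP' : ContinuousOn P' (uIcc a b)).intervalIntegrable
    · rw [hu] at hr
      have hsub : uIcc a r ⊆ Icc a b := by
        rw [uIcc_of_le hr.1]; exact Icc_subset_Icc_right hr.2
      rw [intervalIntegral.integral_eq_sub_of_hasDerivAt (fun x hx => hP x (hsub hx))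
        (hP'.mono hsub).intervalIntegrable]
      ring
  have hint : IntervalIntegrable (fun r => P' r * M r + P r * m r) volume a b := by
    refine IntervalIntegrable.add ?_ ?_
    · exact (hu.symm ▸ hP'.mul hMc :
        ContinuousOn (fun r => P' r * M r) (uIcc a b)).intervalIntegrable
    · exact hm.continuousOn_mul (hu.symm ▸ hPc)
  refine ⟨hint, ?_⟩
  set G : ℝ → ℂ := fun x => ∫ r in a..x, (P' r * M r + P r * m r) with hG
  have hGac : AbsolutelyContinuousOnInterval G a b :=
    absolutelyContinuousOnInterval_of_primitive hint fun r _ => by simp [hG]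
  obtain ⟨C, hC⟩ := ((hPac.smul hMac).sub hGac).const_of_ae_hasDerivAt_zero (by
    have ha : ∀ᵐ x : ℝ, x ≠ a := by simp [ae_iff, measure_singleton]
    have hb : ∀ᵐ x : ℝ, x ≠ b := by simp [ae_iff, measure_singleton]
    filter_upwards [hm.ae_hasDerivAt_integral, hint.ae_hasDerivAt_integral, ha, hb]
      with x h1 h2 hxa hxb hx
    have hx' := hu ▸ hx
    have d1 := (h1 hx a left_mem_uIcc).const_add (M a)
    have d2 := h2 hx a left_mem_uIcc
    have hnhds : Icc a b ∈ 𝓝 x :=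
      Icc_mem_nhds (lt_of_le_of_ne hx'.1 hxa.symm) (lt_of_le_of_ne hx'.2 hxb)
    have d3 : HasDerivAt M (m x) x := by
      refine d1.congr_of_eventuallyEq ?_
      filter_upwards [hnhds] with y hy
      exact hM' y (hu.symm ▸ hy)
    have d4 := ((hP x hx').mul d3).sub d2
    rw [sub_self] at d4
    exact d4)
  have e1 := hC a left_mem_uIcc
  have e2 := hC b right_mem_uIcc
  simp only [Pi.sub_apply, smul_eq_mul, Pi.mul_apply, hG, intervalIntegral.integral_same] at e1 e2
  rw [← e2] at e1
  linear_combination -e1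

/-- The product rule for a finite sum of products, in integrated form. -/
theorem sum_mul_sub_eq_integral {ι : Type*} (s : Finset ι) {P P' M m : ι → ℝ → ℂ} {a b : ℝ}
    (hab : a ≤ b)
    (hP : ∀ i ∈ s, ∀ r ∈ Icc a b, HasDerivAt (P i) (P' i r) r)
    (hP' : ∀ i ∈ s, ContinuousOn (P' i) (Icc a b))
    (hm : ∀ i ∈ s, IntervalIntegrable (m i) volume a b)
    (hM : ∀ i ∈ s, ∀ r ∈ Icc a b, M i r - M i a = ∫ t in a..r, m i t) :
    (∑ i ∈ s, P i b * M i b) - (∑ i ∈ s, P i a * M i a) =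
      ∫ r in a..b, ((∑ i ∈ s, P' i r * M i r) + ∑ i ∈ s, P i r * m i r) := by
  simp only [← Finset.sum_add_distrib, ← Finset.sum_sub_distrib]
  have h := fun i hi => mul_sub_mul_eq_integral hab (hP i hi) (hP' i hi) (hm i hi) (hM i hi)
  rw [intervalIntegral.integral_finsetSum fun i hi => (h i hi).1]
  exact Finset.sum_congr rfl fun i hi => (h i hi).2

/-! ### Moment functions of the exponential -/

/-- The `k`-th derivative of the entire function `r ↦ (e^{ar} - 1) / r`, written as an integral,
so that it makes sense at `r = 0` too. -/
def expMoment (a : ℂ) (k : ℕ) (r : ℝ) : ℂ :=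
  ∫ t in (0 : ℝ)..1, (t : ℂ) ^ k * a ^ (k + 1) * Complex.exp (a * r * t)

theorem expMoment_hasDerivAt (a : ℂ) (k : ℕ) (r : ℝ) :
    HasDerivAt (expMoment a k) (expMoment a (k + 1) r) r := by
  have hcont : ∀ (m : ℕ) (x : ℝ), Continuous fun t : ℝ =>
      (t : ℂ) ^ m * a ^ (m + 1) * Complex.exp (a * x * t) := fun m x => by fun_prop
  refine (intervalIntegral.hasDerivAt_integral_of_dominated_loc_of_deriv_le
    (F := fun (x : ℝ) (t : ℝ) => (t : ℂ) ^ k * a ^ (k + 1) * Complex.exp (a * x * t))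
    (F' := fun (x : ℝ) (t : ℝ) => (t : ℂ) ^ (k + 1) * a ^ (k + 1 + 1) * Complex.exp (a * x * t))
    (bound := fun _ => ‖a‖ ^ (k + 1 + 1) * Real.exp (‖a‖ * (|r| + 1)))
    (Metric.ball_mem_nhds r one_pos) (Eventually.of_forall fun x => ?_)
    ((hcont k r).intervalIntegrable _ _) ((hcont (k + 1) r).aestronglyMeasurable)
    (Eventually.of_forall fun t ht x hx => ?_) intervalIntegrable_const
    (Eventually.of_forall fun t ht x hx => ?_)).2
  · exact (hcont k x).aestronglyMeasurable
  · rw [uIoc_of_le zero_le_one] at ht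
    have hx' : |x| ≤ |r| + 1 := by
      have h1 : |x - r| < 1 := by simpa [Real.dist_eq] using hx
      have h2 := abs_sub_abs_le_abs_sub x r
      linarith
    rw [norm_mul, norm_mul, norm_pow, norm_pow, Complex.norm_real, Real.norm_eq_abs,
      abs_of_pos ht.1]
    have h1 : t ^ (k + 1) ≤ 1 := pow_le_one₀ ht.1.le ht.2
    have h2 : ‖Complex.exp (a * x * t)‖ ≤ Real.exp (‖a‖ * (|r| + 1)) := by
      refine (Complex.norm_exp_le_exp_norm _).trans (Real.exp_le_exp.mpr ?_)
      rw [norm_mul, norm_mul, Complex.norm_real, Complex.norm_real, Real.norm_eq_abs,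
        Real.norm_eq_abs, abs_of_pos ht.1]
      calc ‖a‖ * |x| * t ≤ ‖a‖ * |x| * 1 := by gcongr; exact ht.2
        _ ≤ ‖a‖ * (|r| + 1) := by rw [mul_one]; gcongr
    calc t ^ (k + 1) * ‖a‖ ^ (k + 1 + 1) * ‖Complex.exp (a * x * t)‖
        ≤ 1 * ‖a‖ ^ (k + 1 + 1) * Real.exp (‖a‖ * (|r| + 1)) := by gcongr
      _ = _ := by rw [one_mul]
  · have h1 : HasDerivAt (fun y : ℝ => a * (y : ℂ) * t) (a * 1 * t) x :=
      ((Complex.ofRealCLM.hasDerivAt (x := x)).const_mul a).mul_const (t : ℂ)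
    refine (h1.cexp.const_mul ((t : ℂ) ^ k * a ^ (k + 1))).congr_deriv ?_
    ring

theorem expMoment_zero_right (a : ℂ) (k : ℕ) : expMoment a k 0 = a ^ (k + 1) / (k + 1) := by
  have h1 : expMoment a k 0 = ∫ t in (0 : ℝ)..1, ((t ^ k : ℝ) : ℂ) * a ^ (k + 1) := by
    simp [expMoment]
  rw [h1, intervalIntegral.integral_mul_const, intervalIntegral.integral_ofReal, integral_pow]
  push_cast
  simp
  ring

theorem mul_expMoment_zero (a : ℂ) (r : ℝ) :
    (r : ℂ) * expMoment a 0 r = Complex.exp (a * r) - 1 := by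
  have hd : ∀ t : ℝ, HasDerivAt (fun t : ℝ => Complex.exp (a * r * t))
      (r * ((t : ℂ) ^ 0 * a ^ (0 + 1) * Complex.exp (a * r * t))) t := fun t => by
    have h1 : HasDerivAt (fun y : ℝ => a * r * (y : ℂ)) (a * r * 1) t :=
      (Complex.ofRealCLM.hasDerivAt (x := t)).const_mul (a * r)
    convert h1.cexp using 1
    ring
  have hc : Continuous fun t : ℝ => (r : ℂ) * ((t : ℂ) ^ 0 * a ^ (0 + 1) *
    Complex.exp (a * r * t)) := by fun_prop
  have := intervalIntegral.integral_eq_sub_of_hasDerivAt (fun t _ => hd t)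
    (hc.intervalIntegrable 0 1)
  rw [intervalIntegral.integral_const_mul] at this
  rw [expMoment, this]
  simp

theorem mul_expMoment_succ (a : ℂ) (k : ℕ) (r : ℝ) :
    (r : ℂ) * expMoment a (k + 1) r = a ^ (k + 1) * Complex.exp (a * r) -
      (k + 1) * expMoment a k r := by
  have hd : ∀ t : ℝ, HasDerivAt (fun t : ℝ => (t : ℂ) ^ (k + 1) * a ^ (k + 1) *
      Complex.exp (a * r * t))
      (r * ((t : ℂ) ^ (k + 1) * a ^ (k + 1 + 1) * Complex.exp (a * r * t)) +
        (k + 1) * ((t : ℂ) ^ k * a ^ (k + 1) * Complex.exp (a * r * t))) t := fun t => by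
    have h0 := Complex.ofRealCLM.hasDerivAt (x := t)
    have h1 : HasDerivAt (fun y : ℝ => a * r * (y : ℂ)) (a * r * 1) t := h0.const_mul (a * r)
    refine (((h0.pow (k + 1)).mul_const (a ^ (k + 1))).mul h1.cexp).congr_deriv ?_
    simp only [Complex.ofRealCLM_apply, Pi.pow_apply, Nat.add_sub_cancel]
    push_cast
    ring
  have hc : ∀ (m : ℕ) (c : ℂ), Continuous fun t : ℝ => c * ((t : ℂ) ^ m * a ^ (m + 1) *
    Complex.exp (a * r * t)) := fun m c => by fun_prop
  have := intervalIntegral.integral_eq_sub_of_hasDerivAt (fun t _ => hd t)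
    (((hc (k + 1) r).add (hc k (k + 1))).intervalIntegrable 0 1)
  rw [intervalIntegral.integral_add ((hc (k + 1) r).intervalIntegrable 0 1)
    ((hc k (k + 1)).intervalIntegrable 0 1), intervalIntegral.integral_const_mul,
    intervalIntegral.integral_const_mul] at this
  rw [expMoment, expMoment, eq_sub_iff_add_eq, this]
  simp

/-! ### The functions `D_l e^{ar}` and their derivatives -/

/-- The `k`-th derivative of `D_l (e^{ar} - 1)`, a smooth function on the whole line. With
`q(r) = (e^{ar} - 1) / r` one has `D_1 (r q) = r q'` and `D_2 (r q) = r q'' - q'`. -/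
def regJet (l : ℕ) (a : ℂ) (k : ℕ) (r : ℝ) : ℂ :=
  if l = 1 then r * expMoment a (k + 1) r + k * expMoment a k r
  else r * expMoment a (k + 2) r + (k - 1) * expMoment a (k + 1) r

/-- The `k`-th derivative of `D_l 1`, which is `-1/r` for `l = 1` and `3/r²` for `l = 2`. -/
def singJet (l k : ℕ) (r : ℝ) : ℂ :=
  if l = 1 then -(-1) ^ k * (k.factorial : ℂ) / (r : ℂ) ^ (k + 1)
  else 3 * (-1) ^ k * ((k + 1).factorial : ℂ) / (r : ℂ) ^ (k + 2)

/-- The `k`-th derivative of `D_l e^{ar}`. -/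
def jet (l : ℕ) (a : ℂ) (k : ℕ) (r : ℝ) : ℂ := regJet l a k r + singJet l k r

theorem regJet_hasDerivAt (l : ℕ) (a : ℂ) (k : ℕ) (r : ℝ) :
    HasDerivAt (regJet l a k) (regJet l a (k + 1) r) r := by
  have h0 := Complex.ofRealCLM.hasDerivAt (x := r)
  by_cases hl : l = 1
  · subst hl
    have := (h0.mul (expMoment_hasDerivAt a (k + 1) r)).add
      ((expMoment_hasDerivAt a k r).const_mul (k : ℂ))
    refine (this.congr_deriv ?_).congr_of_eventuallyEq (Eventually.of_forall fun x => ?_)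
    · simp [regJet]; ring
    · simp [regJet]
  · have := (h0.mul (expMoment_hasDerivAt a (k + 2) r)).add
      ((expMoment_hasDerivAt a (k + 1) r).const_mul ((k : ℂ) - 1))
    refine (this.congr_deriv ?_).congr_of_eventuallyEq (Eventually.of_forall fun x => ?_)
    · simp [regJet, hl]; ring
    · simp [regJet, hl]

theorem singJet_hasDerivAt (l k : ℕ) {r : ℝ} (hr : 0 < r) :
    HasDerivAt (singJet l k) (singJet l (k + 1) r) r := by
  have h0 := Complex.ofRealCLM.hasDerivAt (x := r)
  have hr' : (r : ℂ) ≠ 0 := by exact_mod_cast hr.ne'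
  have key : ∀ (c : ℂ) (n : ℕ), HasDerivAt (fun x : ℝ => c / (x : ℂ) ^ (n + 1))
      (-(c * (n + 1)) / (r : ℂ) ^ (n + 2)) r := by
    intro c n
    have := ((h0.pow (n + 1)).inv (pow_ne_zero _ hr')).const_mul c
    refine (this.congr_deriv ?_).congr_of_eventuallyEq (Eventually.of_forall fun x => ?_)
    · simp
      field_simp
      ring
    · simp [div_eq_mul_inv]
  by_cases hl : l = 1
  · subst hl
    refine ((key (-(-1) ^ k * (k.factorial : ℂ)) k).congr_deriv ?_).congr_of_eventuallyEq
      (Eventually.of_forall fun x => ?_)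
    · simp [singJet, Nat.factorial_succ]; ring
    · simp [singJet]
  · refine ((key (3 * (-1) ^ k * ((k + 1).factorial : ℂ)) (k + 1)).congr_deriv
      ?_).congr_of_eventuallyEq (Eventually.of_forall fun x => ?_)
    · simp only [singJet, hl, if_false, Nat.factorial_succ]; push_cast; ring
    · simp [singJet, hl]

theorem jet_hasDerivAt (l : ℕ) (a : ℂ) (k : ℕ) {r : ℝ} (hr : 0 < r) :
    HasDerivAt (jet l a k) (jet l a (k + 1) r) r :=
  (regJet_hasDerivAt l a k r).add (singJet_hasDerivAt l k hr)

theorem jet_one_zero (a : ℂ) {r : ℝ} (hr : 0 < r) :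
    jet 1 a 0 r = (a - 1 / r) * Complex.exp (a * r) := by
  have hr' : (r : ℂ) ≠ 0 := by exact_mod_cast hr.ne'
  have h0 := mul_expMoment_zero a r
  have h1 := mul_expMoment_succ a 0 r
  generalize Complex.exp (a * r) = e at *
  simp [jet, regJet, singJet] at h0 h1 ⊢
  field_simp
  linear_combination (r : ℂ) * h1 - h0

theorem jet_two_zero (a : ℂ) {r : ℝ} (hr : 0 < r) :
    jet 2 a 0 r = (a ^ 2 - 3 * a / r + 3 / r ^ 2) * Complex.exp (a * r) := by
  have hr' : (r : ℂ) ≠ 0 := by exact_mod_cast hr.ne'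
  have h0 := mul_expMoment_zero a r
  have h1 := mul_expMoment_succ a 0 r
  have h2 := mul_expMoment_succ a 1 r
  generalize Complex.exp (a * r) = e at *
  norm_num [jet, regJet, singJet] at h0 h1 h2 ⊢
  field_simp
  linear_combination (r : ℂ) ^ 2 * h2 - 3 * r * h1 + 3 * h0

theorem jet_one_one (a : ℂ) {r : ℝ} (hr : 0 < r) :
    jet 1 a 1 r = (a ^ 2 - a / r + 1 / r ^ 2) * Complex.exp (a * r) := by
  have hr' : (r : ℂ) ≠ 0 := by exact_mod_cast hr.ne'
  have h0 := mul_expMoment_zero a r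
  have h1 := mul_expMoment_succ a 0 r
  have h2 := mul_expMoment_succ a 1 r
  generalize Complex.exp (a * r) = e at *
  norm_num [jet, regJet, singJet] at h0 h1 h2 ⊢
  field_simp
  linear_combination (r : ℂ) ^ 2 * h2 - r * h1 + h0

theorem jet_two_one (a : ℂ) {r : ℝ} (hr : 0 < r) :
    jet 2 a 1 r = (a ^ 3 - 3 * a ^ 2 / r + 6 * a / r ^ 2 - 6 / r ^ 3) * Complex.exp (a * r) := by
  have hr' : (r : ℂ) ≠ 0 := by exact_mod_cast hr.ne'
  have h0 := mul_expMoment_zero a r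
  have h1 := mul_expMoment_succ a 0 r
  have h2 := mul_expMoment_succ a 1 r
  have h3 := mul_expMoment_succ a 2 r
  generalize Complex.exp (a * r) = e at *
  norm_num [jet, regJet, singJet, Nat.factorial] at h0 h1 h2 h3 ⊢
  field_simp
  linear_combination (r : ℂ) ^ 3 * h3 - 3 * r ^ 2 * h2 + 6 * r * h1 - 6 * h0

/-- `D_l e^{ar}` solves `u'' = (a² + l(l+1)/r²) u`. -/
theorem jet_two_eq {l : ℕ} (hl : l = 1 ∨ l = 2) (a : ℂ) {r : ℝ} (hr : 0 < r) :
    jet l a 2 r = (a ^ 2 + (l : ℂ) * ((l : ℂ) + 1) / (r : ℂ) ^ 2) * jet l a 0 r := by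
  have hr' : (r : ℂ) ≠ 0 := by exact_mod_cast hr.ne'
  have h0 := mul_expMoment_zero a r
  have h1 := mul_expMoment_succ a 0 r
  have h2 := mul_expMoment_succ a 1 r
  have h3 := mul_expMoment_succ a 2 r
  have h4 := mul_expMoment_succ a 3 r
  rcases hl with rfl | rfl
  · rw [jet_one_zero a hr]
    generalize Complex.exp (a * r) = e at *
    norm_num [jet, regJet, singJet, Nat.factorial] at h0 h1 h2 h3 h4 ⊢
    field_simp
    linear_combination (r : ℂ) ^ 3 * h3 - r ^ 2 * h2 + 2 * r * h1 - 2 * h0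
  · rw [jet_two_zero a hr]
    generalize Complex.exp (a * r) = e at *
    norm_num [jet, regJet, singJet, Nat.factorial] at h0 h1 h2 h3 h4 ⊢
    field_simp
    linear_combination (r : ℂ) ^ 4 * h4 - 3 * r ^ 3 * h3 + 9 * r ^ 2 * h2 - 18 * r * h1 + 18 * h0

/-- The constant wronskian of `D_l e^{ar}` and `D_l e^{-ar}`. -/
theorem jet_wronskian {l : ℕ} (hl : l = 1 ∨ l = 2) (a : ℂ) {r : ℝ} (hr : 0 < r) :
    jet l a 1 r * jet l (-a) 0 r - jet l a 0 r * jet l (-a) 1 r =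
      2 * (-1) ^ l * a ^ (2 * l + 1) := by
  have hr' : (r : ℂ) ≠ 0 := by exact_mod_cast hr.ne'
  have he : Complex.exp (a * r) * Complex.exp (-a * r) = 1 := by
    rw [← Complex.exp_add]; simp
  rcases hl with rfl | rfl
  · rw [jet_one_zero a hr, jet_one_zero _ hr, jet_one_one _ hr, jet_one_one _ hr]
    set x := Complex.exp (a * r)
    set y := Complex.exp (-a * r)
    field_simp
    linear_combination (-2 * a ^ 3 * r ^ 3) * he
  · rw [jet_two_zero a hr, jet_two_zero _ hr, jet_two_one _ hr, jet_two_one _ hr]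
    set x := Complex.exp (a * r)
    set y := Complex.exp (-a * r)
    field_simp
    linear_combination (2 * a ^ 5 * r ^ 5) * he

theorem regJet_zero_right (l : ℕ) (a : ℂ) (k : ℕ) :
    regJet l a k 0 = if l = 1 then k * (a ^ (k + 1) / (k + 1))
      else ((k : ℂ) - 1) * (a ^ (k + 2) / (k + 2)) := by
  simp only [regJet, expMoment_zero_right]
  push_cast
  split_ifs <;> ring

/-! ### Functions on the half-line with prescribed derivatives -/

/-- The functions `D 0, …, D n` are the successive derivatives of `f` on `(0, ∞)`. -/
structure IsJet (n : ℕ) (f : ℝ → ℂ) (D : ℕ → ℝ → ℂ) : Prop where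
  eqOn : ∀ r, 0 < r → f r = D 0 r
  hasDerivAt : ∀ k < n, ∀ r, 0 < r → HasDerivAt (D k) (D (k + 1) r) r

theorem IsJet.iteratedDeriv_eq {n : ℕ} {f : ℝ → ℂ} {D : ℕ → ℝ → ℂ} (h : IsJet n f D) {k : ℕ}
    (hk : k ≤ n) {r : ℝ} (hr : 0 < r) : iteratedDeriv k f r = D k r := by
  induction k generalizing r with
  | zero => rw [iteratedDeriv_zero]; exact h.eqOn r hr
  | succ k ih =>
    rw [iteratedDeriv_succ]
    have he : iteratedDeriv k f =ᶠ[𝓝 r] D k := by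
      filter_upwards [Ioi_mem_nhds hr] with x hx
      exact ih (by omega) hx
    rw [he.deriv_eq]
    exact (h.hasDerivAt k (by omega) r hr).deriv

theorem IsJet.deriv_eq {n : ℕ} {f : ℝ → ℂ} {D : ℕ → ℝ → ℂ} (h : IsJet n f D)
    (hn : 1 ≤ n) {r : ℝ} (hr : 0 < r) : deriv f r = D 1 r := by
  rw [← iteratedDeriv_one]
  exact h.iteratedDeriv_eq hn hr

theorem IsJet.radialT_eq {n : ℕ} {f : ℝ → ℂ} {D : ℕ → ℝ → ℂ} (h : IsJet n f D) (l : ℕ)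
    (hn : 2 ≤ n) {r : ℝ} (hr : 0 < r) :
    radialT l f r = -D 2 r + (l : ℂ) * ((l : ℂ) + 1) / (r : ℂ) ^ 2 * D 0 r := by
  rw [radialT, h.iteratedDeriv_eq hn hr, h.eqOn r hr]

theorem IsJet.contDiffOn {n : ℕ} {f : ℝ → ℂ} {D : ℕ → ℝ → ℂ} (h : IsJet n f D)
    (hc : ContinuousOn (D n) (Ioi 0)) : ContDiffOn ℝ n f (Ioi 0) := by
  induction n generalizing f D with
  | zero => exact contDiffOn_zero.mpr (hc.congr fun r hr => h.eqOn r hr)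
  | succ n ih =>
    have hd : ∀ r, 0 < r → HasDerivAt f (D 1 r) r := fun r hr => by
      refine (h.hasDerivAt 0 (by omega) r hr).congr_of_eventuallyEq ?_
      filter_upwards [Ioi_mem_nhds hr] with x hx
      exact h.eqOn x hx
    rw [show ((n + 1 : ℕ) : WithTop ℕ∞) = (n : WithTop ℕ∞) + 1 by push_cast; rfl,
      contDiffOn_succ_iff_deriv_of_isOpen isOpen_Ioi]
    refine ⟨fun r hr => (hd r hr).differentiableAt.differentiableWithinAt, by simp, ?_⟩
    exact ih (D := fun k => D (k + 1)) ⟨fun r hr => (hd r hr).deriv,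
      fun k hk => h.hasDerivAt (k + 1) (by omega)⟩ hc

/-- The boundary condition as a relation between the limits `v k` of the derivatives at zero. -/
def BoundaryValues (l : ℕ) (κ : ℝ) (v : ℕ → ℂ) : Prop :=
  if l = 1 then v 0 = 0 ∧ v 2 = -(2 * (√2 : ℝ) / 3) * κ * v 1 ∧ v 3 = 0
  else v 1 = 0 ∧ v 2 = 0 ∧ v 3 = -(2 * (√2 : ℝ) / 5) * (κ : ℂ) ^ 3 * v 0

theorem IsJet.tendsto_iteratedDeriv_iff {n : ℕ} {f : ℝ → ℂ} {D : ℕ → ℝ → ℂ} (h : IsJet n f D)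
    {k : ℕ} (hk : k ≤ n) (w : ℂ) :
    Tendsto (iteratedDeriv k f) (𝓝[>] 0) (𝓝 w) ↔ Tendsto (D k) (𝓝[>] 0) (𝓝 w) := by
  refine tendsto_congr' ?_
  filter_upwards [self_mem_nhdsWithin] with r hr
  exact h.iteratedDeriv_eq hk hr

theorem boundaryCondition_iff {l : ℕ} (hl : l = 1 ∨ l = 2) {κ : ℝ} {f : ℝ → ℂ} {D : ℕ → ℝ → ℂ}
    (h : IsJet 3 f D) : BoundaryCondition l κ f ↔
      ∃ v : ℕ → ℂ, (∀ k ≤ 3, Tendsto (D k) (𝓝[>] 0) (𝓝 (v k))) ∧ BoundaryValues l κ v := by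
  have k0 := h.tendsto_iteratedDeriv_iff (k := 0) (by omega)
  have k1 := h.tendsto_iteratedDeriv_iff (k := 1) (by omega)
  have k2 := h.tendsto_iteratedDeriv_iff (k := 2) (by omega)
  have k3 := h.tendsto_iteratedDeriv_iff (k := 3) (by omega)
  rw [iteratedDeriv_zero] at k0
  rw [iteratedDeriv_one] at k1
  have aux : ∀ a b c d : ℂ, Tendsto (D 0) (𝓝[>] 0) (𝓝 a) → Tendsto (D 1) (𝓝[>] 0) (𝓝 b) →
      Tendsto (D 2) (𝓝[>] 0) (𝓝 c) → Tendsto (D 3) (𝓝[>] 0) (𝓝 d) →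
      ∃ v : ℕ → ℂ, (∀ k ≤ 3, Tendsto (D k) (𝓝[>] 0) (𝓝 (v k))) ∧
        v 0 = a ∧ v 1 = b ∧ v 2 = c ∧ v 3 = d := by
    intro a b c d ha hb hc hd
    refine ⟨fun k => if k = 0 then a else if k = 1 then b else if k = 2 then c else d,
      fun k hk => ?_, by simp, by simp, by simp, by simp⟩
    interval_cases k
    all_goals simpa
  rcases hl with rfl | rfl
  · constructor
    · rintro ⟨c, h0, h1, h2, h3⟩
      obtain ⟨v, hv, e0, e1, e2, e3⟩ := aux _ _ _ _ ((k0 _).1 h0) ((k1 _).1 h1) ((k2 _).1 h2)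
        ((k3 _).1 h3)
      exact ⟨v, hv, by simp [BoundaryValues, e0, e1, e2, e3]⟩
    · rintro ⟨v, hv, hb⟩
      simp only [BoundaryValues, if_true] at hb
      obtain ⟨b0, b2, b3⟩ := hb
      refine ⟨v 1, (k0 _).2 ?_, (k1 _).2 (hv 1 (by omega)), (k2 _).2 ?_, (k3 _).2 ?_⟩
      · rw [← b0]; exact hv 0 (by omega)
      · rw [← b2]; exact hv 2 (by omega)
      · rw [← b3]; exact hv 3 (by omega)
  · constructor
    · rintro ⟨c, h0, h1, h2, h3⟩
      obtain ⟨v, hv, e0, e1, e2, e3⟩ := aux _ _ _ _ ((k0 _).1 h0) ((k1 _).1 h1) ((k2 _).1 h2)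
        ((k3 _).1 h3)
      exact ⟨v, hv, by simp [BoundaryValues, e0, e1, e2, e3]⟩
    · rintro ⟨v, hv, hb⟩
      simp only [BoundaryValues, if_neg (show ¬(2 = 1) by norm_num)] at hb
      obtain ⟨b1, b2, b3⟩ := hb
      refine ⟨v 0, (k0 _).2 (hv 0 (by omega)), (k1 _).2 ?_, (k2 _).2 ?_, (k3 _).2 ?_⟩
      · rw [← b1]; exact hv 1 (by omega)
      · rw [← b2]; exact hv 2 (by omega)
      · rw [← b3]; exact hv 3 (by omega)

/-- The boundary condition only depends on the values of the function near zero. -/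
theorem BoundaryCondition.congr {l : ℕ} {κ : ℝ} {f g : ℝ → ℂ} {s : ℝ} (hs : 0 < s)
    (hl : l = 1 ∨ l = 2) (hg : BoundaryCondition l κ g) (hfg : ∀ r, 0 < r → r < s → f r = g r) :
    BoundaryCondition l κ f := by
  have key : ∀ k : ℕ, ∀ w : ℂ, Tendsto (iteratedDeriv k g) (𝓝[>] 0) (𝓝 w) →
      Tendsto (iteratedDeriv k f) (𝓝[>] 0) (𝓝 w) := by
    intro k w hw
    refine hw.congr' ?_
    filter_upwards [Ioo_mem_nhdsGT hs] with r hr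
    have he : g =ᶠ[𝓝 r] f := by
      filter_upwards [Ioo_mem_nhds hr.1 hr.2] with x hx
      exact (hfg x hx.1 hx.2).symm
    exact (he.iteratedDeriv k).eq_of_nhds
  have k0 := key 0
  have k1 := key 1
  rw [iteratedDeriv_zero, iteratedDeriv_zero] at k0
  rw [iteratedDeriv_one, iteratedDeriv_one] at k1
  rcases hl with rfl | rfl
  · obtain ⟨c, h0, h1, h2, h3⟩ := hg
    exact ⟨c, k0 _ h0, k1 _ h1, key _ _ h2, key _ _ h3⟩
  · obtain ⟨c, h0, h1, h2, h3⟩ := hg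
    exact ⟨c, k0 _ h0, k1 _ h1, key _ _ h2, key _ _ h3⟩

/-! ### The solution space of `T_l² u = z⁴ u` -/

/-- The four fourth roots of `z⁴`. -/
def root (z : ℂ) : Fin 4 → ℂ := ![z, Complex.I * z, -z, -(Complex.I * z)]

/-- The `k`-th derivative of the solution `∑ c_j D_l e^{a_j r}` of `T_l² u = z⁴ u`, where
`a_j` runs through the fourth roots of `z⁴`. -/
def sol (l : ℕ) (z : ℂ) (c : Fin 4 → ℂ) (k : ℕ) (r : ℝ) : ℂ :=
  ∑ j, c j * jet l (root z j) k r

/-- The action of `T_l` on the coefficients of a solution. -/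
def tau (z : ℂ) (c : Fin 4 → ℂ) : Fin 4 → ℂ := fun j => -root z j ^ 2 * c j

theorem root_pow_four (z : ℂ) (j : Fin 4) : root z j ^ 4 = z ^ 4 := by
  have h : Complex.I ^ 4 = 1 := Complex.I_pow_four
  fin_cases j <;> simp [root, mul_pow, h, Even.neg_pow (show Even 4 by decide)]

theorem tau_tau (z : ℂ) (c : Fin 4 → ℂ) : tau z (tau z c) = z ^ 4 • c := by
  funext j
  simp only [tau, Pi.smul_apply, smul_eq_mul, ← root_pow_four z j]
  ring

theorem sol_add (l : ℕ) (z : ℂ) (c d : Fin 4 → ℂ) (k : ℕ) (r : ℝ) :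
    sol l z (c + d) k r = sol l z c k r + sol l z d k r := by
  simp [sol, add_mul, Finset.sum_add_distrib]

theorem sol_sub (l : ℕ) (z : ℂ) (c d : Fin 4 → ℂ) (k : ℕ) (r : ℝ) :
    sol l z (c - d) k r = sol l z c k r - sol l z d k r := by
  simp [sol, sub_mul, Finset.sum_sub_distrib]

theorem sol_smul (l : ℕ) (z : ℂ) (a : ℂ) (c : Fin 4 → ℂ) (k : ℕ) (r : ℝ) :
    sol l z (a • c) k r = a * sol l z c k r := by
  simp [sol, Finset.mul_sum, mul_assoc]

theorem sol_hasDerivAt (l : ℕ) (z : ℂ) (c : Fin 4 → ℂ) (k : ℕ) {r : ℝ} (hr : 0 < r) :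
    HasDerivAt (sol l z c k) (sol l z c (k + 1) r) r := by
  have := HasDerivAt.fun_sum (u := Finset.univ) fun j _ =>
    (jet_hasDerivAt l (root z j) k hr).const_mul (c j)
  exact this

theorem continuousOn_sol (l : ℕ) (z : ℂ) (c : Fin 4 → ℂ) (k : ℕ) :
    ContinuousOn (sol l z c k) (Ioi 0) := fun _ hr =>
  (sol_hasDerivAt l z c k hr).continuousAt.continuousWithinAt

theorem sol_isJet (l : ℕ) (z : ℂ) (c : Fin 4 → ℂ) (n : ℕ) :
    IsJet n (sol l z c 0) (sol l z c) :=
  ⟨fun _ _ => rfl, fun k _ _ hr => sol_hasDerivAt l z c k hr⟩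

/-- `T_l` acts on solutions through `tau`. -/
theorem sol_tau {l : ℕ} (hl : l = 1 ∨ l = 2) (z : ℂ) (c : Fin 4 → ℂ) {r : ℝ} (hr : 0 < r) :
    -sol l z c 2 r + (l : ℂ) * ((l : ℂ) + 1) / (r : ℂ) ^ 2 * sol l z c 0 r =
      sol l z (tau z c) 0 r := by
  simp only [sol, tau, Finset.mul_sum, ← Finset.sum_neg_distrib, ← Finset.sum_add_distrib]
  refine Finset.sum_congr rfl fun j _ => ?_
  rw [jet_two_eq hl _ hr]
  ring

theorem opD_one_eq {w w₁ : ℝ → ℂ} (h : ∀ r, HasDerivAt w (w₁ r) r) {r : ℝ} (hr : 0 < r) :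
    opD 1 w r = w₁ r - w r / r := by
  have hr' : (r : ℂ) ≠ 0 := by exact_mod_cast hr.ne'
  have h0 := Complex.ofRealCLM.hasDerivAt (x := r)
  have hd : HasDerivAt (fun x : ℝ => w x / (x : ℂ)) _ r := (h r).div h0 hr'
  simp only [opD, Function.iterate_one]
  rw [hd.deriv]
  simp
  field_simp

theorem opD_two_eq {w w₁ w₂ : ℝ → ℂ} (h : ∀ r, HasDerivAt w (w₁ r) r)
    (h' : ∀ r, HasDerivAt w₁ (w₂ r) r) {r : ℝ} (hr : 0 < r) :
    opD 2 w r = w₂ r - 3 * w₁ r / r + 3 * w r / r ^ 2 := by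
  have hr' : (r : ℂ) ≠ 0 := by exact_mod_cast hr.ne'
  have h0 := Complex.ofRealCLM.hasDerivAt (x := r)
  have he : (fun x : ℝ => 1 / (x : ℂ) * deriv (fun y : ℝ => w y / (y : ℂ)) x) =ᶠ[𝓝 r]
      fun x : ℝ => w₁ x / (x : ℂ) ^ 2 - w x / (x : ℂ) ^ 3 := by
    filter_upwards [Ioi_mem_nhds hr] with x hx
    have hx' : (x : ℂ) ≠ 0 := by exact_mod_cast (ne_of_gt hx)
    have hd : HasDerivAt (fun y : ℝ => w y / (y : ℂ)) _ x :=
      (h x).div (Complex.ofRealCLM.hasDerivAt (x := x)) hx'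
    rw [hd.deriv]
    simp
    field_simp
  have hd : HasDerivAt (fun x : ℝ => w₁ x / (x : ℂ) ^ 2 - w x / (x : ℂ) ^ 3) _ r :=
    ((h' r).div (h0.pow 2) (pow_ne_zero _ hr')).sub ((h r).div (h0.pow 3) (pow_ne_zero _ hr'))
  simp only [opD, Function.iterate_succ, Function.iterate_zero, Function.comp_apply, id_eq]
  rw [he.deriv_eq, hd.deriv]
  simp
  field_simp
  ring

theorem opD_sum_exp {l : ℕ} (hl : l = 1 ∨ l = 2) (z : ℂ) (c : Fin 4 → ℂ) {r : ℝ} (hr : 0 < r) :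
    opD l (fun x => ∑ j, c j * Complex.exp (root z j * x)) r = sol l z c 0 r := by
  have hexp : ∀ (m : ℕ) (x : ℝ), HasDerivAt
      (fun x : ℝ => ∑ j, c j * root z j ^ m * Complex.exp (root z j * x))
      (∑ j, c j * root z j ^ (m + 1) * Complex.exp (root z j * x)) x := by
    intro m x
    refine HasDerivAt.fun_sum fun j _ => ?_
    have h1 : HasDerivAt (fun y : ℝ => root z j * (y : ℂ)) (root z j * 1) x :=
      (Complex.ofRealCLM.hasDerivAt (x := x)).const_mul _
    refine (h1.cexp.const_mul (c j * root z j ^ m)).congr_deriv ?_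
    ring
  have h0 := hexp 0
  have h1 := hexp 1
  simp only [pow_zero, mul_one, zero_add, pow_one] at h0 h1
  rcases hl with rfl | rfl
  · rw [opD_one_eq h0 hr, sol, Finset.sum_div, ← Finset.sum_sub_distrib]
    refine Finset.sum_congr rfl fun j _ => ?_
    rw [jet_one_zero _ hr]
    ring
  · rw [opD_two_eq h0 h1 hr, sol, Finset.mul_sum, Finset.sum_div, Finset.mul_sum, Finset.sum_div,
      ← Finset.sum_sub_distrib, ← Finset.sum_add_distrib]
    refine Finset.sum_congr rfl fun j _ => ?_
    rw [jet_two_zero _ hr]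
    ring

/-- The coefficients of `g_+`. -/
def gPlusC : Fin 4 → ℂ := ![0, 0, 1, 0]

/-- The coefficients of `g_-`. -/
def gMinusC : Fin 4 → ℂ := ![0, 1, 0, 0]

/-- The coefficients of `h_+`. -/
def hPlusC (l : ℕ) (κ : ℝ) (z : ℂ) : Fin 4 → ℂ := ![1, betaPlus l κ z, alphaPlus l κ z, 0]

/-- The coefficients of `h_-`. -/
def hMinusC (l : ℕ) (κ : ℝ) (z : ℂ) : Fin 4 → ℂ := ![0, alphaMinus l κ z, betaMinus l κ z, 1]

theorem gPlus_eq {l : ℕ} (hl : l = 1 ∨ l = 2) (z : ℂ) {r : ℝ} (hr : 0 < r) :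
    gPlus l z r = sol l z gPlusC 0 r := by
  rw [← opD_sum_exp hl z _ hr, gPlus]
  congr 1
  funext x
  simp [Fin.sum_univ_four, gPlusC, root]

theorem gMinus_eq {l : ℕ} (hl : l = 1 ∨ l = 2) (z : ℂ) {r : ℝ} (hr : 0 < r) :
    gMinus l z r = sol l z gMinusC 0 r := by
  rw [← opD_sum_exp hl z _ hr, gMinus]
  congr 1
  funext x
  simp [Fin.sum_univ_four, gMinusC, root]

theorem hPlus_eq {l : ℕ} (hl : l = 1 ∨ l = 2) (κ : ℝ) (z : ℂ) {r : ℝ} (hr : 0 < r) :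
    hPlus l κ z r = sol l z (hPlusC l κ z) 0 r := by
  rw [← opD_sum_exp hl z _ hr, hPlus]
  congr 1
  funext x
  simp [Fin.sum_univ_four, hPlusC, root]
  ring

theorem hMinus_eq {l : ℕ} (hl : l = 1 ∨ l = 2) (κ : ℝ) (z : ℂ) {r : ℝ} (hr : 0 < r) :
    hMinus l κ z r = sol l z (hMinusC l κ z) 0 r := by
  rw [← opD_sum_exp hl z _ hr, hMinus]
  congr 1
  funext x
  simp [Fin.sum_univ_four, hMinusC, root]
  ring

theorem hTildePlus_eq {l : ℕ} (hl : l = 1 ∨ l = 2) (κ : ℝ) (z : ℂ) {r : ℝ} (hr : 0 < r) :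
    hTildePlus l κ z r = sol l z ![1, 0, alphaPlus l κ z, 0] 0 r := by
  rw [← opD_sum_exp hl z _ hr, hTildePlus]
  congr 1
  funext x
  simp [Fin.sum_univ_four, root]

theorem hTildeMinus_eq {l : ℕ} (hl : l = 1 ∨ l = 2) (κ : ℝ) (z : ℂ) {r : ℝ} (hr : 0 < r) :
    hTildeMinus l κ z r = sol l z ![0, alphaMinus l κ z, 0, 1] 0 r := by
  rw [← opD_sum_exp hl z _ hr, hTildeMinus]
  congr 1
  funext x
  simp [Fin.sum_univ_four, root]
  ring

/-- A function which agrees with a solution on the half-line has the jet of that solution. -/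
theorem isJet_of_eq_sol {l : ℕ} {z : ℂ} {c : Fin 4 → ℂ} {f : ℝ → ℂ}
    (h : ∀ r, 0 < r → f r = sol l z c 0 r) (n : ℕ) : IsJet n f (sol l z c) :=
  ⟨h, fun k _ _ hr => sol_hasDerivAt l z c k hr⟩

theorem wronskian_eq {l : ℕ} {z : ℂ} {c d : Fin 4 → ℂ} {f g : ℝ → ℂ}
    (hf : ∀ r, 0 < r → f r = sol l z c 0 r) (hg : ∀ r, 0 < r → g r = sol l z d 0 r)
    {r : ℝ} (hr : 0 < r) : wronskian f g r =
      sol l z c 1 r * sol l z d 0 r - sol l z c 0 r * sol l z d 1 r := by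
  rw [wronskian, (isJet_of_eq_sol hf 1).deriv_eq le_rfl hr,
    (isJet_of_eq_sol hg 1).deriv_eq le_rfl hr, hf r hr, hg r hr]

theorem jet_wronskian_plus {l : ℕ} (hl : l = 1 ∨ l = 2) (z : ℂ) {r : ℝ} (hr : 0 < r) :
    jet l (root z 0) 1 r * jet l (root z 2) 0 r - jet l (root z 0) 0 r * jet l (root z 2) 1 r =
      wPlus l z := by
  have := jet_wronskian hl z hr
  simp only [root, Matrix.cons_val] at *
  rw [this]
  rcases hl with rfl | rfl <;> simp [wPlus]

theorem jet_wronskian_minus {l : ℕ} (hl : l = 1 ∨ l = 2) (z : ℂ) {r : ℝ} (hr : 0 < r) :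
    jet l (root z 3) 1 r * jet l (root z 1) 0 r - jet l (root z 3) 0 r * jet l (root z 1) 1 r =
      wMinus l z := by
  have := jet_wronskian hl (-(Complex.I * z)) hr
  rw [neg_neg] at this
  simp only [root, Matrix.cons_val] at *
  rw [this]
  have h2 := Complex.I_sq
  rcases hl with rfl | rfl
  · simp [wMinus]
    linear_combination (-2 * z ^ 3 * Complex.I) * h2
  · simp [wMinus]
    linear_combination (-2 * z ^ 5 * Complex.I) * (Complex.I ^ 2 - 1) * h2

/-! ### Behaviour of solutions at zero -/

/-- The `k`-th derivative of the part of a solution which is smooth at zero. -/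
def reg (l : ℕ) (z : ℂ) (c : Fin 4 → ℂ) (k : ℕ) (r : ℝ) : ℂ :=
  ∑ j, c j * regJet l (root z j) k r

/-- The power sums `∑ c_j a_j^n`, the Taylor coefficients at zero of `∑ c_j e^{a_j r}`. -/
def moment (z : ℂ) (c : Fin 4 → ℂ) (n : ℕ) : ℂ := ∑ j, c j * root z j ^ n

theorem moment_add_four (z : ℂ) (c : Fin 4 → ℂ) (n : ℕ) :
    moment z c (n + 4) = z ^ 4 * moment z c n := by
  simp only [moment, Finset.mul_sum]
  refine Finset.sum_congr rfl fun j _ => ?_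
  rw [pow_add, root_pow_four]
  ring

theorem moment_add (z : ℂ) (c d : Fin 4 → ℂ) (n : ℕ) :
    moment z (c + d) n = moment z c n + moment z d n := by
  simp [moment, add_mul, Finset.sum_add_distrib]

theorem moment_smul (z : ℂ) (a : ℂ) (c : Fin 4 → ℂ) (n : ℕ) :
    moment z (a • c) n = a * moment z c n := by
  simp [moment, Finset.mul_sum, mul_assoc]

theorem sol_eq_reg_add (l : ℕ) (z : ℂ) (c : Fin 4 → ℂ) (k : ℕ) (r : ℝ) :
    sol l z c k r = reg l z c k r + moment z c 0 * singJet l k r := by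
  simp [sol, reg, moment, jet, mul_add, Finset.sum_add_distrib, Finset.sum_mul]

theorem sol_eq_reg {l : ℕ} {z : ℂ} {c : Fin 4 → ℂ} (h : moment z c 0 = 0) (k : ℕ) (r : ℝ) :
    sol l z c k r = reg l z c k r := by
  rw [sol_eq_reg_add, h, zero_mul, add_zero]

theorem reg_hasDerivAt (l : ℕ) (z : ℂ) (c : Fin 4 → ℂ) (k : ℕ) (r : ℝ) :
    HasDerivAt (reg l z c k) (reg l z c (k + 1) r) r :=
  HasDerivAt.fun_sum fun j _ => (regJet_hasDerivAt l (root z j) k r).const_mul (c j)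

theorem continuous_reg (l : ℕ) (z : ℂ) (c : Fin 4 → ℂ) (k : ℕ) : Continuous (reg l z c k) :=
  continuous_iff_continuousAt.mpr fun r => (reg_hasDerivAt l z c k r).continuousAt

theorem reg_zero_right (l : ℕ) (z : ℂ) (c : Fin 4 → ℂ) (k : ℕ) :
    reg l z c k 0 = if l = 1 then k / (k + 1) * moment z c (k + 1)
      else ((k : ℂ) - 1) / (k + 2) * moment z c (k + 2) := by
  simp only [reg, regJet_zero_right, moment]
  split_ifs
  · rw [Finset.mul_sum]
    exact Finset.sum_congr rfl fun j _ => by ring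
  · rw [Finset.mul_sum]
    exact Finset.sum_congr rfl fun j _ => by ring

/-- The condition on the coefficients of a solution which expresses the boundary condition. -/
def BoundaryCoeff (l : ℕ) (κ : ℝ) (z : ℂ) (c : Fin 4 → ℂ) : Prop :=
  moment z c 0 = 0 ∧
    if l = 1 then 2 * moment z c 3 + (√2 : ℝ) * κ * moment z c 2 = 0
    else 2 * z ^ 4 * moment z c 1 = (√2 : ℝ) * (κ : ℂ) ^ 3 * moment z c 2

/-- The derivatives at zero of the smooth part are multiples of moments; the higher moments reduce
to the first four by `moment_add_four`. -/
theorem boundaryValues_reg_iff {l : ℕ} (hl : l = 1 ∨ l = 2) {κ : ℝ} {z : ℂ} {c : Fin 4 → ℂ}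
    (h0 : moment z c 0 = 0) :
    BoundaryValues l κ (fun k => reg l z c k 0) ↔ BoundaryCoeff l κ z c := by
  have h4 := moment_add_four z c 0
  have h5 := moment_add_four z c 1
  rw [h0] at h4
  norm_num at h4 h5
  rcases hl with rfl | rfl
  · simp only [BoundaryValues, BoundaryCoeff, reg_zero_right, h0, if_true]
    norm_num [h4]
    constructor
    · intro h; linear_combination 3 * h
    · intro h; linear_combination (1 / 3) * h
  · simp only [BoundaryValues, BoundaryCoeff, reg_zero_right, h0,
      if_neg (show ¬(2 = 1) by norm_num)]
    norm_num [h4, h5]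
    constructor
    · intro h; linear_combination 5 * h
    · intro h; linear_combination (1 / 5) * h

theorem tendsto_reg (l : ℕ) (z : ℂ) (c : Fin 4 → ℂ) (k : ℕ) :
    Tendsto (reg l z c k) (𝓝[>] 0) (𝓝 (reg l z c k 0)) :=
  ((continuous_reg l z c k).tendsto 0).mono_left nhdsWithin_le_nhds

/-- If a solution has a finite limit at zero, its singular part vanishes. -/
theorem moment_zero_of_tendsto {l : ℕ} (hl : l = 1 ∨ l = 2) {z : ℂ} {c : Fin 4 → ℂ} {v : ℂ}
    (h : Tendsto (sol l z c 0) (𝓝[>] 0) (𝓝 v)) : moment z c 0 = 0 := by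
  have hr : Tendsto (fun r : ℝ => (r : ℂ)) (𝓝[>] 0) (𝓝 0) := by
    have := (Complex.continuous_ofReal.tendsto 0).mono_left (nhdsWithin_le_nhds (s := Ioi 0))
    simpa using this
  have h1 : Tendsto (fun r : ℝ => (r : ℂ) ^ l * (sol l z c 0 r - reg l z c 0 r)) (𝓝[>] 0)
      (𝓝 (0 ^ l * (v - reg l z c 0 0))) := (hr.pow l).mul (h.sub (tendsto_reg l z c 0))
  have hl0 : l ≠ 0 := by omega
  rw [zero_pow hl0, zero_mul] at h1
  have h2 : Tendsto (fun r : ℝ => (r : ℂ) ^ l * (sol l z c 0 r - reg l z c 0 r)) (𝓝[>] 0)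
      (𝓝 ((if l = 1 then -1 else 3) * moment z c 0)) := by
    refine tendsto_const_nhds.congr' ?_
    filter_upwards [self_mem_nhdsWithin] with r hr
    have hr' : (r : ℂ) ≠ 0 := by exact_mod_cast (ne_of_gt hr)
    rw [sol_eq_reg_add]
    rcases hl with rfl | rfl
    · simp [singJet]; field_simp
    · simp [singJet]; field_simp
  have h3 := tendsto_nhds_unique h2 h1
  rcases hl with rfl | rfl <;> simpa using h3

theorem boundaryCondition_sol_iff {l : ℕ} (hl : l = 1 ∨ l = 2) {κ : ℝ} {z : ℂ} {c : Fin 4 → ℂ} :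
    BoundaryCondition l κ (sol l z c 0) ↔ BoundaryCoeff l κ z c := by
  rw [boundaryCondition_iff hl (sol_isJet l z c 3)]
  constructor
  · rintro ⟨v, hv, hb⟩
    have h0 := moment_zero_of_tendsto hl (hv 0 (by omega))
    rw [← boundaryValues_reg_iff hl h0]
    have hk : ∀ k ≤ 3, v k = reg l z c k 0 := fun k hk => by
      refine tendsto_nhds_unique (hv k hk) ((tendsto_reg l z c k).congr fun r => ?_)
      rw [sol_eq_reg h0]
    simpa only [BoundaryValues, hk 0 (by omega), hk 1 (by omega), hk 2 (by omega),
      hk 3 le_rfl] using hb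
  · intro h
    refine ⟨fun k => reg l z c k 0, fun k _ => (tendsto_reg l z c k).congr fun r => ?_,
      (boundaryValues_reg_iff hl h.1).2 h⟩
    rw [sol_eq_reg h.1]

/-- The Taylor estimate for a smooth part vanishing to order `n` at zero. -/
theorem norm_reg_le {l : ℕ} {z : ℂ} {c : Fin 4 → ℂ} {n : ℕ}
    (h : ∀ k < n, reg l z c k 0 = 0) {k : ℕ} (hk : k ≤ n) :
    ∃ C, 0 ≤ C ∧ ∀ r : ℝ, 0 ≤ r → r ≤ 1 → ‖reg l z c k r‖ ≤ C * r ^ (n - k) := by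
  induction hk using Nat.decreasingInduction with
  | self =>
    obtain ⟨C, hC⟩ := isCompact_Icc.exists_bound_of_continuousOn
      (continuous_reg l z c n).continuousOn (s := Icc (0 : ℝ) 1)
    refine ⟨C, (norm_nonneg _).trans (hC 0 (by simp)), fun r h0 h1 => ?_⟩
    simpa using hC r ⟨h0, h1⟩
  | of_succ k hk ih =>
    obtain ⟨C, hC0, hC⟩ := ih
    refine ⟨C, hC0, fun r h0 h1 => ?_⟩
    have := Convex.norm_image_sub_le_of_norm_hasDerivWithin_le (f := reg l z c k)
      (f' := reg l z c (k + 1)) (s := Icc 0 r) (C := C * r ^ (n - (k + 1))) (x := 0) (y := r)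
      (fun x _ => (reg_hasDerivAt l z c k x).hasDerivWithinAt)
      (fun x hx => (hC x hx.1 (hx.2.trans h1)).trans (by
        have := hx.1
        gcongr
        exact hx.2)) (convex_Icc 0 r) (by simp [h0]) (by simp [h0])
    rw [h k hk, sub_zero, sub_zero, Real.norm_of_nonneg h0] at this
    refine this.trans_eq ?_
    rw [show n - k = n - (k + 1) + 1 by omega, pow_succ]
    ring

/-! ### The coefficients of the resolvent kernel -/

theorem pos_of_arg {z : ℂ} (hz₀ : 0 < Complex.arg z) (hz₁ : Complex.arg z < Real.pi / 2) :
    0 < z.re ∧ 0 < z.im := by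
  have him : 0 < z.im := by
    rcases lt_or_ge 0 z.im with h | h
    · exact h
    · rcases h.lt_or_eq with h | h
      · exact absurd (Complex.arg_neg_iff.mpr h) (not_lt.mpr hz₀.le)
      · rcases le_or_gt 0 z.re with h2 | h2
        · rw [Complex.arg_eq_zero_iff.mpr ⟨h2, h⟩] at hz₀
          exact absurd hz₀ (lt_irrefl _)
        · rw [Complex.arg_eq_pi_iff.mpr ⟨h2, h⟩] at hz₁
          linarith [Real.pi_pos]
  refine ⟨?_, him⟩
  rcases Complex.arg_lt_pi_div_two_iff.mp hz₁ with h | h | h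
  · exact h
  · exact absurd him (not_lt.mpr h.le)
  · rw [h, Complex.arg_zero] at hz₀
    exact absurd hz₀ (lt_irrefl _)

/-- For `z` in the open first quadrant, `d` vanishes only if `κ > 0` and `z⁴ = -κ⁴`. -/
theorem coeffDen_ne_zero {l : ℕ} (hl : l = 1 ∨ l = 2) {κ : ℝ} {z : ℂ} (hx : 0 < z.re)
    (hy : 0 < z.im) (hκ : 0 < κ → z ^ 4 ≠ -(κ : ℂ) ^ 4) : coeffDen l κ z ≠ 0 := by
  intro hd
  have h2 : √2 ^ 2 = 2 := Real.sq_sqrt (by norm_num)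
  have h2p : 0 < √2 := by positivity
  obtain ⟨x, y⟩ := z
  simp only at hx hy
  -- In both cases `d = 0` forces `x = y` and `√2 x = κ`.
  suffices hxy : x = y ∧ √2 * x = κ by
    obtain ⟨rfl, rfl⟩ := hxy
    refine hκ (by positivity) ?_
    have h4 : √2 ^ 4 = 4 := by rw [show √2 ^ 4 = (√2 ^ 2) ^ 2 by ring, h2]; norm_num
    apply Complex.ext
    · simp [pow_succ, ← Complex.ofReal_mul, ← Complex.ofReal_neg]
      linear_combination x ^ 4 * h4
    · simp [pow_succ, ← Complex.ofReal_mul, ← Complex.ofReal_neg]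
  rcases hl with rfl | rfl
  · have hre := congrArg Complex.re hd
    have him := congrArg Complex.im hd
    simp [coeffDen] at hre him
    have hxy : x = y := by linarith
    refine ⟨hxy, ?_⟩
    have h3 : √2 * (√2 * x - κ) = 0 := by
      rw [← hxy] at hre
      linear_combination x * h2 - hre
    rcases mul_eq_zero.mp h3 with h | h
    · exact absurd h h2p.ne'
    · linarith
  · have hre := congrArg Complex.re hd
    have him := congrArg Complex.im hd
    simp [coeffDen, pow_succ, ← Complex.ofReal_mul] at hre him
    have hxy : x = y := by
      have : (x - y) * (x ^ 2 + 4 * x * y + y ^ 2) = 0 := by linear_combination him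
      rcases mul_eq_zero.mp this with h | h
      · linarith
      · exact absurd h (by positivity)
    refine ⟨hxy, ?_⟩
    rw [← hxy] at hre
    have h3 : κ ^ 3 = (√2 * x) ^ 3 := by
      have h4 : √2 * (κ ^ 3 - (√2 * x) ^ 3) = 0 := by
        linear_combination hre - (x ^ 3 * (√2 ^ 2 + 2)) * h2
      rcases mul_eq_zero.mp h4 with h | h
      · exact absurd h h2p.ne'
      · linarith
    exact ((Odd.strictMono_pow (by decide : Odd 3)).injective h3).symm

theorem alphaPlus_mul {l : ℕ} {κ : ℝ} {z : ℂ} (hd : coeffDen l κ z ≠ 0) :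
    alphaPlus l κ z * coeffDen l κ z = if l = 1 then -((Complex.I + 1) * z + (√2 : ℝ) * κ)
      else -((Complex.I - 1) * z ^ 3 + (√2 : ℝ) * (κ : ℂ) ^ 3) := by
  unfold alphaPlus
  split_ifs <;> exact div_mul_cancel₀ _ hd

theorem betaPlus_mul {l : ℕ} {κ : ℝ} {z : ℂ} (hd : coeffDen l κ z ≠ 0) :
    betaPlus l κ z * coeffDen l κ z = if l = 1 then 2 * z else -(2 * z ^ 3) := by
  unfold betaPlus
  split_ifs <;> exact div_mul_cancel₀ _ hd

theorem alphaMinus_mul {l : ℕ} {κ : ℝ} {z : ℂ} (hd : coeffDen l κ z ≠ 0) :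
    alphaMinus l κ z * coeffDen l κ z = if l = 1 then (Complex.I + 1) * z - (√2 : ℝ) * κ
      else -((1 - Complex.I) * z ^ 3 + (√2 : ℝ) * (κ : ℂ) ^ 3) := by
  unfold alphaMinus
  split_ifs <;> exact div_mul_cancel₀ _ hd

theorem betaMinus_mul {l : ℕ} {κ : ℝ} {z : ℂ} (hd : coeffDen l κ z ≠ 0) :
    betaMinus l κ z * coeffDen l κ z = if l = 1 then -(2 * Complex.I * z)
      else -(2 * Complex.I * z ^ 3) := by
  unfold betaMinus
  split_ifs <;> exact div_mul_cancel₀ _ hd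

theorem boundaryCoeff_hPlusC {l : ℕ} (hl : l = 1 ∨ l = 2) {κ : ℝ} {z : ℂ}
    (hd : coeffDen l κ z ≠ 0) : BoundaryCoeff l κ z (hPlusC l κ z) := by
  have ha := alphaPlus_mul hd
  have hb := betaPlus_mul hd
  have hI := Complex.I_sq
  rcases hl with rfl | rfl
  · simp only [coeffDen, if_true] at ha hb hd
    refine ⟨mul_right_cancel₀ hd ?_, ?_⟩
    · simp [moment, Fin.sum_univ_four, hPlusC, -mul_eq_zero]
      linear_combination ha + hb
    · rw [if_pos rfl]
      refine mul_right_cancel₀ hd ?_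
      simp [moment, Fin.sum_univ_four, hPlusC, root]
      generalize alphaPlus 1 κ z = a at *
      generalize betaPlus 1 κ z = b at *
      grind
  · simp only [coeffDen, if_neg (show ¬(2 = 1) by norm_num)] at ha hb hd
    refine ⟨mul_right_cancel₀ hd ?_, ?_⟩
    · simp [moment, Fin.sum_univ_four, hPlusC, -mul_eq_zero]
      linear_combination ha + hb
    · rw [if_neg (by norm_num)]
      refine mul_right_cancel₀ hd ?_
      simp [moment, Fin.sum_univ_four, hPlusC, root]
      generalize alphaPlus 2 κ z = a at *
      generalize betaPlus 2 κ z = b at *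
      grind

theorem boundaryCoeff_hMinusC {l : ℕ} (hl : l = 1 ∨ l = 2) {κ : ℝ} {z : ℂ}
    (hd : coeffDen l κ z ≠ 0) : BoundaryCoeff l κ z (hMinusC l κ z) := by
  have ha := alphaMinus_mul hd
  have hb := betaMinus_mul hd
  have hI := Complex.I_sq
  rcases hl with rfl | rfl
  · simp only [coeffDen, if_true] at ha hb hd
    refine ⟨mul_right_cancel₀ hd ?_, ?_⟩
    · simp [moment, Fin.sum_univ_four, hMinusC, -mul_eq_zero]
      linear_combination ha + hb
    · rw [if_pos rfl]
      refine mul_right_cancel₀ hd ?_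
      simp [moment, Fin.sum_univ_four, hMinusC, root]
      generalize alphaMinus 1 κ z = a at *
      generalize betaMinus 1 κ z = b at *
      grind
  · simp only [coeffDen, if_neg (show ¬(2 = 1) by norm_num)] at ha hb hd
    refine ⟨mul_right_cancel₀ hd ?_, ?_⟩
    · simp [moment, Fin.sum_univ_four, hMinusC, -mul_eq_zero]
      linear_combination ha + hb
    · rw [if_neg (by norm_num)]
      refine mul_right_cancel₀ hd ?_
      simp [moment, Fin.sum_univ_four, hMinusC, root]
      generalize alphaMinus 2 κ z = a at *
      generalize betaMinus 2 κ z = b at *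
      grind

theorem wPlus_ne_zero (l : ℕ) {z : ℂ} (hz : z ≠ 0) : wPlus l z ≠ 0 := by
  unfold wPlus
  split_ifs <;> simp [hz]

theorem wMinus_ne_zero (l : ℕ) {z : ℂ} (hz : z ≠ 0) : wMinus l z ≠ 0 := by
  unfold wMinus
  split_ifs <;> simp [hz]

/-- The coupling terms `β_± g_∓` cancel in all jump relations of the kernel. -/
theorem beta_mul_w {l : ℕ} (hl : l = 1 ∨ l = 2) {κ : ℝ} {z : ℂ} (hd : coeffDen l κ z ≠ 0) :
    betaMinus l κ z * wPlus l z + betaPlus l κ z * wMinus l z = 0 := by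
  have h1 := betaMinus_mul hd
  have h2 := betaPlus_mul hd
  refine mul_right_cancel₀ hd ?_
  rcases hl with rfl | rfl
  · simp [wPlus, wMinus, -mul_eq_zero] at *
    linear_combination (-2 * z ^ 3) * h1 - 2 * Complex.I * z ^ 3 * h2
  · simp [wPlus, wMinus, -mul_eq_zero] at *
    linear_combination (2 * z ^ 5) * h1 - 2 * Complex.I * z ^ 5 * h2

/-! ### The kernel as a sum of products of solutions -/

/-- The solutions occurring in the smaller variable of the kernel: `h_- / (2 z² W_-)` and
`-h_+ / (2 z² W_+)`. -/
def phi (l : ℕ) (κ : ℝ) (z : ℂ) : Fin 2 → Fin 4 → ℂ :=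
  ![(1 / (2 * z ^ 2 * wMinus l z)) • hMinusC l κ z,
    (-(1 / (2 * z ^ 2 * wPlus l z))) • hPlusC l κ z]

/-- The solutions occurring in the larger variable of the kernel: `g_-` and `g_+`. -/
def psi : Fin 2 → Fin 4 → ℂ := ![gMinusC, gPlusC]

/-- The kernel for `r ≤ s`. -/
def kernelLE (l : ℕ) (κ : ℝ) (z : ℂ) (r s : ℝ) : ℂ :=
  ∑ i, sol l z (phi l κ z i) 0 r * sol l z (psi i) 0 s

theorem resolventKernel_eq {l : ℕ} (hl : l = 1 ∨ l = 2) (κ : ℝ) (z : ℂ) {r s : ℝ} (hr : 0 < r)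
    (hrs : r ≤ s) : resolventKernel l κ z r s = kernelLE l κ z r s := by
  have hs := hr.trans_le hrs
  simp only [kernelLE, Fin.sum_univ_two, phi, psi, Matrix.cons_val_zero, Matrix.cons_val_one,
    sol_smul, resolventKernel, ← gPlus_eq hl z hs, ← gMinus_eq hl z hs, ← hPlus_eq hl κ z hr,
    ← hMinus_eq hl κ z hr]
  rcases hrs.lt_or_eq with h | h
  · have h1 : theta (s - r) = 1 := by
      rw [theta, if_neg (by linarith), if_neg (by linarith)]
    have h2 : theta (r - s) = 0 := by
      rw [theta, if_pos (by linarith)]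
    rw [h1, h2]
    ring
  · subst h
    simp only [sub_self, theta, lt_irrefl, if_false, if_true]
    ring

theorem resolventKernel_symm (l : ℕ) (κ : ℝ) (z : ℂ) (r s : ℝ) :
    resolventKernel l κ z r s = resolventKernel l κ z s r := by
  simp only [resolventKernel]
  ring

theorem beta_mul_phi {l : ℕ} (hl : l = 1 ∨ l = 2) {κ : ℝ} {z : ℂ} (hz : z ≠ 0)
    (hd : coeffDen l κ z ≠ 0) :
    1 / (2 * z ^ 2 * wMinus l z) * betaMinus l κ z +
      1 / (2 * z ^ 2 * wPlus l z) * betaPlus l κ z = 0 := by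
  have h := beta_mul_w hl hd
  have h1 := wPlus_ne_zero l hz
  have h2 := wMinus_ne_zero l hz
  field_simp
  linear_combination h

/-- The first derivative of the kernel does not jump on the diagonal. -/
theorem jump_one {l : ℕ} (hl : l = 1 ∨ l = 2) {κ : ℝ} {z : ℂ} (hz : z ≠ 0)
    (hd : coeffDen l κ z ≠ 0) {r : ℝ} (hr : 0 < r) :
    ∑ i, (sol l z (psi i) 1 r * sol l z (phi l κ z i) 0 r -
      sol l z (phi l κ z i) 1 r * sol l z (psi i) 0 r) = 0 := by
  have hg := beta_mul_phi hl hz hd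
  have hp := jet_wronskian_plus hl z hr
  have hm := jet_wronskian_minus hl z hr
  have h1 := wPlus_ne_zero l hz
  have h2 := wMinus_ne_zero l hz
  have hA : 1 / (2 * z ^ 2 * wMinus l z) * wMinus l z = 1 / (2 * z ^ 2) := by field_simp
  have hB : 1 / (2 * z ^ 2 * wPlus l z) * wPlus l z = 1 / (2 * z ^ 2) := by field_simp
  simp only [phi, psi, Fin.sum_univ_two, Matrix.cons_val_zero, Matrix.cons_val_one, sol_smul]
  simp only [sol, Fin.sum_univ_four, gPlusC, gMinusC, hPlusC, hMinusC, Matrix.cons_val]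
  generalize 1 / (2 * z ^ 2 * wMinus l z) = A at *
  generalize 1 / (2 * z ^ 2 * wPlus l z) = B at *
  linear_combination -A * hm + B * hp - hA + hB +
    (jet l (root z 2) 0 r * jet l (root z 1) 1 r - jet l (root z 2) 1 r * jet l (root z 1) 0 r) * hg

/-- The operation `T_l` in the first variable of the kernel does not jump on the diagonal. -/
theorem jump_tau {l : ℕ} (hl : l = 1 ∨ l = 2) {κ : ℝ} {z : ℂ} (hz : z ≠ 0)
    (hd : coeffDen l κ z ≠ 0) {r : ℝ} :
    ∑ i, (sol l z (tau z (psi i)) 0 r * sol l z (phi l κ z i) 0 r -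
      sol l z (tau z (phi l κ z i)) 0 r * sol l z (psi i) 0 r) = 0 := by
  have hg := beta_mul_phi hl hz hd
  have hI := Complex.I_sq
  simp only [phi, psi, Fin.sum_univ_two, Matrix.cons_val_zero, Matrix.cons_val_one, sol_smul]
  simp only [sol, Fin.sum_univ_four, gPlusC, gMinusC, hPlusC, hMinusC, tau, Matrix.cons_val,
    Pi.smul_apply, smul_eq_mul]
  generalize 1 / (2 * z ^ 2 * wMinus l z) = A at *
  generalize 1 / (2 * z ^ 2 * wPlus l z) = B at *
  have r0 : root z 0 ^ 2 = z ^ 2 := by simp [root]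
  have r1 : root z 1 ^ 2 = -z ^ 2 := by simp [root, mul_pow]
  have r2 : root z 2 ^ 2 = z ^ 2 := by simp [root]
  have r3 : root z 3 ^ 2 = -z ^ 2 := by simp [root, mul_pow]
  simp only [r0, r1, r2, r3]
  linear_combination (2 * z ^ 2 * jet l (root z 1) 0 r * jet l (root z 2) 0 r) * hg

/-- The derivative of `T_l` applied to the first variable of the kernel has jump `-1` on the
diagonal, which produces the delta function. -/
theorem jump_tau_one {l : ℕ} (hl : l = 1 ∨ l = 2) {κ : ℝ} {z : ℂ} (hz : z ≠ 0)
    (hd : coeffDen l κ z ≠ 0) {r : ℝ} (hr : 0 < r) :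
    ∑ i, (sol l z (tau z (psi i)) 1 r * sol l z (phi l κ z i) 0 r -
      sol l z (tau z (phi l κ z i)) 1 r * sol l z (psi i) 0 r) = -1 := by
  have hg := beta_mul_phi hl hz hd
  have hp := jet_wronskian_plus hl z hr
  have hm := jet_wronskian_minus hl z hr
  have h1 := wPlus_ne_zero l hz
  have h2 := wMinus_ne_zero l hz
  have hA : 1 / (2 * z ^ 2 * wMinus l z) * wMinus l z * z ^ 2 = 1 / 2 := by field_simp
  have hB : 1 / (2 * z ^ 2 * wPlus l z) * wPlus l z * z ^ 2 = 1 / 2 := by field_simp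
  have hI := Complex.I_sq
  simp only [phi, psi, Fin.sum_univ_two, Matrix.cons_val_zero, Matrix.cons_val_one]
  simp only [sol, Fin.sum_univ_four, gPlusC, gMinusC, hPlusC, hMinusC, tau, Matrix.cons_val,
    Pi.smul_apply, smul_eq_mul]
  generalize 1 / (2 * z ^ 2 * wMinus l z) = A at *
  generalize 1 / (2 * z ^ 2 * wPlus l z) = B at *
  have r0 : root z 0 ^ 2 = z ^ 2 := by simp [root]
  have r1 : root z 1 ^ 2 = -z ^ 2 := by simp [root, mul_pow]
  have r2 : root z 2 ^ 2 = z ^ 2 := by simp [root]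
  have r3 : root z 3 ^ 2 = -z ^ 2 := by simp [root, mul_pow]
  simp only [r0, r1, r2, r3]
  linear_combination -A * z ^ 2 * hm - B * z ^ 2 * hp - hA - hB +
    z ^ 2 * (jet l (root z 2) 0 r * jet l (root z 1) 1 r +
      jet l (root z 2) 1 r * jet l (root z 1) 0 r) * hg

theorem boundaryCoeff_smul {l : ℕ} {κ : ℝ} {z : ℂ} {c : Fin 4 → ℂ} (a : ℂ)
    (h : BoundaryCoeff l κ z c) : BoundaryCoeff l κ z (a • c) := by
  refine ⟨by rw [moment_smul, h.1, mul_zero], ?_⟩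
  have h2 := h.2
  split_ifs at h2 ⊢
  · simp only [moment_smul]
    linear_combination a * h2
  · simp only [moment_smul]
    linear_combination a * h2

theorem boundaryCoeff_phi {l : ℕ} (hl : l = 1 ∨ l = 2) {κ : ℝ} {z : ℂ}
    (hd : coeffDen l κ z ≠ 0) (i : Fin 2) : BoundaryCoeff l κ z (phi l κ z i) := by
  fin_cases i
  · exact boundaryCoeff_smul _ (boundaryCoeff_hMinusC hl hd)
  · exact boundaryCoeff_smul _ (boundaryCoeff_hPlusC hl hd)

/-- The sum of the two solutions in the smaller variable vanishes at zero to the highest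
possible order: its moments of orders `0`, `2` vanish (the latter again by the relation between
`β_+` and `β_-`), and the boundary condition removes one more. This is what compensates the
singularity of `g_±` at zero. -/
theorem reg_phi_add {l : ℕ} (hl : l = 1 ∨ l = 2) {κ : ℝ} {z : ℂ} (hz : z ≠ 0)
    (hd : coeffDen l κ z ≠ 0) {k : ℕ} (hk : k < l + 3) :
    reg l z (phi l κ z 0 + phi l κ z 1) k 0 = 0 := by
  set H := phi l κ z 0 + phi l κ z 1 with hH
  have b0 := boundaryCoeff_phi hl hd 0
  have b1 := boundaryCoeff_phi hl hd 1
  have m0 : moment z H 0 = 0 := by rw [hH, moment_add, b0.1, b1.1, add_zero]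
  have m2 : moment z H 2 = 0 := by
    have hg := beta_mul_phi hl hz hd
    have hp := (boundaryCoeff_hPlusC hl hd).1
    have hm := (boundaryCoeff_hMinusC hl hd).1
    have hI := Complex.I_sq
    rw [hH, moment_add]
    simp only [phi, Matrix.cons_val_zero, Matrix.cons_val_one, moment_smul]
    simp [moment, Fin.sum_univ_four, hPlusC, hMinusC, root, mul_pow] at hp hm ⊢
    generalize z ^ 2 = w at *
    simp only [one_div, mul_inv] at *
    linear_combination (2 * w) * hg - ((wMinus l z)⁻¹ * (w⁻¹ * 2⁻¹) * w) * hm -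
      ((wPlus l z)⁻¹ * (w⁻¹ * 2⁻¹) * w) * hp
  have h4 := moment_add_four z H 0
  have h5 := moment_add_four z H 1
  have h6 := moment_add_four z H 2
  norm_num [m0, m2] at h4 h5 h6
  rcases hl with rfl | rfl
  · have m3 : moment z H 3 = 0 := by
      have e0 := b0.2
      have e1 := b1.2
      simp only [if_true] at e0 e1
      rw [hH, moment_add] at m2 ⊢
      linear_combination (1 / 2) * e0 + (1 / 2) * e1 - (1 / 2) * ((√2 : ℝ) * κ) * m2
    rw [reg_zero_right, if_pos rfl]
    interval_cases k <;> norm_num [m2, m3, h4]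
  · have m1 : moment z H 1 = 0 := by
      have e0 := b0.2
      have e1 := b1.2
      simp only [if_neg (show ¬(2 = 1) by norm_num)] at e0 e1
      have hz4 : 2 * z ^ 4 ≠ 0 := by simp [hz]
      refine mul_left_cancel₀ hz4 ?_
      rw [hH, moment_add] at m2 ⊢
      linear_combination e0 + e1 + ((√2 : ℝ) * (κ : ℂ) ^ 3) * m2
    rw [reg_zero_right, if_neg (by norm_num)]
    interval_cases k <;> norm_num [m1, m2, h4, h5, h6]

/-! ### Bounds for solutions and for the kernel -/

theorem norm_jet_le {l : ℕ} (hl : l = 1 ∨ l = 2) (a : ℂ) :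
    ∃ C, 0 ≤ C ∧ ∀ r : ℝ, 1 ≤ r → ‖jet l a 0 r‖ ≤ C * Real.exp (a.re * r) := by
  refine ⟨(1 + ‖a‖) ^ 2 * 3, by positivity, fun r hr => ?_⟩
  have hr0 : 0 < r := by linarith
  have hexp : ‖Complex.exp (a * r)‖ = Real.exp (a.re * r) := by
    rw [Complex.norm_exp]; simp
  have hrn : ‖(r : ℂ)‖ = r := by rw [Complex.norm_real, Real.norm_of_nonneg hr0.le]
  have ha := norm_nonneg a
  have hi : ∀ n : ℕ, 1 / r ^ n ≤ 1 := fun n => by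
    rw [div_le_one (by positivity)]; exact one_le_pow₀ hr
  rcases hl with rfl | rfl
  · rw [jet_one_zero a hr0, norm_mul, hexp]
    gcongr
    refine (norm_sub_le _ _).trans ?_
    rw [norm_div, norm_one, hrn]
    have := hi 1
    rw [pow_one] at this
    nlinarith
  · rw [jet_two_zero a hr0, norm_mul, hexp]
    gcongr
    refine (norm_add_le _ _).trans ((add_le_add (norm_sub_le _ _) le_rfl).trans ?_)
    rw [norm_div, norm_div, norm_pow, norm_mul, norm_pow, hrn]
    norm_num
    have h1 := hi 1
    have h2 := hi 2
    rw [pow_one] at h1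
    have h3 : 3 * ‖a‖ / r ≤ 3 * ‖a‖ := by
      calc 3 * ‖a‖ / r = 3 * ‖a‖ * (1 / r) := by ring
        _ ≤ 3 * ‖a‖ * 1 := by gcongr
        _ = 3 * ‖a‖ := mul_one _
    have h4 : 3 / r ^ 2 ≤ 3 := by
      calc 3 / r ^ 2 = 3 * (1 / r ^ 2) := by ring
        _ ≤ 3 * 1 := by gcongr
        _ = 3 := mul_one _
    nlinarith

theorem norm_sol_le {l : ℕ} (hl : l = 1 ∨ l = 2) (z : ℂ) (c : Fin 4 → ℂ) {σ : ℝ}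
    (hσ : ∀ j, c j ≠ 0 → (root z j).re ≤ σ) :
    ∃ C, 0 ≤ C ∧ ∀ r : ℝ, 1 ≤ r → ‖sol l z c 0 r‖ ≤ C * Real.exp (σ * r) := by
  choose C hC0 hC using fun j => norm_jet_le hl (root z j)
  refine ⟨∑ j, ‖c j‖ * C j, Finset.sum_nonneg fun j _ => mul_nonneg (norm_nonneg _) (hC0 j),
    fun r hr => ?_⟩
  rw [Finset.sum_mul]
  refine (norm_sum_le _ _).trans (Finset.sum_le_sum fun j _ => ?_)
  rw [norm_mul, mul_assoc]
  by_cases hc : c j = 0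
  · simp [hc]
  · have h1 := hC0 j
    have h2 := hσ j hc
    refine mul_le_mul_of_nonneg_left ((hC j r hr).trans ?_) (norm_nonneg _)
    gcongr

theorem norm_sol_le_of_regular {l : ℕ} (hl : l = 1 ∨ l = 2) {z : ℂ} {c : Fin 4 → ℂ}
    (h0 : moment z c 0 = 0) {σ : ℝ} (hσ : ∀ j, c j ≠ 0 → (root z j).re ≤ σ) :
    ∃ C, 0 ≤ C ∧ ∀ r : ℝ, 0 < r → ‖sol l z c 0 r‖ ≤ C * Real.exp (σ * r) := by
  obtain ⟨C, hC0, hC⟩ := norm_sol_le hl z c hσ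
  obtain ⟨D, hD0, hD⟩ := norm_reg_le (l := l) (z := z) (c := c) (n := 0) (by simp) le_rfl
  refine ⟨C + D * Real.exp |σ|, by positivity, fun r hr => ?_⟩
  rw [add_mul]
  rcases le_total 1 r with h | h
  · exact (hC r h).trans (le_add_of_nonneg_right (by positivity))
  · refine le_trans ?_ (le_add_of_nonneg_left (by positivity))
    rw [sol_eq_reg h0, mul_assoc, ← Real.exp_add]
    refine (hD r hr.le h).trans ?_
    rw [pow_zero]
    have : 1 ≤ Real.exp (|σ| + σ * r) := by
      apply Real.one_le_exp
      have h1 : -|σ| ≤ σ := neg_abs_le σ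
      nlinarith [abs_nonneg σ]
    gcongr

/-- A solution and its derivatives have at most the singularity of `D_l 1` at zero. -/
theorem norm_sol_le_pow {l : ℕ} (hl : l = 1 ∨ l = 2) (z : ℂ) (c : Fin 4 → ℂ) (k : ℕ) :
    ∃ C, 0 ≤ C ∧ ∀ r : ℝ, 0 < r → r ≤ 1 → ‖sol l z c k r‖ ≤ C / r ^ (l + k) := by
  obtain ⟨D, hD⟩ := isCompact_Icc.exists_bound_of_continuousOn
    (continuous_reg l z c k).continuousOn (s := Icc (0 : ℝ) 1)
  have hD0 : 0 ≤ D := (norm_nonneg _).trans (hD 0 (by simp))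
  refine ⟨D + ‖moment z c 0‖ * (3 * (k + 1).factorial), by positivity, fun r hr h1 => ?_⟩
  have hrn : ‖(r : ℂ)‖ = r := by rw [Complex.norm_real, Real.norm_of_nonneg hr.le]
  have hpow : r ^ (l + k) ≤ 1 := pow_le_one₀ hr.le h1
  have hs : ‖singJet l k r‖ ≤ 3 * (k + 1).factorial / r ^ (l + k) := by
    rcases hl with rfl | rfl
    · rw [singJet, if_pos rfl, add_comm 1 k]
      simp only [norm_div, norm_mul, norm_neg, norm_pow, norm_one, one_pow, one_mul, hrn,
        Complex.norm_natCast]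
      gcongr
      have h2 : (k.factorial : ℝ) ≤ (k + 1).factorial := by
        exact_mod_cast Nat.factorial_le (Nat.le_succ k)
      have h3 : (0 : ℝ) ≤ (k + 1).factorial := by positivity
      linarith
    · rw [singJet, if_neg (by norm_num), add_comm 2 k]
      simp only [norm_div, norm_mul, norm_neg, norm_pow, norm_one, one_pow, mul_one, hrn,
        Complex.norm_natCast]
      norm_num
  rw [sol_eq_reg_add, add_div]
  refine (norm_add_le _ _).trans (add_le_add ?_ ?_)
  · refine (hD r ⟨hr.le, h1⟩).trans ?_
    rw [le_div_iff₀ (by positivity)]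
    exact mul_le_of_le_one_right hD0 hpow
  · rw [norm_mul, mul_div_assoc]
    gcongr

/-- The form of the kernel for `r ≤ s` in which the singular solution `g_-` is accompanied by a
factor which vanishes at zero to high order. -/
theorem kernelLE_eq (l : ℕ) (κ : ℝ) (z : ℂ) (r s : ℝ) :
    kernelLE l κ z r s =
      sol l z (phi l κ z 0 + phi l κ z 1) 0 r * sol l z (psi 0) 0 s +
        sol l z (phi l κ z 1) 0 r * sol l z (psi 1 - psi 0) 0 s := by
  simp only [kernelLE, Fin.sum_univ_two, sol_add, sol_sub]
  ring

theorem moment_psi_sub (z : ℂ) : moment z (psi 1 - psi 0) 0 = 0 := by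
  simp [moment, Fin.sum_univ_four, psi, gPlusC, gMinusC]

theorem root_re (z : ℂ) (j : Fin 4) : (root z j).re = ![z.re, -z.im, -z.re, z.im] j := by
  fin_cases j <;> simp [root]

theorem norm_kernelLE_le {l : ℕ} (hl : l = 1 ∨ l = 2) {κ : ℝ} {z : ℂ} (hx : 0 < z.re)
    (hy : 0 < z.im) (hd : coeffDen l κ z ≠ 0) :
    ∃ C, 0 ≤ C ∧ ∀ r s : ℝ, 0 < r → r ≤ s →
      ‖kernelLE l κ z r s‖ ≤ C * Real.exp (-(min z.re z.im * (s - r))) := by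
  have hz : z ≠ 0 := fun h => by simp [h] at hx
  set m := min z.re z.im with hm
  have hm0 : 0 < m := lt_min hx hy
  have hmx : m ≤ z.re := min_le_left _ _
  have hmy : m ≤ z.im := min_le_right _ _
  obtain ⟨A0, hA0, A⟩ := norm_sol_le_of_regular hl (boundaryCoeff_phi hl hd 0).1 (σ := z.im)
    (fun j hj => by
      rw [root_re]
      fin_cases j
      · simp [phi, hMinusC] at hj
      · simp; linarith
      · simp; linarith
      · simp)
  obtain ⟨B0, hB0, B⟩ := norm_sol_le_of_regular hl (boundaryCoeff_phi hl hd 1).1 (σ := z.re)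
    (fun j hj => by
      rw [root_re]
      fin_cases j
      · simp
      · simp; linarith
      · simp; linarith
      · simp [phi, hPlusC] at hj)
  obtain ⟨C0, hC0, C⟩ := norm_sol_le hl z (psi 0) (σ := -z.im) (fun j hj => by
      rw [root_re]
      fin_cases j <;> simp [psi, gMinusC] at hj ⊢)
  obtain ⟨D0, hD0, D⟩ := norm_sol_le hl z (psi 1) (σ := -z.re) (fun j hj => by
      rw [root_re]
      fin_cases j <;> simp [psi, gPlusC] at hj ⊢)
  obtain ⟨E0, hE0, E⟩ := norm_reg_le (l := l) (z := z) (c := phi l κ z 0 + phi l κ z 1)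
    (n := l + 3) (fun k hk => reg_phi_add hl hz hd hk) (Nat.zero_le _)
  obtain ⟨F0, hF0, F⟩ := norm_sol_le_pow hl z (psi 0) 0
  obtain ⟨K0, hK0, K⟩ := norm_sol_le_of_regular hl (moment_psi_sub z) (σ := 0)
    (fun j hj => by
      rw [root_re]
      fin_cases j
      · simp [psi, gPlusC, gMinusC] at hj
      · simp; linarith
      · simp; linarith
      · simp [psi, gPlusC, gMinusC] at hj)
  have hmom : moment z (phi l κ z 0 + phi l κ z 1) 0 = 0 := by
    rw [moment_add, (boundaryCoeff_phi hl hd 0).1, (boundaryCoeff_phi hl hd 1).1, add_zero]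
  refine ⟨A0 * C0 + B0 * D0 + (E0 * F0 + B0 * Real.exp z.re * K0) * Real.exp m, by positivity,
    fun r s hr hrs => ?_⟩
  have hs := hr.trans_le hrs
  rw [add_mul]
  -- For `s ≥ 1` the pairs `(h_-, g_-)` and `(h_+, g_+)` are estimated separately. For `s ≤ 1` the
  -- singular factor `s^{-l}` of `g_-` is compensated by the factor `r^{l+3}`, since `r ≤ s`.
  rcases le_total 1 s with h1 | h1
  · refine le_trans ?_ (le_add_of_nonneg_right (by positivity))
    rw [kernelLE, Fin.sum_univ_two, add_mul]
    refine (norm_add_le _ _).trans (add_le_add ?_ ?_)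
    · rw [norm_mul]
      calc _ ≤ (A0 * Real.exp (z.im * r)) * (C0 * Real.exp (-z.im * s)) :=
            mul_le_mul (A r hr) (C s h1) (norm_nonneg _) (by positivity)
        _ = A0 * C0 * Real.exp (-(z.im * (s - r))) := by
            rw [show -(z.im * (s - r)) = z.im * r + -z.im * s by ring, Real.exp_add]; ring
        _ ≤ _ := by
            have : 0 ≤ s - r := by linarith
            gcongr
    · rw [norm_mul]
      calc _ ≤ (B0 * Real.exp (z.re * r)) * (D0 * Real.exp (-z.re * s)) :=
            mul_le_mul (B r hr) (D s h1) (norm_nonneg _) (by positivity)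
        _ = B0 * D0 * Real.exp (-(z.re * (s - r))) := by
            rw [show -(z.re * (s - r)) = z.re * r + -z.re * s by ring, Real.exp_add]; ring
        _ ≤ _ := by
            have : 0 ≤ s - r := by linarith
            gcongr
  · refine le_trans ?_ (le_add_of_nonneg_left (by positivity))
    have hr1 : r ≤ 1 := hrs.trans h1
    have hbd : ‖kernelLE l κ z r s‖ ≤ E0 * F0 + B0 * Real.exp z.re * K0 := by
      rw [kernelLE_eq]
      refine (norm_add_le _ _).trans (add_le_add ?_ ?_)
      · rw [norm_mul, sol_eq_reg hmom]
        calc _ ≤ (E0 * r ^ (l + 3 - 0)) * (F0 / s ^ (l + 0)) :=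
              mul_le_mul (E r hr.le hr1) (F s hs h1) (norm_nonneg _) (by positivity)
          _ = E0 * F0 * (r ^ 3 * (r ^ l / s ^ l)) := by
              rw [Nat.sub_zero, add_zero, pow_add]; ring
          _ ≤ E0 * F0 * (1 * 1) := by
              gcongr
              · exact pow_le_one₀ hr.le hr1
              · rw [div_le_one (by positivity)]
                gcongr
          _ = _ := by ring
      · rw [norm_mul]
        refine mul_le_mul ((B r hr).trans ?_) ((K s hs).trans ?_) (norm_nonneg _) (by positivity)
        · gcongr
          nlinarith
        · simp
    rw [mul_assoc, ← Real.exp_add]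
    refine hbd.trans (le_mul_of_one_le_right (by positivity) (Real.one_le_exp ?_))
    nlinarith

theorem norm_resolventKernel_le {l : ℕ} (hl : l = 1 ∨ l = 2) {κ : ℝ} {z : ℂ} (hx : 0 < z.re)
    (hy : 0 < z.im) (hd : coeffDen l κ z ≠ 0) :
    ∃ C, 0 ≤ C ∧ ∀ r s : ℝ, 0 < r → 0 < s →
      ‖resolventKernel l κ z r s‖ ≤ C * Real.exp (-(min z.re z.im * |r - s|)) := by
  obtain ⟨C, hC0, hC⟩ := norm_kernelLE_le hl hx hy hd
  refine ⟨C, hC0, fun r s hr hs => ?_⟩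
  rcases le_total r s with h | h
  · rw [resolventKernel_eq hl κ z hr h, abs_sub_comm, abs_of_nonneg (by linarith)]
    exact hC r s hr h
  · rw [resolventKernel_symm, resolventKernel_eq hl κ z hs h, abs_of_nonneg (by linarith)]
    exact hC s r hs h

/-! ### The kernel as a fundamental solution -/

theorem contDiffOn_radialT (l : ℕ) {f : ℝ → ℂ} (hf : ContDiffOn ℝ ∞ f (Ioi 0)) :
    ContDiffOn ℝ ∞ (radialT l f) (Ioi 0) := by
  have h2 : ContDiffOn ℝ ∞ (iteratedDeriv 2 f) (Ioi 0) := by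
    have h1 : ContDiffOn ℝ ∞ (deriv f) (Ioi 0) := hf.deriv_of_isOpen isOpen_Ioi (by simp)
    have := h1.deriv_of_isOpen (m := ∞) isOpen_Ioi (by simp)
    simpa [iteratedDeriv_succ, iteratedDeriv_zero] using this
  have hof : ContDiffOn ℝ ∞ (fun r : ℝ => (r : ℂ)) (Ioi 0) :=
    Complex.ofRealCLM.contDiff.contDiffOn
  have hpot : ContDiffOn ℝ ∞ (fun r : ℝ => (l : ℂ) * ((l : ℂ) + 1) / (r : ℂ) ^ 2) (Ioi 0) := by
    simp only [div_eq_mul_inv]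
    refine contDiffOn_const.mul ((hof.pow 2).inv ?_)
    intro r hr
    have : (r : ℂ) ≠ 0 := by exact_mod_cast (ne_of_gt hr)
    exact pow_ne_zero 2 this
  exact h2.neg.add (hpot.mul hf)

theorem hasDerivAt_of_contDiffOn {f : ℝ → ℂ} (hf : ContDiffOn ℝ ∞ f (Ioi 0)) {r : ℝ}
    (hr : 0 < r) : HasDerivAt f (deriv f r) r :=
  ((hf.contDiffAt (Ioi_mem_nhds hr)).differentiableAt (by simp)).hasDerivAt

/-- The boundary form of `T_l²` on a solution and a test function. -/
def lagrange (l : ℕ) (z : ℂ) (c : Fin 4 → ℂ) (χ : ℝ → ℂ) (r : ℝ) : ℂ :=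
  -(sol l z c 0 r * deriv (radialT l χ) r) + sol l z c 1 r * radialT l χ r -
    sol l z (tau z c) 0 r * deriv χ r + sol l z (tau z c) 1 r * χ r

/-- Lagrange's identity for `T_l² - z⁴`. -/
theorem lagrange_hasDerivAt {l : ℕ} (hl : l = 1 ∨ l = 2) (z : ℂ) (c : Fin 4 → ℂ) {χ : ℝ → ℂ}
    (hχ : ContDiffOn ℝ ∞ χ (Ioi 0)) {r : ℝ} (hr : 0 < r) :
    HasDerivAt (lagrange l z c χ)
      (sol l z c 0 r * (radialT l (radialT l χ) r - z ^ 4 * χ r)) r := by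
  have hT := contDiffOn_radialT l hχ
  have dχ := hasDerivAt_of_contDiffOn hχ hr
  have dχ' := hasDerivAt_of_contDiffOn (hχ.deriv_of_isOpen isOpen_Ioi (m := ∞) (by simp)) hr
  have dT := hasDerivAt_of_contDiffOn hT hr
  have dT' := hasDerivAt_of_contDiffOn (hT.deriv_of_isOpen isOpen_Ioi (m := ∞) (by simp)) hr
  have e0 := sol_tau hl z c hr
  have e1 := sol_tau hl z (tau z c) hr
  rw [tau_tau, sol_smul] at e1
  have := ((((sol_hasDerivAt l z c 0 hr).mul dT').neg.add
    ((sol_hasDerivAt l z c 1 hr).mul dT)).sub ((sol_hasDerivAt l z (tau z c) 0 hr).mul dχ')).add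
    ((sol_hasDerivAt l z (tau z c) 1 hr).mul dχ)
  refine this.congr_deriv ?_
  have f0 : radialT l (radialT l χ) r = -deriv (deriv (radialT l χ)) r +
      (l : ℂ) * ((l : ℂ) + 1) / (r : ℂ) ^ 2 * radialT l χ r := by
    conv_lhs => rw [radialT, iteratedDeriv_succ, iteratedDeriv_one]
  have f1 : radialT l χ r = -deriv (deriv χ) r +
      (l : ℂ) * ((l : ℂ) + 1) / (r : ℂ) ^ 2 * χ r := by
    conv_lhs => rw [radialT, iteratedDeriv_succ, iteratedDeriv_one]
  rw [f0]
  linear_combination (-radialT l χ r) * e0 - χ r * e1 - sol l z (tau z c) 0 r * f1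

theorem integral_sol_mul_eq {l : ℕ} (hl : l = 1 ∨ l = 2) (z : ℂ) (c : Fin 4 → ℂ) {χ : ℝ → ℂ}
    (hχ : ContDiffOn ℝ ∞ χ (Ioi 0)) {a b : ℝ} (ha : 0 < a) (hab : a ≤ b) :
    IntervalIntegrable (fun r => sol l z c 0 r * (radialT l (radialT l χ) r - z ^ 4 * χ r))
      volume a b ∧
    ∫ r in a..b, sol l z c 0 r * (radialT l (radialT l χ) r - z ^ 4 * χ r) =
      lagrange l z c χ b - lagrange l z c χ a := by
  have hsub : uIcc a b ⊆ Ioi 0 := by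
    rw [uIcc_of_le hab]; exact fun x hx => ha.trans_le hx.1
  have hi : IntervalIntegrable
      (fun r => sol l z c 0 r * (radialT l (radialT l χ) r - z ^ 4 * χ r)) volume a b := by
    apply ContinuousOn.intervalIntegrable
    refine ContinuousOn.mono ?_ hsub
    exact (continuousOn_sol l z c 0).mul
      ((contDiffOn_radialT l (contDiffOn_radialT l hχ)).continuousOn.sub
        (continuousOn_const.mul hχ.continuousOn))
  exact ⟨hi, intervalIntegral.integral_eq_sub_of_hasDerivAt
    (fun r hr => lagrange_hasDerivAt hl z c hχ (hsub hr)) hi⟩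

theorem radialT_eq_zero_of_eventuallyEq {l : ℕ} {f : ℝ → ℂ} {r : ℝ} (h : f =ᶠ[𝓝 r] 0) :
    radialT l f =ᶠ[𝓝 r] 0 := by
  filter_upwards [h.eventuallyEq_nhds] with x hx
  have h2 : iteratedDeriv 2 f x = 0 := by
    rw [(hx.iteratedDeriv 2).eq_of_nhds]
    exact iteratedDeriv_const_zero
  simp [radialT, h2, hx.eq_of_nhds]

/-- The coefficients of the solution `R(·, s)` on `(0, s]`. -/
def lowerC (l : ℕ) (κ : ℝ) (z : ℂ) (s : ℝ) : Fin 4 → ℂ :=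
  sol l z (psi 0) 0 s • phi l κ z 0 + sol l z (psi 1) 0 s • phi l κ z 1

/-- The coefficients of the solution `R(·, s)` on `[s, ∞)`. -/
def upperC (l : ℕ) (κ : ℝ) (z : ℂ) (s : ℝ) : Fin 4 → ℂ :=
  sol l z (phi l κ z 0) 0 s • psi 0 + sol l z (phi l κ z 1) 0 s • psi 1

theorem resolventKernel_eq_lower {l : ℕ} (hl : l = 1 ∨ l = 2) (κ : ℝ) (z : ℂ) {r s : ℝ}
    (hr : 0 < r) (hrs : r ≤ s) :
    resolventKernel l κ z r s = sol l z (lowerC l κ z s) 0 r := by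
  rw [resolventKernel_eq hl κ z hr hrs, kernelLE, Fin.sum_univ_two, lowerC, sol_add, sol_smul,
    sol_smul]
  ring

theorem resolventKernel_eq_upper {l : ℕ} (hl : l = 1 ∨ l = 2) (κ : ℝ) (z : ℂ) {r s : ℝ}
    (hs : 0 < s) (hrs : s ≤ r) :
    resolventKernel l κ z r s = sol l z (upperC l κ z s) 0 r := by
  rw [resolventKernel_symm, resolventKernel_eq hl κ z hs hrs, kernelLE, Fin.sum_univ_two, upperC,
    sol_add, sol_smul, sol_smul]

theorem continuousOn_resolventKernel {l : ℕ} (hl : l = 1 ∨ l = 2) (κ : ℝ) (z : ℂ) {s : ℝ}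
    (hs : 0 < s) : ContinuousOn (fun r => resolventKernel l κ z r s) (Ioi 0) := by
  have h1 : ContinuousOn (fun r => sol l z (lowerC l κ z s) 0 (min r s) +
      sol l z (upperC l κ z s) 0 (max r s) - resolventKernel l κ z s s) (Ioi 0) := by
    refine (ContinuousOn.add ?_ ?_).sub continuousOn_const
    · exact (continuousOn_sol l z _ 0).comp (continuous_id.min continuous_const).continuousOn
        fun r hr => lt_min hr hs
    · exact (continuousOn_sol l z _ 0).comp (continuous_id.max continuous_const).continuousOn
        fun r hr => lt_max_of_lt_right hs
  refine h1.congr fun r hr => ?_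
  rcases le_total r s with h | h
  · simp only [min_eq_left h, max_eq_right h]
    rw [resolventKernel_eq_lower hl κ z hr h, resolventKernel_eq_upper hl κ z hs le_rfl]
    ring
  · simp only [min_eq_right h, max_eq_left h]
    rw [resolventKernel_eq_upper hl κ z hs h, resolventKernel_eq_lower hl κ z hs le_rfl]
    ring

theorem tau_add (z : ℂ) (c d : Fin 4 → ℂ) : tau z (c + d) = tau z c + tau z d := by
  funext j; simp [tau]; ring

theorem tau_smul (z a : ℂ) (c : Fin 4 → ℂ) : tau z (a • c) = a • tau z c := by
  funext j; simp [tau]; ring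

/-- The boundary forms from the left and from the right of the diagonal differ by the value of
the test function. -/
theorem lagrange_lower_sub_upper {l : ℕ} (hl : l = 1 ∨ l = 2) {κ : ℝ} {z : ℂ} (hz : z ≠ 0)
    (hd : coeffDen l κ z ≠ 0) (χ : ℝ → ℂ) {s : ℝ} (hs : 0 < s) :
    lagrange l z (lowerC l κ z s) χ s - lagrange l z (upperC l κ z s) χ s = χ s := by
  have h1 := jump_one hl hz hd hs
  have h2 := jump_tau (r := s) hl hz hd
  have h3 := jump_tau_one hl hz hd hs
  simp only [Fin.sum_univ_two] at h1 h2 h3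
  simp only [lagrange, lowerC, upperC, tau_add, tau_smul, sol_add, sol_smul]
  linear_combination (-radialT l χ s) * h1 + deriv χ s * h2 - χ s * h3

theorem isFundamentalSolution_resolventKernel {l : ℕ} (hl : l = 1 ∨ l = 2) {κ : ℝ} {z : ℂ}
    (hz : z ≠ 0) (hd : coeffDen l κ z ≠ 0) {s : ℝ} (hs : 0 < s) :
    IsFundamentalSolution l (z ^ 4) s (fun r => resolventKernel l κ z r s) := by
  refine ⟨(continuousOn_resolventKernel hl κ z hs).locallyIntegrableOn measurableSet_Ioi,
    fun χ hχ hc hsupp => ?_⟩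
  have hχ' : ContDiffOn ℝ ∞ χ (Ioi 0) := hχ.contDiffOn
  obtain ⟨a, ha, has, hasupp⟩ : ∃ a, 0 < a ∧ a < s ∧ ∀ x ∈ tsupport χ, a < x := by
    rcases (tsupport χ).eq_empty_or_nonempty with h | h
    · exact ⟨s / 2, by linarith, by linarith, by simp [h]⟩
    · obtain ⟨x₀, hx₀, hmin⟩ := hc.isCompact.exists_isMinOn h continuousOn_id
      have hx₀' : 0 < x₀ := hsupp hx₀
      refine ⟨min x₀ s / 2, by positivity, ?_, fun x hx => ?_⟩
      · have := min_le_right x₀ s; linarith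
      · have h1 := min_le_left x₀ s
        have h2 : x₀ ≤ x := hmin hx
        linarith
  obtain ⟨b, hsb, hbsupp⟩ : ∃ b, s < b ∧ ∀ x ∈ tsupport χ, x < b := by
    obtain ⟨B, hB⟩ := hc.isCompact.isBounded.bddAbove
    exact ⟨max s B + 1, by have := le_max_left s B; linarith,
      fun x hx => by have := le_max_right s B; have := hB hx; linarith⟩
  have hev : ∀ x, x ∉ tsupport χ → χ =ᶠ[𝓝 x] 0 := fun x hx =>
    notMem_tsupport_iff_eventuallyEq.mp hx
  -- Only the boundary terms on the diagonal contribute.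
  have hlag : ∀ x, x ∉ tsupport χ → ∀ c, lagrange l z c χ x = 0 := by
    intro x hx c
    have h0 := hev x hx
    have h1 := radialT_eq_zero_of_eventuallyEq (l := l) h0
    have h2 : deriv χ x = 0 := by rw [h0.deriv_eq]; exact deriv_const x (0 : ℂ)
    have h3 : deriv (radialT l χ) x = 0 := by rw [h1.deriv_eq]; exact deriv_const x (0 : ℂ)
    simp [lagrange, h0.eq_of_nhds, h1.eq_of_nhds, h2, h3]
  obtain ⟨i1, e1⟩ := integral_sol_mul_eq hl z (lowerC l κ z s) hχ' ha has.le
  obtain ⟨i2, e2⟩ := integral_sol_mul_eq hl z (upperC l κ z s) hχ' hs hsb.le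
  set F := fun r => resolventKernel l κ z r s * (radialT l (radialT l χ) r - z ^ 4 * χ r) with hF
  have c1 : EqOn (fun r => sol l z (lowerC l κ z s) 0 r *
      (radialT l (radialT l χ) r - z ^ 4 * χ r)) F (uIcc a s) := fun r hr => by
    rw [uIcc_of_le has.le] at hr
    simp only [hF, resolventKernel_eq_lower hl κ z (ha.trans_le hr.1) hr.2]
  have c2 : EqOn (fun r => sol l z (upperC l κ z s) 0 r *
      (radialT l (radialT l χ) r - z ^ 4 * χ r)) F (uIcc s b) := fun r hr => by
    rw [uIcc_of_le hsb.le] at hr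
    simp only [hF, resolventKernel_eq_upper hl κ z hs hr.1]
  have hint : ∫ r in Ioi (0 : ℝ), F r = ∫ r in a..b, F r := by
    rw [intervalIntegral.integral_of_le (has.trans hsb).le]
    refine (setIntegral_eq_of_subset_of_forall_sdiff_eq_zero measurableSet_Ioi
      (fun x hx => ha.trans hx.1) fun x hx => ?_)
    have hx' : x ∉ tsupport χ := fun hxs =>
      hx.2 ⟨hasupp x hxs, (hbsupp x hxs).le⟩
    have h0 := hev x hx'
    have h1 := radialT_eq_zero_of_eventuallyEq (l := l)
      (radialT_eq_zero_of_eventuallyEq (l := l) h0)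
    simp [hF, h0.eq_of_nhds, h1.eq_of_nhds]
  rw [hint, ← intervalIntegral.integral_add_adjacent_intervals
    ((intervalIntegrable_congr (c1.mono uIoc_subset_uIcc)).1 i1)
    ((intervalIntegrable_congr (c2.mono uIoc_subset_uIcc)).1 i2),
    ← intervalIntegral.integral_congr c1, ← intervalIntegral.integral_congr c2, e1, e2,
    hlag a (fun h => lt_irrefl _ (hasupp a h)), hlag b (fun h => lt_irrefl _ (hbsupp b h)),
    ← lagrange_lower_sub_upper hl hz hd χ hs]
  ring

/-! ### Integral operators with exponentially decaying kernels -/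

theorem integrable_exp_neg_mul_abs {m : ℝ} (hm : 0 < m) :
    Integrable fun t : ℝ => Real.exp (-(m * |t|)) := by
  rw [← integrableOn_univ, ← Iic_union_Ioi (a := (0 : ℝ))]
  refine IntegrableOn.union ?_ ?_
  · refine (integrableOn_exp_mul_Iic hm 0).congr_fun (fun t ht => ?_) measurableSet_Iic
    simp only [abs_of_nonpos (mem_Iic.mp ht)]
    congr 1; ring
  · refine (integrableOn_exp_mul_Ioi (neg_lt_zero.mpr hm) 0).congr_fun (fun t ht => ?_)
      measurableSet_Ioi
    simp only [abs_of_pos (mem_Ioi.mp ht)]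
    congr 1; ring

/-- Schur's test for a convolution kernel with nonnegative values: the Cauchy-Schwarz inequality
for `w = w^{1/2} w^{1/2}`, followed by Tonelli's theorem. -/
theorem lintegral_sq_lintegral_mul_le {w F : ℝ → ENNReal} {S : Set ℝ} (hw : Measurable w)
    (hF : AEMeasurable F (volume.restrict S)) :
    ∫⁻ r in S, (∫⁻ s in S, w (r - s) * F s) ^ (2 : ℝ) ≤
      (∫⁻ t, w t) ^ (2 : ℝ) * ∫⁻ s in S, F s ^ (2 : ℝ) := by
  set M := ∫⁻ t, w t with hM
  have h2 : (2 : ℝ).HolderConjugate 2 := Real.HolderConjugate.two_two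
  have hsq : ∀ x : ENNReal, (x ^ (1 / 2 : ℝ)) ^ (2 : ℝ) = x := fun x => by
    rw [← ENNReal.rpow_mul]; norm_num
  have hpt : ∀ r : ℝ, (∫⁻ s in S, w (r - s) * F s) ^ (2 : ℝ) ≤
      M * ∫⁻ s in S, w (r - s) * F s ^ (2 : ℝ) := by
    intro r
    have hwm : Measurable fun s => w (r - s) ^ (1 / 2 : ℝ) :=
      (hw.comp (measurable_const.sub measurable_id)).pow_const _
    have := ENNReal.lintegral_mul_le_Lp_mul_Lq (volume.restrict S) h2 hwm.aemeasurable
      (hwm.aemeasurable.mul hF)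
    have e1 : ∀ s, ((fun s => w (r - s) ^ (1 / 2 : ℝ)) *
        ((fun s => w (r - s) ^ (1 / 2 : ℝ)) * F)) s = w (r - s) * F s := fun s => by
      simp only [Pi.mul_apply]
      rw [← mul_assoc, ← sq, ← ENNReal.rpow_natCast]
      push_cast
      rw [hsq]
    have e2 : ∀ s, ((fun s => w (r - s) ^ (1 / 2 : ℝ)) * F) s ^ (2 : ℝ) =
        w (r - s) * F s ^ (2 : ℝ) := fun s => by
      simp only [Pi.mul_apply]
      rw [ENNReal.mul_rpow_of_nonneg _ _ (by norm_num), hsq]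
    simp only [e1, e2, hsq] at this
    calc (∫⁻ s in S, w (r - s) * F s) ^ (2 : ℝ)
        ≤ ((∫⁻ s in S, w (r - s)) ^ (1 / 2 : ℝ) *
            (∫⁻ s in S, w (r - s) * F s ^ (2 : ℝ)) ^ (1 / 2 : ℝ)) ^ (2 : ℝ) := by
          gcongr
      _ = (∫⁻ s in S, w (r - s)) * ∫⁻ s in S, w (r - s) * F s ^ (2 : ℝ) := by
          rw [ENNReal.mul_rpow_of_nonneg _ _ (by norm_num), hsq, hsq]
      _ ≤ M * ∫⁻ s in S, w (r - s) * F s ^ (2 : ℝ) := by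
          gcongr
          rw [hM, ← lintegral_sub_left_eq_self w r]
          exact lintegral_mono' Measure.restrict_le_self le_rfl
  calc ∫⁻ r in S, (∫⁻ s in S, w (r - s) * F s) ^ (2 : ℝ)
      ≤ ∫⁻ r in S, M * ∫⁻ s in S, w (r - s) * F s ^ (2 : ℝ) := lintegral_mono hpt
    _ ≤ M * ∫⁻ r in S, ∫⁻ s in S, w (r - s) * F s ^ (2 : ℝ) := by
        rw [lintegral_const_mul'']
        have : AEMeasurable (Function.uncurry fun r s => w (r - s) * F s ^ (2 : ℝ))
            ((volume.restrict S).prod (volume.restrict S)) := by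
          refine AEMeasurable.mul (hw.comp (measurable_fst.sub measurable_snd)).aemeasurable ?_
          exact (hF.pow_const _).comp_quasiMeasurePreserving Measure.quasiMeasurePreserving_snd
        exact this.lintegral_prod_right'
    _ = M * ∫⁻ s in S, ∫⁻ r in S, w (r - s) * F s ^ (2 : ℝ) := by
        rw [lintegral_lintegral_swap]
        refine AEMeasurable.mul (hw.comp (measurable_fst.sub measurable_snd)).aemeasurable ?_
        exact (hF.pow_const _).comp_quasiMeasurePreserving Measure.quasiMeasurePreserving_snd
    _ ≤ M * ∫⁻ s in S, M * F s ^ (2 : ℝ) := by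
        gcongr with s
        have hws : Measurable fun r => w (r - s) := hw.comp (measurable_id.sub measurable_const)
        rw [lintegral_mul_const _ hws]
        gcongr
        rw [hM, ← lintegral_sub_right_eq_self w s]
        exact lintegral_mono' Measure.restrict_le_self le_rfl
    _ = M ^ (2 : ℝ) * ∫⁻ s in S, F s ^ (2 : ℝ) := by
        rw [lintegral_const_mul'' _ (hF.pow_const _), ← mul_assoc]
        congr 1
        rw [show (2 : ℝ) = (2 : ℕ) by norm_num, ENNReal.rpow_natCast, sq]

/-- A function dominated by `e^{-m |r - s|}` is integrable against elements of `L²(0, ∞)`. -/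
theorem integrableOn_mul_of_exp_bound {m C r : ℝ} (hm : 0 < m) {g : ℝ → ℂ}
    (hg : AEStronglyMeasurable g (volume.restrict (Ioi 0)))
    (hb : ∀ s, 0 < s → ‖g s‖ ≤ C * Real.exp (-(m * |r - s|))) (f : HalfLineL2) :
    IntegrableOn (fun s => g s * f s) (Ioi 0) := by
  have hg2 : MemLp g 2 (volume.restrict (Ioi 0)) := by
    rw [memLp_two_iff_integrable_sq_norm hg]
    have h1 : Integrable (fun s : ℝ => C ^ 2 * Real.exp (-(2 * m * |s - r|))) :=
      ((integrable_exp_neg_mul_abs (by linarith : 0 < 2 * m)).comp_sub_right r).const_mul _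
    refine h1.integrableOn.mono' (hg.norm.pow 2) ?_
    filter_upwards [ae_restrict_mem measurableSet_Ioi] with s hs
    rw [Real.norm_of_nonneg (by positivity)]
    calc ‖g s‖ ^ 2 ≤ (C * Real.exp (-(m * |r - s|))) ^ 2 := by gcongr; exact hb s hs
      _ = _ := by
        rw [mul_pow, ← Real.exp_nat_mul, abs_sub_comm]
        congr 2
        push_cast
        ring
  exact hg2.integrable_mul (Lp.memLp f)

/-- A measurable kernel dominated by `e^{-m |r - s|}` defines a bounded operator. -/
theorem exists_hasKernel {m C : ℝ} (hm : 0 < m) {K : ℝ → ℝ → ℂ}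
    (hK : ∀ r, 0 < r → AEStronglyMeasurable (K r) (volume.restrict (Ioi 0)))
    (hb : ∀ r s, 0 < r → 0 < s → ‖K r s‖ ≤ C * Real.exp (-(m * |r - s|)))
    (hmeas : ∀ f : HalfLineL2, AEStronglyMeasurable (fun r => ∫ s in Ioi (0 : ℝ), K r s * f s)
      (volume.restrict (Ioi 0))) :
    ∃ G : HalfLineL2 →L[ℂ] HalfLineL2, HasKernel G K := by
  have hint : ∀ (f : HalfLineL2) (r : ℝ), 0 < r → IntegrableOn (fun s => K r s * f s) (Ioi 0) :=
    fun f r hr => integrableOn_mul_of_exp_bound hm (hK r hr) (hb r · hr) f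
  set w : ℝ → ENNReal := fun t => ENNReal.ofReal (C * Real.exp (-(m * |t|))) with hw
  have hwm : Measurable w := by fun_prop
  have hM : ∫⁻ t, w t ≠ ⊤ :=
    ((integrable_exp_neg_mul_abs hm).const_mul C).lintegral_lt_top.ne
  have hbound : ∀ f : HalfLineL2,
      eLpNorm (fun r => ∫ s in Ioi (0 : ℝ), K r s * f s) 2 (volume.restrict (Ioi 0)) ≤
        (∫⁻ t, w t) * eLpNorm f 2 (volume.restrict (Ioi 0)) := by
    intro f
    have hfm : AEMeasurable (fun s => ‖f s‖ₑ) (volume.restrict (Ioi 0)) :=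
      (Lp.aestronglyMeasurable f).enorm
    rw [eLpNorm_eq_lintegral_rpow_enorm_toReal two_ne_zero ENNReal.ofNat_ne_top,
      eLpNorm_eq_lintegral_rpow_enorm_toReal two_ne_zero ENNReal.ofNat_ne_top,
      ENNReal.toReal_ofNat]
    calc (∫⁻ r in Ioi (0 : ℝ), ‖∫ s in Ioi (0 : ℝ), K r s * f s‖ₑ ^ (2 : ℝ)) ^ (1 / 2 : ℝ)
        ≤ (∫⁻ r in Ioi (0 : ℝ), (∫⁻ s in Ioi (0 : ℝ), w (r - s) * ‖f s‖ₑ) ^ (2 : ℝ)) ^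
            (1 / 2 : ℝ) := by
          refine ENNReal.rpow_le_rpow (setLIntegral_mono' measurableSet_Ioi fun r hr => ?_)
            (by norm_num)
          refine ENNReal.rpow_le_rpow ((enorm_integral_le_lintegral_enorm _).trans
            (setLIntegral_mono' measurableSet_Ioi fun s hs => ?_)) (by norm_num)
          rw [enorm_mul]
          gcongr
          rw [hw, ← ofReal_norm]
          exact ENNReal.ofReal_le_ofReal (hb r s hr hs)
      _ ≤ ((∫⁻ t, w t) ^ (2 : ℝ) * ∫⁻ s in Ioi (0 : ℝ), ‖f s‖ₑ ^ (2 : ℝ)) ^ (1 / 2 : ℝ) :=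
          ENNReal.rpow_le_rpow (lintegral_sq_lintegral_mul_le hwm hfm) (by norm_num)
      _ = _ := by
          rw [ENNReal.mul_rpow_of_nonneg _ _ (by norm_num), ← ENNReal.rpow_mul]
          norm_num
  have hmem : ∀ f : HalfLineL2,
      MemLp (fun r => ∫ s in Ioi (0 : ℝ), K r s * f s) 2 (volume.restrict (Ioi 0)) := fun f =>
    ⟨hmeas f, (hbound f).trans_lt (ENNReal.mul_lt_top hM.lt_top (Lp.memLp f).2)⟩
  let L : HalfLineL2 →ₗ[ℂ] HalfLineL2 :=
    { toFun := fun f => (hmem f).toLp _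
      map_add' := fun f g => by
        rw [← MemLp.toLp_add]
        refine MemLp.toLp_congr _ _ ?_
        filter_upwards [ae_restrict_mem measurableSet_Ioi] with r hr
        rw [Pi.add_apply, ← integral_add (hint f r hr) (hint g r hr)]
        refine integral_congr_ae ?_
        filter_upwards [Lp.coeFn_add f g] with s hs
        rw [hs, Pi.add_apply, mul_add]
      map_smul' := fun c f => by
        rw [RingHom.id_apply, ← MemLp.toLp_const_smul]
        refine MemLp.toLp_congr _ _ ?_
        filter_upwards [ae_restrict_mem measurableSet_Ioi] with r hr
        rw [Pi.smul_apply, smul_eq_mul, ← integral_const_mul]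
        refine integral_congr_ae ?_
        filter_upwards [Lp.coeFn_smul c f] with s hs
        rw [hs, Pi.smul_apply, smul_eq_mul]
        ring }
  refine ⟨L.mkContinuous (∫⁻ t, w t).toReal fun f => ?_, fun f => ⟨hint f, ?_⟩⟩
  · change ‖(hmem f).toLp _‖ ≤ _
    rw [Lp.norm_toLp, Lp.norm_def, ← ENNReal.toReal_mul]
    exact ENNReal.toReal_mono (ENNReal.mul_ne_top hM (Lp.memLp f).2.ne) (hbound f)
  · exact (hmem f).coeFn_toLp

/-! ### Primitives on the half-line -/

theorem continuousOn_of_primitive {M m : ℝ → ℂ}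
    (hm : ∀ a b, 0 < a → a ≤ b → IntervalIntegrable m volume a b)
    (hM : ∀ a b, 0 < a → a ≤ b → M b - M a = ∫ s in a..b, m s) : ContinuousOn M (Ioi 0) := by
  intro r hr
  have hr0 : 0 < r := hr
  have h1 : ContinuousOn (fun x => ∫ s in (r / 2)..x, m s) (uIcc (r / 2) (2 * r)) :=
    intervalIntegral.continuousOn_primitive_interval'
      (hm _ _ (by linarith) (by linarith)) left_mem_uIcc
  rw [uIcc_of_le (by linarith)] at h1
  have h2 : ContinuousAt (fun x => M (r / 2) + ∫ s in (r / 2)..x, m s) r :=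
    continuousAt_const.add (h1.continuousAt (Icc_mem_nhds (by linarith) (by linarith)))
  refine (h2.congr ?_).continuousWithinAt
  filter_upwards [Ioi_mem_nhds (show r / 2 < r by linarith)] with x hx
  rw [← hM (r / 2) x (by linarith) (le_of_lt hx)]
  ring

theorem hasDerivAt_of_primitive {M m : ℝ → ℂ} (hm : ContinuousOn m (Ioi 0))
    (hM : ∀ a b, 0 < a → a ≤ b → M b - M a = ∫ s in a..b, m s) {r : ℝ} (hr : 0 < r) :
    HasDerivAt M (m r) r := by
  have hsub : uIcc (r / 2) r ⊆ Ioi 0 := by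
    rw [uIcc_of_le (by linarith)]
    exact fun x hx => lt_of_lt_of_le (by linarith : (0 : ℝ) < r / 2) hx.1
  have h1 := intervalIntegral.integral_hasDerivAt_right (hm.mono hsub).intervalIntegrable
    (hm.stronglyMeasurableAtFilter isOpen_Ioi r hr) (hm.continuousAt (Ioi_mem_nhds hr))
  refine (h1.const_add (M (r / 2))).congr_of_eventuallyEq ?_
  filter_upwards [Ioi_mem_nhds (show r / 2 < r by linarith)] with x hx
  rw [← hM (r / 2) x (by linarith) (le_of_lt hx)]
  ring

/-! ### The solution of the inhomogeneous equation -/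

/-- Solutions built from decaying exponentials decay, with at most an `r^{-l}` singularity. -/
theorem norm_sol_le_decay {l : ℕ} (hl : l = 1 ∨ l = 2) (z : ℂ) (c : Fin 4 → ℂ) {m : ℝ}
    (hm : 0 ≤ m) (hc : ∀ j, c j ≠ 0 → (root z j).re ≤ -m) :
    ∃ C, 0 ≤ C ∧ ∀ s : ℝ, 0 < s →
      ‖sol l z c 0 s‖ ≤ C * Real.exp (-(m * s)) / (min s 1) ^ l := by
  obtain ⟨C, hC0, hC⟩ := norm_sol_le hl z c hc
  obtain ⟨D, hD0, hD⟩ := norm_sol_le_pow hl z c 0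
  refine ⟨C + D * Real.exp m, by positivity, fun s hs => ?_⟩
  rcases le_total 1 s with h | h
  · rw [min_eq_right h, one_pow, div_one, add_mul]
    refine (hC s h).trans (le_trans (le_of_eq ?_) (le_add_of_nonneg_right (by positivity)))
    rw [neg_mul]
  · rw [min_eq_left h]
    refine (hD s hs h).trans ?_
    rw [add_zero]
    gcongr
    rw [add_mul, mul_assoc, ← Real.exp_add]
    refine le_trans ?_ (le_add_of_nonneg_left (by positivity))
    exact le_mul_of_one_le_right hD0 (Real.one_le_exp (by nlinarith))

theorem integrableOn_Ioi_sol_mul {l : ℕ} (hl : l = 1 ∨ l = 2) {z : ℂ} {c : Fin 4 → ℂ} {m : ℝ}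
    (hm : 0 < m) (hc : ∀ j, c j ≠ 0 → (root z j).re ≤ -m) (f : HalfLineL2) {r : ℝ} (hr : 0 < r) :
    IntegrableOn (fun s => sol l z c 0 s * f s) (Ioi r) := by
  obtain ⟨C, hC0, hC⟩ := norm_sol_le_decay hl z c hm.le hc
  have hmeas : AEStronglyMeasurable ((Ioi r).indicator (sol l z c 0))
      (volume.restrict (Ioi 0)) := by
    rw [aestronglyMeasurable_indicator_iff measurableSet_Ioi,
      Measure.restrict_restrict measurableSet_Ioi]
    exact ((continuousOn_sol l z c 0).mono inter_subset_right).aestronglyMeasurable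
      (measurableSet_Ioi.inter measurableSet_Ioi)
  have h1 := integrableOn_mul_of_exp_bound (r := 0) (C := C / (min r 1) ^ l) hm hmeas
    (fun s hs => by
      by_cases h : s ∈ Ioi r
      · rw [indicator_of_mem h, zero_sub, abs_neg, abs_of_pos hs]
        refine (hC s hs).trans ?_
        rw [div_mul_eq_mul_div]
        have : min r 1 ≤ min s 1 := min_le_min_right 1 (le_of_lt h)
        have : 0 < min r 1 := lt_min hr one_pos
        gcongr
      · rw [indicator_of_notMem h, norm_zero]
        have : 0 < min r 1 := lt_min hr one_pos
        positivity) f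
  refine (h1.mono_set (Ioi_subset_Ioi hr.le)).congr_fun (fun s hs => ?_) measurableSet_Ioi
  simp only [indicator_of_mem hs]

theorem integrableOn_Ioi_zero_sol_mul {l : ℕ} (hl : l = 1 ∨ l = 2) {z : ℂ} {c : Fin 4 → ℂ}
    {m : ℝ} (hm : 0 < m) (hc : ∀ j, c j ≠ 0 → (root z j).re ≤ -m) (h0 : moment z c 0 = 0)
    (f : HalfLineL2) : IntegrableOn (fun s => sol l z c 0 s * f s) (Ioi 0) := by
  obtain ⟨C, hC0, hC⟩ := norm_sol_le_of_regular (σ := -m) hl h0 hc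
  refine integrableOn_mul_of_exp_bound (r := 0) (C := C) hm
    ((continuousOn_sol l z c 0).aestronglyMeasurable measurableSet_Ioi) (fun s hs => ?_) f
  rw [zero_sub, abs_neg, abs_of_pos hs, ← neg_mul]
  exact hC s hs

theorem HalfLineL2.integrableOn_Ioc (f : HalfLineL2) (r : ℝ) : IntegrableOn f (Ioc 0 r) := by
  have h1 : MemLp f 2 (volume.restrict (Ioc 0 r)) :=
    (Lp.memLp f).mono_measure (Measure.restrict_mono (fun x hx => hx.1) le_rfl)
  exact h1.integrable (by norm_num)

theorem integrableOn_Ioc_sol_mul {l : ℕ} {z : ℂ} {c : Fin 4 → ℂ} (h0 : moment z c 0 = 0)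
    (f : HalfLineL2) (r : ℝ) : IntegrableOn (fun s => sol l z c 0 s * f s) (Ioc 0 r) := by
  have h1 := (HalfLineL2.integrableOn_Ioc f r).continuousOn_mul_of_subset
    (K := Icc 0 r) (g := reg l z c 0)
    (continuous_reg l z c 0).continuousOn isCompact_Icc measurableSet_Ioc Ioc_subset_Icc_self
  refine h1.congr_fun (fun s _ => ?_) measurableSet_Ioc
  simp only [sol_eq_reg h0]

/-- The integral of `f` against a solution over `(r, ∞)`. -/
def upperInt (l : ℕ) (z : ℂ) (c : Fin 4 → ℂ) (f : ℝ → ℂ) (r : ℝ) : ℂ :=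
  ∫ s in Ioi r, sol l z c 0 s * f s

/-- The integral of `f` against a solution over `(0, r]`. -/
def lowerInt (l : ℕ) (z : ℂ) (c : Fin 4 → ℂ) (f : ℝ → ℂ) (r : ℝ) : ℂ :=
  ∫ s in Ioc 0 r, sol l z c 0 s * f s

theorem intervalIntegrable_sol_mul (l : ℕ) (z : ℂ) (c : Fin 4 → ℂ) (f : HalfLineL2) {a b : ℝ}
    (ha : 0 < a) (hab : a ≤ b) :
    IntervalIntegrable (fun s => sol l z c 0 s * f s) volume a b := by
  refine (HalfLineL2.intervalIntegrable f ha hab).continuousOn_mul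
    ((continuousOn_sol l z c 0).mono ?_)
  rw [uIcc_of_le hab]
  exact fun x hx => ha.trans_le hx.1

theorem upperInt_sub {l : ℕ} {z : ℂ} {c : Fin 4 → ℂ} {f : HalfLineL2}
    (h : ∀ r, 0 < r → IntegrableOn (fun s => sol l z c 0 s * f s) (Ioi r)) {a b : ℝ}
    (ha : 0 < a) (hab : a ≤ b) :
    upperInt l z c f b - upperInt l z c f a = ∫ s in a..b, -(sol l z c 0 s * f s) := by
  have h1 := setIntegral_union (μ := volume) (f := fun s => sol l z c 0 s * f s)
    (Ioc_disjoint_Ioi_same (a := a) (b := b)) measurableSet_Ioi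
    ((h a ha).mono_set Ioc_subset_Ioi_self) ((h a ha).mono_set (Ioi_subset_Ioi hab))
  rw [Ioc_union_Ioi_eq_Ioi hab] at h1
  rw [intervalIntegral.integral_neg, intervalIntegral.integral_of_le hab, upperInt, upperInt, h1]
  ring

theorem lowerInt_sub {l : ℕ} {z : ℂ} {c : Fin 4 → ℂ} {f : HalfLineL2}
    (h : moment z c 0 = 0) {a b : ℝ} (ha : 0 < a) (hab : a ≤ b) :
    lowerInt l z c f b - lowerInt l z c f a = ∫ s in a..b, sol l z c 0 s * f s := by
  have hi := integrableOn_Ioc_sol_mul (l := l) h f b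
  have h1 := setIntegral_union (μ := volume) (f := fun s => sol l z c 0 s * f s)
    (Ioc_disjoint_Ioc_of_le (a := 0) (d := b) (le_refl a)) measurableSet_Ioc
    (hi.mono_set (Ioc_subset_Ioc_right hab)) (hi.mono_set (Ioc_subset_Ioc_left ha.le))
  rw [Ioc_union_Ioc_eq_Ioc ha.le hab] at h1
  rw [intervalIntegral.integral_of_le hab, lowerInt, lowerInt, h1]
  ring

/-- The hypotheses on `κ` and `z` under which the kernel is studied: `z` lies in the open first
quadrant and `d ≠ 0`. -/
structure Admissible (l : ℕ) (κ : ℝ) (z : ℂ) : Prop where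
  degree : l = 1 ∨ l = 2
  re_pos : 0 < z.re
  im_pos : 0 < z.im
  den_ne_zero : coeffDen l κ z ≠ 0

theorem Admissible.ne_zero {l : ℕ} {κ : ℝ} {z : ℂ} (h : Admissible l κ z) : z ≠ 0 := fun h0 => by
  have := h.re_pos
  simp [h0] at this

theorem Admissible.psi_decay {l : ℕ} {κ : ℝ} {z : ℂ} (_ : Admissible l κ z) (i : Fin 2) :
    ∀ j, psi i j ≠ 0 → (root z j).re ≤ -(min z.re z.im) := by
  intro j hj
  have h1 := min_le_left z.re z.im
  have h2 := min_le_right z.re z.im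
  rw [root_re]
  fin_cases i <;> fin_cases j <;> simp [psi, gMinusC, gPlusC] at hj ⊢

theorem Admissible.psi_sub_decay {l : ℕ} {κ : ℝ} {z : ℂ} (h : Admissible l κ z) :
    ∀ j, (psi 1 - psi 0) j ≠ 0 → (root z j).re ≤ -(min z.re z.im) := by
  intro j hj
  by_cases h0 : psi 0 j = 0
  · exact h.psi_decay 1 j fun h1 => hj (by rw [Pi.sub_apply, h0, h1, sub_zero])
  · exact h.psi_decay 0 j h0

theorem Admissible.min_pos {l : ℕ} {κ : ℝ} {z : ℂ} (h : Admissible l κ z) :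
    0 < min z.re z.im := lt_min h.re_pos h.im_pos

theorem Admissible.moment_phi {l : ℕ} {κ : ℝ} {z : ℂ} (h : Admissible l κ z) (i : Fin 2) :
    moment z (phi l κ z i) 0 = 0 := (boundaryCoeff_phi h.degree h.den_ne_zero i).1

theorem Admissible.integrableOn_psi {l : ℕ} {κ : ℝ} {z : ℂ} (h : Admissible l κ z)
    (f : HalfLineL2) (i : Fin 2) {r : ℝ} (hr : 0 < r) :
    IntegrableOn (fun s => sol l z (psi i) 0 s * f s) (Ioi r) :=
  integrableOn_Ioi_sol_mul h.degree h.min_pos (h.psi_decay i) f hr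

/-- The function `∫ R(·, s) f(s) ds` written through variation of constants (`S = id`), the
function obtained from it by applying `T_l` to the solutions (`S = tau z`), and the functions
obtained by differentiating only the solutions `k` times. -/
def greenJet (l : ℕ) (κ : ℝ) (z : ℂ) (f : ℝ → ℂ) (S : (Fin 4 → ℂ) → Fin 4 → ℂ) (k : ℕ)
    (r : ℝ) : ℂ :=
  ∑ i, (sol l z (S (phi l κ z i)) k r * upperInt l z (psi i) f r +
    sol l z (S (psi i)) k r * lowerInt l z (phi l κ z i) f r)

/-- The jump on the diagonal of the `k`-th derivative of the kernel after applying `S`. -/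
def jump (l : ℕ) (κ : ℝ) (z : ℂ) (S : (Fin 4 → ℂ) → Fin 4 → ℂ) (k : ℕ) (r : ℝ) : ℂ :=
  ∑ i, (sol l z (S (psi i)) k r * sol l z (phi l κ z i) 0 r -
    sol l z (S (phi l κ z i)) k r * sol l z (psi i) 0 r)

theorem Admissible.continuousOn_greenJet {l : ℕ} {κ : ℝ} {z : ℂ} (h : Admissible l κ z)
    (f : HalfLineL2) (S : (Fin 4 → ℂ) → Fin 4 → ℂ) (k : ℕ) :
    ContinuousOn (greenJet l κ z f S k) (Ioi 0) := by
  refine continuousOn_finsetSum _ fun i _ => ?_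
  refine ((continuousOn_sol l z _ k).mul ?_).add ((continuousOn_sol l z _ k).mul ?_)
  · exact continuousOn_of_primitive
      (fun a b ha hab => (intervalIntegrable_sol_mul l z (psi i) f ha hab).neg)
      (fun a b ha hab => upperInt_sub (fun r hr => h.integrableOn_psi f i hr) ha hab)
  · exact continuousOn_of_primitive
      (fun a b ha hab => intervalIntegrable_sol_mul l z (phi l κ z i) f ha hab)
      (fun a b ha hab => lowerInt_sub (h.moment_phi i) ha hab)

/-- The derivative of `greenJet` consists of the terms in which the solutions are differentiated
and a jump term, from the derivatives of the integrals. -/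
theorem Admissible.greenJet_sub {l : ℕ} {κ : ℝ} {z : ℂ} (h : Admissible l κ z)
    (f : HalfLineL2) (S : (Fin 4 → ℂ) → Fin 4 → ℂ) (k : ℕ) {a b : ℝ} (ha : 0 < a) (hab : a ≤ b) :
    greenJet l κ z f S k b - greenJet l κ z f S k a =
      ∫ r in a..b, (greenJet l κ z f S (k + 1) r + jump l κ z S k r * f r) := by
  have hpos : ∀ r ∈ Icc a b, 0 < r := fun r hr => ha.trans_le hr.1
  have key := sum_mul_sub_eq_integral (Finset.univ : Finset (Fin 2 ⊕ Fin 2)) (a := a) (b := b)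
    (P := Sum.elim (fun i => sol l z (S (phi l κ z i)) k) (fun i => sol l z (S (psi i)) k))
    (P' := Sum.elim (fun i => sol l z (S (phi l κ z i)) (k + 1))
      (fun i => sol l z (S (psi i)) (k + 1)))
    (M := Sum.elim (fun i => upperInt l z (psi i) f) (fun i => lowerInt l z (phi l κ z i) f))
    (m := Sum.elim (fun i s => -(sol l z (psi i) 0 s * f s))
      (fun i s => sol l z (phi l κ z i) 0 s * f s)) hab
    (by
      rintro (i | i) - r hr
      · exact sol_hasDerivAt l z _ k (hpos r hr)
      · exact sol_hasDerivAt l z _ k (hpos r hr))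
    (by
      rintro (i | i) -
      · exact (continuousOn_sol l z _ (k + 1)).mono hpos
      · exact (continuousOn_sol l z _ (k + 1)).mono hpos)
    (by
      rintro (i | i) -
      · exact (intervalIntegrable_sol_mul l z (psi i) f ha hab).neg
      · exact intervalIntegrable_sol_mul l z (phi l κ z i) f ha hab)
    (by
      rintro (i | i) - r hr
      · exact upperInt_sub (fun r hr => h.integrableOn_psi f i hr) ha hr.1
      · exact lowerInt_sub (h.moment_phi i) ha hr.1)
  simp only [Fintype.sum_sum_type, Sum.elim_inl, Sum.elim_inr, ← Finset.sum_add_distrib] at key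
  rw [greenJet, greenJet, key]
  refine intervalIntegral.integral_congr fun r _ => ?_
  simp only [greenJet, jump, Fin.sum_univ_two]
  ring

theorem Admissible.greenJet_hasDerivAt {l : ℕ} {κ : ℝ} {z : ℂ} (h : Admissible l κ z)
    (f : HalfLineL2) {S : (Fin 4 → ℂ) → Fin 4 → ℂ} {k : ℕ}
    (hJ : ∀ r, 0 < r → jump l κ z S k r = 0) {r : ℝ} (hr : 0 < r) :
    HasDerivAt (greenJet l κ z f S k) (greenJet l κ z f S (k + 1) r) r := by
  refine hasDerivAt_of_primitive (h.continuousOn_greenJet f S (k + 1)) (fun a b ha hab => ?_) hr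
  rw [h.greenJet_sub f S k ha hab]
  refine intervalIntegral.integral_congr fun x hx => ?_
  rw [uIcc_of_le hab] at hx
  simp only [hJ x (ha.trans_le hx.1), zero_mul, add_zero]

theorem sol_two_eq {l : ℕ} (hl : l = 1 ∨ l = 2) (z : ℂ) (c : Fin 4 → ℂ) {r : ℝ} (hr : 0 < r) :
    sol l z c 2 r = (l : ℂ) * ((l : ℂ) + 1) / (r : ℂ) ^ 2 * sol l z c 0 r -
      sol l z (tau z c) 0 r := by
  rw [← sol_tau hl z c hr]; ring

theorem Admissible.jump_two {l : ℕ} {κ : ℝ} {z : ℂ} (h : Admissible l κ z) {r : ℝ} (hr : 0 < r) :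
    jump l κ z id 2 r = 0 := by
  have h1 := jump_tau (r := r) h.degree h.ne_zero h.den_ne_zero
  simp only [jump, id_eq, sol_two_eq h.degree z _ hr, Fin.sum_univ_two] at h1 ⊢
  linear_combination -h1

/-- Variation of constants: the derivatives of order at most three fall on the solutions. -/
theorem Admissible.greenJet_isJet {l : ℕ} {κ : ℝ} {z : ℂ} (h : Admissible l κ z)
    (f : HalfLineL2) : IsJet 3 (greenJet l κ z f id 0) (greenJet l κ z f id) := by
  refine ⟨fun _ _ => rfl, fun k hk r hr => h.greenJet_hasDerivAt f (fun x hx => ?_) hr⟩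
  interval_cases k
  · simp only [jump, id_eq]
    exact Finset.sum_eq_zero fun i _ => by ring
  · exact jump_one h.degree h.ne_zero h.den_ne_zero hx
  · exact h.jump_two hx

theorem Admissible.greenJet_two {l : ℕ} {κ : ℝ} {z : ℂ} (h : Admissible l κ z) (f : ℝ → ℂ)
    (S : (Fin 4 → ℂ) → Fin 4 → ℂ) {r : ℝ} (hr : 0 < r) :
    greenJet l κ z f S 2 r = (l : ℂ) * ((l : ℂ) + 1) / (r : ℂ) ^ 2 * greenJet l κ z f S 0 r -
      greenJet l κ z f (fun c => tau z (S c)) 0 r := by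
  simp only [greenJet, sol_two_eq h.degree z _ hr, Fin.sum_univ_two]
  ring

theorem Admissible.radialT_greenJet {l : ℕ} {κ : ℝ} {z : ℂ} (h : Admissible l κ z)
    (f : HalfLineL2) {r : ℝ} (hr : 0 < r) :
    radialT l (greenJet l κ z f id 0) r = greenJet l κ z f (tau z) 0 r := by
  rw [(h.greenJet_isJet f).radialT_eq l (by norm_num) hr, h.greenJet_two f id hr]
  simp only [id_eq]
  ring

/-- The jump of the derivative of `T_l` on the diagonal turns into the inhomogeneity `f`. -/
theorem Admissible.solvesTAE {l : ℕ} {κ : ℝ} {z : ℂ} (h : Admissible l κ z) (f : HalfLineL2) :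
    SolvesTAE l (radialT l (greenJet l κ z f id 0))
      (fun r => z ^ 4 * greenJet l κ z f id 0 r + f r) := by
  have hT : IsJet 1 (radialT l (greenJet l κ z f id 0)) (greenJet l κ z f (tau z)) := by
    refine ⟨fun r hr => h.radialT_greenJet f hr, fun k hk r hr => ?_⟩
    obtain rfl : k = 0 := by omega
    exact h.greenJet_hasDerivAt f
      (fun x hx => jump_tau h.degree h.ne_zero h.den_ne_zero) hr
  intro a b ha hab
  rw [hT.deriv_eq le_rfl ha, hT.deriv_eq le_rfl (ha.trans_le hab), h.greenJet_sub f _ 1 ha hab]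
  refine intervalIntegral.integral_congr fun r hr => ?_
  rw [uIcc_of_le hab] at hr
  have hr0 := ha.trans_le hr.1
  have hj : jump l κ z (tau z) 1 r = -1 := jump_tau_one h.degree h.ne_zero h.den_ne_zero hr0
  have h4 : greenJet l κ z f (fun c => tau z (tau z c)) 0 r =
      z ^ 4 * greenJet l κ z f id 0 r := by
    simp only [greenJet, tau_tau, sol_smul, id_eq, Finset.mul_sum]
    exact Finset.sum_congr rfl fun i _ => by ring
  simp only [h.radialT_greenJet f hr0]
  rw [h.greenJet_two f _ hr0, hj, h4]
  ring

/-- Splitting the kernel integral at the diagonal. -/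
theorem Admissible.integral_resolventKernel {l : ℕ} {κ : ℝ} {z : ℂ} (h : Admissible l κ z)
    (f : HalfLineL2) {r : ℝ} (hr : 0 < r) :
    ∫ s in Ioi (0 : ℝ), resolventKernel l κ z r s * f s = greenJet l κ z f id 0 r := by
  have e1 : EqOn (fun s => resolventKernel l κ z r s * f s)
      (fun s => ∑ i, sol l z (psi i) 0 r * (sol l z (phi l κ z i) 0 s * f s)) (Ioc 0 r) :=
    fun s hs => by
      simp only [resolventKernel_symm l κ z r s, resolventKernel_eq h.degree κ z hs.1 hs.2,
        kernelLE, Finset.sum_mul]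
      exact Finset.sum_congr rfl fun i _ => by ring
  have e2 : EqOn (fun s => resolventKernel l κ z r s * f s)
      (fun s => ∑ i, sol l z (phi l κ z i) 0 r * (sol l z (psi i) 0 s * f s)) (Ioi r) :=
    fun s hs => by
      simp only [resolventKernel_eq h.degree κ z hr (le_of_lt hs), kernelLE, Finset.sum_mul]
      exact Finset.sum_congr rfl fun i _ => by ring
  have i1 : ∀ i ∈ Finset.univ, IntegrableOn
      (fun s => sol l z (psi i) 0 r * (sol l z (phi l κ z i) 0 s * f s)) (Ioc 0 r) := fun i _ =>
    (integrableOn_Ioc_sol_mul (h.moment_phi i) f r).const_mul _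
  have i2 : ∀ i ∈ Finset.univ, IntegrableOn
      (fun s => sol l z (phi l κ z i) 0 r * (sol l z (psi i) 0 s * f s)) (Ioi r) := fun i _ =>
    (h.integrableOn_psi f i hr).const_mul _
  generalize (f : ℝ → ℂ) = F at *
  rw [← Ioc_union_Ioi_eq_Ioi hr.le, setIntegral_union Ioc_disjoint_Ioi_same measurableSet_Ioi
    ((integrableOn_congr_fun e1 measurableSet_Ioc).2 (integrable_finsetSum _ i1))
    ((integrableOn_congr_fun e2 measurableSet_Ioi).2 (integrable_finsetSum _ i2)),
    setIntegral_congr_fun measurableSet_Ioc e1, setIntegral_congr_fun measurableSet_Ioi e2,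
    integral_finsetSum _ i1, integral_finsetSum _ i2]
  simp only [integral_const_mul, greenJet, upperInt, lowerInt, id_eq, ← Finset.sum_add_distrib]
  exact Finset.sum_congr rfl fun i _ => by ring

/-! ### The boundary condition for the solution of the inhomogeneous equation -/

theorem tendsto_setIntegral_Ioc_zero {E : Type*} [NormedAddCommGroup E] [NormedSpace ℝ E]
    {g : ℝ → E} (hg : IntegrableOn g (Ioc 0 1)) :
    Tendsto (fun r => ∫ s in Ioc 0 r, g s) (𝓝[>] 0) (𝓝 0) := by
  have h1 : ContinuousOn (fun x => ∫ s in (0 : ℝ)..x, g s) (uIcc 0 1) :=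
    intervalIntegral.continuousOn_primitive_interval'
      ((intervalIntegrable_iff_integrableOn_Ioc_of_le zero_le_one).2 hg) left_mem_uIcc
  rw [uIcc_of_le zero_le_one] at h1
  have h2 := (h1 0 (by simp)).tendsto
  rw [intervalIntegral.integral_same] at h2
  have h3 : 𝓝[>] (0 : ℝ) ≤ 𝓝[Icc 0 1] 0 := by
    rw [← nhdsWithin_Ioc_eq_nhdsGT one_pos]
    exact nhdsWithin_mono _ Ioc_subset_Icc_self
  refine (h2.mono_left h3).congr' ?_
  filter_upwards [self_mem_nhdsWithin] with r hr
  exact intervalIntegral.integral_of_le (le_of_lt hr)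

/-- Although a decaying solution is of order `r^{-l}` at zero, its integral against `f` over
`(r, ∞)` is `o(r^{-l})`, by dominated convergence. -/
theorem tendsto_pow_mul_upperInt {l : ℕ} (hl : l = 1 ∨ l = 2) {z : ℂ} {c : Fin 4 → ℂ} {m : ℝ}
    (hm : 0 < m) (hc : ∀ j, c j ≠ 0 → (root z j).re ≤ -m) (f : HalfLineL2) :
    Tendsto (fun r : ℝ => (r : ℂ) ^ l * upperInt l z c f r) (𝓝[>] 0) (𝓝 0) := by
  obtain ⟨C, hC0, hC⟩ := norm_sol_le_decay hl z c hm.le hc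
  have hl0 : l ≠ 0 := by omega
  have hpow : Tendsto (fun r : ℝ => (r : ℂ) ^ l) (𝓝[>] 0) (𝓝 0) := by
    have h1 : Continuous fun r : ℝ => (r : ℂ) ^ l := by fun_prop
    have := (h1.tendsto 0).mono_left (nhdsWithin_le_nhds (s := Ioi 0))
    simpa [hl0] using this
  have hbi : Integrable (fun s => C * Real.exp (-(m * s)) * ‖f s‖) (volume.restrict (Ioi 0)) := by
    have hk := integrableOn_mul_of_exp_bound (r := 0) (C := C) hm
      (g := fun s => ((C * Real.exp (-(m * s)) : ℝ) : ℂ))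
      (by fun_prop) (fun s hs => by
        rw [Complex.norm_real, Real.norm_of_nonneg (by positivity), zero_sub, abs_neg,
          abs_of_pos hs]) f
    refine hk.norm.congr (Eventually.of_forall fun s => ?_)
    simp only [norm_mul, Complex.norm_real]
    rw [Real.norm_of_nonneg hC0, Real.norm_of_nonneg (Real.exp_nonneg _)]
  have key := tendsto_integral_filter_of_dominated_convergence
    (μ := volume.restrict (Ioi (0 : ℝ))) (l := 𝓝[>] (0 : ℝ))
    (F := fun r s => (Ioi r).indicator (fun s => (r : ℂ) ^ l * (sol l z c 0 s * f s)) s)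
    (f := fun _ => 0) (fun s => C * Real.exp (-(m * s)) * ‖f s‖)
    (Eventually.of_forall fun r => by
      refine AEStronglyMeasurable.indicator ?_ measurableSet_Ioi
      exact (((continuousOn_sol l z c 0).aestronglyMeasurable measurableSet_Ioi).mul
        (Lp.aestronglyMeasurable f)).const_mul _)
    (by
      filter_upwards [Ioc_mem_nhdsGT one_pos] with r hr
      filter_upwards [ae_restrict_mem measurableSet_Ioi] with s hs
      have hs0 : 0 < s := hs
      have hmin : 0 < min s 1 := lt_min hs0 one_pos
      by_cases h : s ∈ Ioi r
      · rw [indicator_of_mem h, norm_mul, norm_mul, norm_pow, Complex.norm_real,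
          Real.norm_of_nonneg hr.1.le, ← mul_assoc]
        refine mul_le_mul_of_nonneg_right ?_ (norm_nonneg _)
        calc r ^ l * ‖sol l z c 0 s‖
            ≤ (min s 1) ^ l * (C * Real.exp (-(m * s)) / (min s 1) ^ l) := by
              have h1 : r ≤ min s 1 := le_min (le_of_lt h) hr.2
              have h2 := hC s hs0
              have h3 := hr.1.le
              gcongr
          _ = _ := by field_simp
      · rw [indicator_of_notMem h, norm_zero]
        positivity)
    hbi
    (by
      filter_upwards [ae_restrict_mem measurableSet_Ioi] with s hs
      have h1 := hpow.mul_const (sol l z c 0 s * f s)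
      rw [zero_mul] at h1
      refine h1.congr' ?_
      filter_upwards [Ioo_mem_nhdsGT (show (0 : ℝ) < s from hs)] with r hr
      rw [indicator_of_mem (show s ∈ Ioi r from hr.2)])
  rw [integral_zero] at key
  refine key.congr' ?_
  filter_upwards [self_mem_nhdsWithin] with r hr
  rw [setIntegral_indicator measurableSet_Ioi, inter_eq_right.2 (Ioi_subset_Ioi (le_of_lt hr)),
    integral_const_mul, upperInt]

/-- The regrouping of `kernelLE_eq` for the solution of the inhomogeneous equation. -/
theorem Admissible.greenJet_eq {l : ℕ} {κ : ℝ} {z : ℂ} (h : Admissible l κ z)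
    (f : HalfLineL2) (k : ℕ) {r : ℝ} (hr : 0 < r) :
    greenJet l κ z f id k r =
      sol l z (phi l κ z 0 + phi l κ z 1) k r * upperInt l z (psi 0) f r +
      sol l z (psi 0) k r * lowerInt l z (phi l κ z 0 + phi l κ z 1) f r +
      sol l z (phi l κ z 1) k r * upperInt l z (psi 1 - psi 0) f r +
      sol l z (psi 1 - psi 0) k r * lowerInt l z (phi l κ z 1) f r := by
  have e1 : upperInt l z (psi 1 - psi 0) f r =
      upperInt l z (psi 1) f r - upperInt l z (psi 0) f r := by
    rw [upperInt, upperInt, upperInt,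
      ← integral_sub (h.integrableOn_psi f 1 hr) (h.integrableOn_psi f 0 hr)]
    simp only [sol_sub, sub_mul]
  have e2 : lowerInt l z (phi l κ z 0 + phi l κ z 1) f r =
      lowerInt l z (phi l κ z 0) f r + lowerInt l z (phi l κ z 1) f r := by
    rw [lowerInt, lowerInt, lowerInt,
      ← integral_add (integrableOn_Ioc_sol_mul (h.moment_phi 0) f r)
        (integrableOn_Ioc_sol_mul (h.moment_phi 1) f r)]
    simp only [sol_add, add_mul]
  rw [e1, e2]
  simp only [greenJet, Fin.sum_univ_two, sol_add, sol_sub, id_eq]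
  ring

/-- At zero only the term of `greenJet_eq` survives in which both solutions are regular and
the integral extends over `(r, ∞)`. -/
theorem Admissible.tendsto_greenJet {l : ℕ} {κ : ℝ} {z : ℂ} (h : Admissible l κ z)
    (f : HalfLineL2) {k : ℕ} (hk : k ≤ 3) :
    Tendsto (greenJet l κ z f id k) (𝓝[>] 0)
      (𝓝 (reg l z (phi l κ z 1) k 0 * upperInt l z (psi 1 - psi 0) f 0)) := by
  have hl := h.degree
  set H := phi l κ z 0 + phi l κ z 1 with hH
  have hH0 : moment z H 0 = 0 := by
    rw [hH, moment_add, h.moment_phi 0, h.moment_phi 1, add_zero]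
  have hvan : ∀ k < l + 3, reg l z H k 0 = 0 := fun k hk =>
    reg_phi_add hl h.ne_zero h.den_ne_zero hk
  obtain ⟨C, hC0, hC⟩ := norm_reg_le hvan (show k ≤ l + 3 by omega)
  obtain ⟨D, hD0, hD⟩ := norm_reg_le hvan (Nat.zero_le _)
  obtain ⟨E, hE0, hE⟩ := norm_sol_le_pow hl z (psi 0) k
  have t1 : Tendsto (fun r => sol l z H k r * upperInt l z (psi 0) f r) (𝓝[>] 0) (𝓝 0) := by
    have h1 := (tendsto_pow_mul_upperInt hl h.min_pos (h.psi_decay 0) f).norm.const_mul C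
    rw [norm_zero, mul_zero] at h1
    refine squeeze_zero_norm' ?_ h1
    filter_upwards [Ioc_mem_nhdsGT one_pos] with r hr
    rw [norm_mul, norm_mul, norm_pow, Complex.norm_real, Real.norm_of_nonneg hr.1.le, ← mul_assoc,
      sol_eq_reg hH0]
    gcongr
    refine (hC r hr.1.le hr.2).trans ?_
    gcongr ?_ * ?_
    exact pow_le_pow_of_le_one hr.1.le hr.2 (by omega)
  have t2 : Tendsto (fun r => sol l z (psi 0) k r * lowerInt l z H f r) (𝓝[>] 0) (𝓝 0) := by
    have hf1 := (HalfLineL2.integrableOn_Ioc f 1).norm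
    have h1 := (tendsto_setIntegral_Ioc_zero hf1).const_mul (E * D)
    rw [mul_zero] at h1
    refine squeeze_zero_norm' ?_ h1
    filter_upwards [Ioc_mem_nhdsGT one_pos] with r hr
    have hr0 : 0 < r := hr.1
    have e1 : ‖lowerInt l z H f r‖ ≤ D * r ^ (l + 3) * ∫ s in Ioc 0 r, ‖f s‖ := by
      rw [lowerInt, ← integral_const_mul]
      refine norm_integral_le_of_norm_le
        ((HalfLineL2.integrableOn_Ioc f r).norm.const_mul _) ?_
      filter_upwards [ae_restrict_mem measurableSet_Ioc] with s hs
      rw [norm_mul, sol_eq_reg hH0]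
      gcongr
      refine (hD s hs.1.le (hs.2.trans hr.2)).trans ?_
      have := hs.1.le
      have := hs.2
      rw [Nat.sub_zero]
      gcongr
    have e2 : ‖sol l z (psi 0) k r‖ ≤ E / r ^ (l + 3) := by
      exact (hE r hr0 hr.2).trans (div_le_div_of_nonneg_left hE0 (by positivity)
        (pow_le_pow_of_le_one hr0.le hr.2 (by omega)))
    rw [norm_mul]
    calc _ ≤ E / r ^ (l + 3) * (D * r ^ (l + 3) * ∫ s in Ioc 0 r, ‖f s‖) := by gcongr
      _ = _ := by field_simp
  have hint : IntegrableOn (fun s => sol l z (psi 1 - psi 0) 0 s * f s) (Ioi 0) :=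
    integrableOn_Ioi_zero_sol_mul hl h.min_pos h.psi_sub_decay (moment_psi_sub z) f
  have t3 : Tendsto (fun r => sol l z (phi l κ z 1) k r * upperInt l z (psi 1 - psi 0) f r)
      (𝓝[>] 0) (𝓝 (reg l z (phi l κ z 1) k 0 * upperInt l z (psi 1 - psi 0) f 0)) := by
    refine Tendsto.mul ((tendsto_reg l z _ k).congr fun r => (sol_eq_reg (h.moment_phi 1) k r).symm)
      ?_
    have h1 := (tendsto_setIntegral_Ioc_zero (hint.mono_set Ioc_subset_Ioi_self)).const_sub
      (upperInt l z (psi 1 - psi 0) f 0)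
    rw [sub_zero] at h1
    refine h1.congr' ?_
    filter_upwards [self_mem_nhdsWithin] with r hr
    have h2 := setIntegral_union (μ := volume) (f := fun s => sol l z (psi 1 - psi 0) 0 s * f s)
      (Ioc_disjoint_Ioi_same (a := 0) (b := r)) measurableSet_Ioi
      (hint.mono_set Ioc_subset_Ioi_self) (hint.mono_set (Ioi_subset_Ioi (le_of_lt hr)))
    generalize (f : ℝ → ℂ) = F at *
    rw [Ioc_union_Ioi_eq_Ioi (le_of_lt hr)] at h2
    rw [upperInt, upperInt, h2]
    ring
  have t4 : Tendsto (fun r => sol l z (psi 1 - psi 0) k r * lowerInt l z (phi l κ z 1) f r)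
      (𝓝[>] 0) (𝓝 (reg l z (psi 1 - psi 0) k 0 * 0)) :=
    Tendsto.mul ((tendsto_reg l z _ k).congr fun r => (sol_eq_reg (moment_psi_sub z) k r).symm)
      (tendsto_setIntegral_Ioc_zero (integrableOn_Ioc_sol_mul (h.moment_phi 1) f 1))
  have := ((t1.add t2).add t3).add t4
  rw [add_zero, zero_add, mul_zero, add_zero] at this
  refine this.congr' ?_
  filter_upwards [self_mem_nhdsWithin] with r hr
  exact (h.greenJet_eq f k hr).symm

theorem Admissible.boundaryCondition_greenJet {l : ℕ} {κ : ℝ} {z : ℂ} (h : Admissible l κ z)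
    (f : HalfLineL2) : BoundaryCondition l κ (greenJet l κ z f id 0) := by
  rw [boundaryCondition_iff h.degree (h.greenJet_isJet f)]
  refine ⟨_, fun k hk => h.tendsto_greenJet f hk, ?_⟩
  have h1 := (boundaryValues_reg_iff h.degree (h.moment_phi 1)).2
    (boundaryCoeff_phi h.degree h.den_ne_zero 1)
  simp only [BoundaryValues] at h1 ⊢
  split_ifs at h1 ⊢
  · obtain ⟨h2, h3, h4⟩ := h1
    exact ⟨by rw [h2, zero_mul], by rw [h3]; ring, by rw [h4, zero_mul]⟩
  · obtain ⟨h2, h3, h4⟩ := h1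
    exact ⟨by rw [h2, zero_mul], by rw [h3, zero_mul], by rw [h4]; ring⟩

theorem Admissible.isDomainRep_greenJet {l : ℕ} {κ : ℝ} {z : ℂ} (h : Admissible l κ z)
    (f : HalfLineL2) : IsDomainRep l κ (greenJet l κ z f id 0)
      (fun r => z ^ 4 * greenJet l κ z f id 0 r + f r) :=
  ⟨(h.greenJet_isJet f).contDiffOn (h.continuousOn_greenJet f id 3), h.solvesTAE f,
    h.boundaryCondition_greenJet f⟩

/-! ### Square integrable solutions of the homogeneous equation -/

/-- The only solutions of `p'' = (a² + l(l+1)/r²) p` are the combinations of `D_l e^{±ar}`. -/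
theorem exists_eq_jet_add_jet {l : ℕ} (hl : l = 1 ∨ l = 2) {a : ℂ} (ha : a ≠ 0) {p p' : ℝ → ℂ}
    (hp : ∀ r, 0 < r → HasDerivAt p (p' r) r)
    (hp' : ∀ r : ℝ, 0 < r →
      HasDerivAt p' ((a ^ 2 + (l : ℂ) * ((l : ℂ) + 1) / (r : ℂ) ^ 2) * p r) r) :
    ∃ α β : ℂ, ∀ r, 0 < r → p r = α * jet l a 0 r + β * jet l (-a) 0 r := by
  -- The wronskian of `p` with a solution of the same equation is constant.
  have hW : ∀ b : ℂ, b ^ 2 = a ^ 2 → ∀ r, 0 < r →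
      p' r * jet l b 0 r - p r * jet l b 1 r = p' 1 * jet l b 0 1 - p 1 * jet l b 1 1 := by
    intro b hb r hr
    have hd : ∀ x, 0 < x →
        HasDerivAt (fun x => p' x * jet l b 0 x - p x * jet l b 1 x) 0 x := by
      intro x hx
      refine (((hp' x hx).mul (jet_hasDerivAt l b 0 hx)).sub
        ((hp x hx).mul (jet_hasDerivAt l b 1 hx))).congr_deriv ?_
      rw [jet_two_eq hl b hx, hb]
      ring
    have := intervalIntegral.integral_eq_sub_of_hasDerivAt (a := 1) (b := r)
      (fun x hx => hd x (lt_of_lt_of_le (lt_min one_pos hr) hx.1)) (by simp)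
    rw [intervalIntegral.integral_zero] at this
    exact (sub_eq_zero.mp this.symm)
  have hW0 : 2 * (-1 : ℂ) ^ l * a ^ (2 * l + 1) ≠ 0 := by simp [ha]
  refine ⟨(p' 1 * jet l (-a) 0 1 - p 1 * jet l (-a) 1 1) / (2 * (-1) ^ l * a ^ (2 * l + 1)),
    -(p' 1 * jet l a 0 1 - p 1 * jet l a 1 1) / (2 * (-1) ^ l * a ^ (2 * l + 1)),
    fun r hr => ?_⟩
  rw [← hW (-a) (by ring) r hr, ← hW a rfl r hr]
  have hw := jet_wronskian hl a hr
  rw [div_mul_eq_mul_div, div_mul_eq_mul_div, ← add_div, eq_div_iff hW0]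
  linear_combination (-p r) * hw

/-- A solution of `T_l² φ = z⁴ φ` is a combination of the functions `D_l e^{a_j r}`:
`T_l φ ± z² φ` solve second order equations. -/
theorem exists_eq_sol {l : ℕ} (hl : l = 1 ∨ l = 2) {z : ℂ} (hz : z ≠ 0) {φ : ℝ → ℂ}
    (hφ : ContDiffOn ℝ 3 φ (Ioi 0)) (hs : SolvesTAE l (radialT l φ) fun r => z ^ 4 * φ r) :
    ∃ c : Fin 4 → ℂ, ∀ r, 0 < r → φ r = sol l z c 0 r := by
  have hT := radialT_contDiffOn l hφ
  have hφ1 : ContDiffOn ℝ 2 (deriv φ) (Ioi 0) := hφ.deriv_of_isOpen isOpen_Ioi (by norm_num)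
  have d0 : ∀ r : ℝ, 0 < r → HasDerivAt φ (deriv φ r) r := fun r hr =>
    ((hφ.contDiffAt (Ioi_mem_nhds hr)).differentiableAt (by norm_num)).hasDerivAt
  have d1 : ∀ r : ℝ, 0 < r → HasDerivAt (deriv φ)
      ((l : ℂ) * ((l : ℂ) + 1) / (r : ℂ) ^ 2 * φ r - radialT l φ r) r := fun r hr => by
    refine ((hφ1.contDiffAt (Ioi_mem_nhds hr)).differentiableAt
      (by norm_num)).hasDerivAt.congr_deriv ?_
    rw [radialT, iteratedDeriv_succ, iteratedDeriv_one]
    ring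
  have d2 : ∀ r : ℝ, 0 < r → HasDerivAt (radialT l φ) (deriv (radialT l φ) r) r := fun r hr =>
    ((hT.contDiffAt (Ioi_mem_nhds hr)).differentiableAt (by norm_num)).hasDerivAt
  have hpot : ContinuousOn (fun r : ℝ => (l : ℂ) * ((l : ℂ) + 1) / (r : ℂ) ^ 2) (Ioi 0) := by
    refine continuousOn_const.div (Complex.continuous_ofReal.continuousOn.pow 2) fun r hr => ?_
    have : (r : ℂ) ≠ 0 := by exact_mod_cast (ne_of_gt hr)
    exact pow_ne_zero 2 this
  have d3 : ∀ r : ℝ, 0 < r → HasDerivAt (deriv (radialT l φ))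
      ((l : ℂ) * ((l : ℂ) + 1) / (r : ℂ) ^ 2 * radialT l φ r - z ^ 4 * φ r) r := fun r hr =>
    hasDerivAt_of_primitive (m := fun r => (l : ℂ) * ((l : ℂ) + 1) / (r : ℂ) ^ 2 * radialT l φ r -
      z ^ 4 * φ r) ((hpot.mul hT.continuousOn).sub (continuousOn_const.mul hφ.continuousOn)) hs hr
  have hI : (Complex.I * z) ^ 2 = -z ^ 2 := by rw [mul_pow, Complex.I_sq]; ring
  obtain ⟨α, β, h1⟩ := exists_eq_jet_add_jet hl (mul_ne_zero Complex.I_ne_zero hz)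
    (p := fun r => radialT l φ r + z ^ 2 * φ r)
    (p' := fun r => deriv (radialT l φ) r + z ^ 2 * deriv φ r)
    (fun r hr => (d2 r hr).add ((d0 r hr).const_mul _))
    (fun r hr => ((d3 r hr).add ((d1 r hr).const_mul (z ^ 2))).congr_deriv (by rw [hI]; ring))
  obtain ⟨γ, δ, h2⟩ := exists_eq_jet_add_jet hl hz
    (p := fun r => radialT l φ r - z ^ 2 * φ r)
    (p' := fun r => deriv (radialT l φ) r - z ^ 2 * deriv φ r)
    (fun r hr => (d2 r hr).sub ((d0 r hr).const_mul _))
    (fun r hr => ((d3 r hr).sub ((d1 r hr).const_mul (z ^ 2))).congr_deriv (by ring))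
  refine ⟨(1 / (2 * z ^ 2)) • ![-γ, α, -δ, β], fun r hr => ?_⟩
  rw [sol_smul]
  simp only [sol, Fin.sum_univ_four, root, Matrix.cons_val]
  rw [div_mul_eq_mul_div, one_mul, eq_div_iff (mul_ne_zero two_ne_zero (pow_ne_zero 2 hz))]
  linear_combination h1 r hr - h2 r hr

/-- A square integrable function on the half-line cannot have a nonzero limit at infinity. -/
theorem eq_zero_of_memLp_of_tendsto {F : ℝ → ℂ} {K : ℂ}
    (hF : MemLp F 2 (volume.restrict (Ioi 0))) (hK : Tendsto F atTop (𝓝 K)) : K = 0 := by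
  by_contra hne
  have hpos : 0 < ‖K‖ ^ 2 := by positivity
  have hi : IntegrableOn (fun r => ‖F r‖ ^ 2) (Ioi 0) :=
    (memLp_two_iff_integrable_sq_norm hF.1).1 hF
  have hev := (hK.norm.pow 2).eventually (lt_mem_nhds (half_lt_self hpos))
  obtain ⟨N, hN⟩ := eventually_atTop.1 hev
  have hc : IntegrableOn (fun _ : ℝ => ‖K‖ ^ 2 / 2) (Ioi (max N 0)) := by
    refine (hi.mono_set (Ioi_subset_Ioi (le_max_right N 0))).mono' (by fun_prop) ?_
    filter_upwards [ae_restrict_mem measurableSet_Ioi] with r hr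
    rw [Real.norm_of_nonneg (by positivity)]
    exact (hN r ((le_max_left N 0).trans (le_of_lt hr))).le
  rw [integrableOn_const_iff] at hc
  rcases hc with h | h
  · exact hpos.ne' (by simpa using h)
  · simp at h

/-- If `e^{-ar} f` is asymptotic to `K + M e^{δr}` with an oscillating, not growing `e^{δr}` and
`f` is square integrable, then `K = 0`. -/
theorem eq_zero_of_memLp_of_asymptotic {f A B : ℝ → ℂ} {a δ K M : ℂ}
    (hf : MemLp f 2 (volume.restrict (Ioi 0))) (ha : 0 ≤ a.re) (hδ : δ.re ≤ 0) (hδ' : δ.im ≠ 0)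
    (h : ∀ r : ℝ, 0 < r → f r * Complex.exp (-a * r) = A r + B r * Complex.exp (δ * r))
    (hA : Tendsto A atTop (𝓝 K)) (hB : Tendsto B atTop (𝓝 M)) : K = 0 := by
  -- Translation by a half period `τ` turns the oscillating term into its negative, up to a
  -- positive factor `1 / E`; adding `E` times the translate removes it.
  set τ : ℝ := Real.pi / |δ.im| with hτ
  have hτ0 : 0 < τ := div_pos Real.pi_pos (abs_pos.mpr hδ')
  set E : ℝ := Real.exp (-δ.re * τ) with hE
  have hEδ : (E : ℂ) * Complex.exp (δ * τ) = -1 := by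
    have h1 : Complex.exp (δ.im * τ * Complex.I) = -1 := by
      rcases lt_or_gt_of_ne hδ' with hn | hp
      · have : (δ.im : ℂ) * τ = -Real.pi := by
          rw [hτ, abs_of_neg hn]; push_cast
          have : (δ.im : ℂ) ≠ 0 := by exact_mod_cast hδ'
          field_simp
        rw [this, neg_mul, Complex.exp_neg, Complex.exp_pi_mul_I]; norm_num
      · have : (δ.im : ℂ) * τ = Real.pi := by
          rw [hτ, abs_of_pos hp]; push_cast
          have : (δ.im : ℂ) ≠ 0 := by exact_mod_cast hδ'
          field_simp
        rw [this, Complex.exp_pi_mul_I]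
    rw [hE, Complex.ofReal_exp, ← Complex.exp_add, ← h1]
    congr 1
    push_cast
    linear_combination -(τ : ℂ) * Complex.re_add_im δ
  set g : ℝ → ℂ := fun r => f r * Complex.exp (-a * r) with hg
  have hg2 : MemLp g 2 (volume.restrict (Ioi 0)) := by
    refine hf.of_le (hf.1.mul (by fun_prop)) ?_
    filter_upwards [ae_restrict_mem measurableSet_Ioi] with r hr
    have hr0 : 0 < r := hr
    rw [hg, norm_mul, Complex.norm_exp]
    refine mul_le_of_le_one_right (norm_nonneg _) (Real.exp_le_one_iff.mpr ?_)
    simp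
    positivity
  have hgτ : MemLp (fun r => g (r + τ)) 2 (volume.restrict (Ioi 0)) := by
    have hmp := (measurePreserving_add_right (volume : Measure ℝ) τ).restrict_preimage
      (measurableSet_Ioi (a := (0 : ℝ)))
    refine (hg2.comp_measurePreserving hmp).mono_measure (Measure.restrict_mono ?_ le_rfl)
    intro r hr
    have hr0 : (0 : ℝ) < r := hr
    simp only [mem_preimage, mem_Ioi]
    linarith
  have hsum : MemLp (fun r => g r + (E : ℂ) * g (r + τ)) 2 (volume.restrict (Ioi 0)) :=
    hg2.add (hgτ.const_mul (E : ℂ))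
  have hshift : Tendsto (fun r : ℝ => r + τ) atTop atTop :=
    tendsto_atTop_add_const_right _ _ tendsto_id
  have hlim : Tendsto (fun r => g r + (E : ℂ) * g (r + τ)) atTop (𝓝 (K + E * K)) := by
    have hosc : Tendsto (fun r : ℝ => (B r - B (r + τ)) * Complex.exp (δ * r)) atTop (𝓝 0) := by
      have h1 := hB.sub (hB.comp hshift)
      rw [sub_self] at h1
      refine squeeze_zero_norm' ?_ (by simpa using h1.norm)
      filter_upwards [eventually_gt_atTop 0] with r hr
      rw [norm_mul, Complex.norm_exp]
      refine mul_le_of_le_one_right (norm_nonneg _) (Real.exp_le_one_iff.mpr ?_)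
      simp
      exact mul_nonpos_of_nonpos_of_nonneg hδ hr.le
    have h2 := (hA.add ((hA.comp hshift).const_mul (E : ℂ))).add hosc
    rw [add_zero] at h2
    refine h2.congr' ?_
    filter_upwards [eventually_gt_atTop 0] with r hr
    have e : Complex.exp (δ * ((r + τ : ℝ) : ℂ)) = Complex.exp (δ * r) * Complex.exp (δ * τ) := by
      rw [← Complex.exp_add]; push_cast; ring_nf
    simp only [hg, h r hr, h (r + τ) (by linarith), Function.comp_apply, e]
    linear_combination -(B (r + τ) * Complex.exp (δ * r)) * hEδ
  have h0 := eq_zero_of_memLp_of_tendsto hsum hlim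
  have hE0 : (1 + E : ℂ) ≠ 0 := by
    have : 0 < 1 + E := by positivity
    exact_mod_cast this.ne'
  have : (1 + E : ℂ) * K = 0 := by linear_combination h0
  exact (mul_eq_zero.mp this).resolve_left hE0

/-- `D_l e^{ar}` behaves like `a^l e^{ar}` at infinity. -/
theorem tendsto_jet_mul_exp {l : ℕ} (hl : l = 1 ∨ l = 2) (a : ℂ) :
    Tendsto (fun r : ℝ => jet l a 0 r * Complex.exp (-a * r)) atTop (𝓝 (a ^ l)) := by
  have hinv : Tendsto (fun r : ℝ => ((r : ℂ))⁻¹) atTop (𝓝 0) := by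
    have := (Complex.continuous_ofReal.tendsto 0).comp tendsto_inv_atTop_zero
    simpa [Function.comp_def] using this
  have hexp : ∀ r : ℝ, Complex.exp (a * r) * Complex.exp (-a * r) = 1 := fun r => by
    rw [← Complex.exp_add]; simp
  rcases hl with rfl | rfl
  · have h1 := tendsto_const_nhds (x := a) (f := (atTop : Filter ℝ)) |>.sub hinv
    rw [sub_zero] at h1
    rw [pow_one]
    refine h1.congr' ?_
    filter_upwards [eventually_gt_atTop 0] with r hr
    rw [jet_one_zero a hr, mul_assoc, hexp]
    ring
  · have h1 := ((tendsto_const_nhds (x := a ^ 2) (f := (atTop : Filter ℝ))).sub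
      (hinv.const_mul (3 * a))).add ((hinv.pow 2).const_mul 3)
    norm_num at h1
    refine h1.congr' ?_
    filter_upwards [eventually_gt_atTop 0] with r hr
    rw [jet_two_zero a hr]
    linear_combination -(a ^ 2 - 3 * a / r + 3 / (r : ℂ) ^ 2) * hexp r

theorem tendsto_mul_exp_zero {G : ℝ → ℂ} {M δ : ℂ} (hG : Tendsto G atTop (𝓝 M)) (hδ : δ.re < 0) :
    Tendsto (fun r : ℝ => G r * Complex.exp (δ * r)) atTop (𝓝 0) := by
  have h1 : Tendsto (fun r : ℝ => Complex.exp (δ * r)) atTop (𝓝 0) := by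
    rw [tendsto_zero_iff_norm_tendsto_zero]
    have h2 : Tendsto (fun r : ℝ => δ.re * r) atTop atBot :=
      tendsto_id.const_mul_atTop_of_neg hδ
    refine (Real.tendsto_exp_atBot.comp h2).congr fun r => ?_
    rw [Complex.norm_exp]
    simp
  simpa using hG.mul h1

/-- A square integrable solution does not contain the growing exponentials `e^{zr}`, `e^{-izr}`. The
dominant one is treated first; if both grow at the same rate, the other one only oscillates relative
to it. -/
theorem growing_coeff_eq_zero {l : ℕ} (hl : l = 1 ∨ l = 2) {z : ℂ} (hx : 0 < z.re)
    (hy : 0 < z.im) {c : Fin 4 → ℂ}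
    (hf : MemLp (sol l z c 0) 2 (volume.restrict (Ioi 0))) : c 0 = 0 ∧ c 3 = 0 := by
  have hz : z ≠ 0 := fun h => by simp [h] at hx
  set G : Fin 4 → ℝ → ℂ := fun i r => jet l (root z i) 0 r * Complex.exp (-root z i * r) with hG
  have hlim : ∀ i, Tendsto (fun r => c i * G i r) atTop (𝓝 (c i * root z i ^ l)) := fun i =>
    (tendsto_jet_mul_exp hl (root z i)).const_mul (c i)
  have hterm : ∀ (i : Fin 4) (a : ℂ) (r : ℝ), c i * jet l (root z i) 0 r * Complex.exp (-a * r) =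
      c i * G i r * Complex.exp ((root z i - a) * r) := fun i a r => by
    rw [hG, mul_assoc, mul_assoc, mul_assoc, ← Complex.exp_add]
    congr 3
    ring
  have hroot : ∀ i, root z i ≠ 0 := fun i hi => by
    have := root_pow_four z i
    rw [hi, zero_pow (by norm_num)] at this
    exact pow_ne_zero 4 hz this.symm
  have hconcl : ∀ i, c i * root z i ^ l = 0 → c i = 0 := fun i hi =>
    (mul_eq_zero.mp hi).resolve_right (pow_ne_zero _ (hroot i))
  -- `j` is the index of the exponential under consideration, `j'` that of the other growing one.
  have step : ∀ j j' : Fin 4, (j = 0 ∧ j' = 3 ∨ j = 3 ∧ j' = 0) →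
      ((root z j').re ≤ (root z j).re ∨ c j' = 0) → c j = 0 := by
    intro j j' hjj hle
    have hre : 0 < (root z j).re := by
      rcases hjj with ⟨rfl, -⟩ | ⟨rfl, -⟩ <;> rw [root_re] <;> simpa
    have hdec : ∀ i, i = 1 ∨ i = 2 → (root z i - root z j).re < 0 := by
      intro i hi
      have : (root z i).re < 0 := by
        rcases hi with rfl | rfl <;> rw [root_re] <;> simpa
      rw [Complex.sub_re]
      linarith
    have hA : Tendsto (fun r => c j * G j r +
        c 1 * G 1 r * Complex.exp ((root z 1 - root z j) * r) +
        c 2 * G 2 r * Complex.exp ((root z 2 - root z j) * r)) atTop (𝓝 (c j * root z j ^ l)) := by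
      have := ((hlim j).add (tendsto_mul_exp_zero (hlim 1) (hdec 1 (Or.inl rfl)))).add
        (tendsto_mul_exp_zero (hlim 2) (hdec 2 (Or.inr rfl)))
      simpa using this
    have hsplit : ∀ r : ℝ, sol l z c 0 r * Complex.exp (-root z j * r) =
        (c j * G j r + c 1 * G 1 r * Complex.exp ((root z 1 - root z j) * r) +
          c 2 * G 2 r * Complex.exp ((root z 2 - root z j) * r)) +
        c j' * G j' r * Complex.exp ((root z j' - root z j) * r) := by
      intro r
      have hj : c j * G j r = c j * jet l (root z j) 0 r * Complex.exp (-root z j * r) := by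
        rw [hterm j (root z j) r, sub_self, zero_mul, Complex.exp_zero, mul_one]
      rw [hj, ← hterm, ← hterm, ← hterm, sol, Fin.sum_univ_four]
      rcases hjj with ⟨rfl, rfl⟩ | ⟨rfl, rfl⟩ <;> ring
    have him : (root z j' - root z j).im ≠ 0 := by
      rcases hjj with ⟨rfl, rfl⟩ | ⟨rfl, rfl⟩
      · simp [root]; linarith
      · simp [root]; linarith
    apply hconcl
    rcases hle with hle | hle
    · exact eq_zero_of_memLp_of_asymptotic hf hre.le (by rw [Complex.sub_re]; linarith) him
        (fun r _ => hsplit r) hA (hlim j')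
    · refine eq_zero_of_memLp_of_asymptotic (δ := Complex.I) (B := fun _ => 0) hf hre.le (by simp)
        (by simp) (fun r _ => ?_) hA tendsto_const_nhds
      rw [hsplit r, hle]
      ring
  rcases le_total (root z 3).re (root z 0).re with h | h
  · have h0 := step 0 3 (Or.inl ⟨rfl, rfl⟩) (Or.inl h)
    exact ⟨h0, step 3 0 (Or.inr ⟨rfl, rfl⟩) (Or.inr h0)⟩
  · have h3 := step 3 0 (Or.inr ⟨rfl, rfl⟩) (Or.inl h)
    exact ⟨step 0 3 (Or.inl ⟨rfl, rfl⟩) (Or.inr h3), h3⟩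

/-- The boundary condition excludes the decaying solutions, because `d ≠ 0`. -/
theorem decaying_coeff_eq_zero {l : ℕ} {κ : ℝ} {z : ℂ} (h : Admissible l κ z) {c : Fin 4 → ℂ}
    (h0 : c 0 = 0) (h3 : c 3 = 0) (hc : BoundaryCoeff l κ z c) : c = 0 := by
  have hz := h.ne_zero
  have hd := h.den_ne_zero
  have hI := Complex.I_sq
  obtain ⟨m0, m1⟩ := hc
  simp only [moment, Fin.sum_univ_four, h0, h3, root, Matrix.cons_val, zero_mul, zero_add,
    add_zero, pow_zero, mul_one] at m0 m1
  have h12 : c 2 = -c 1 := by linear_combination m0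
  rw [h12] at m1
  have hz2 : z ^ 2 ≠ 0 := pow_ne_zero 2 hz
  have hfin : c 1 * coeffDen l κ z = 0 := by
    refine mul_left_cancel₀ hz2 ?_
    rcases h.degree with rfl | rfl
    · rw [if_pos rfl] at m1
      rw [coeffDen, if_pos rfl]
      grind
    · rw [if_neg (by norm_num)] at m1
      rw [coeffDen, if_neg (by norm_num)]
      grind
  have h1 : c 1 = 0 := (mul_eq_zero.mp hfin).resolve_right hd
  funext j
  fin_cases j
  · exact h0
  · exact h1
  · simp [h12, h1]
  · exact h3

/-- `z⁴` is not an eigenvalue of `T_{lκ}²`. -/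
theorem Admissible.eq_zero_of_mem_graph {l : ℕ} {κ : ℝ} {z : ℂ} (h : Admissible l κ z)
    {v : HalfLineL2} (hv : (v, z ^ 4 • v) ∈ graphTSq l h.degree κ) : v = 0 := by
  obtain ⟨φ, hvφ, hrep⟩ := hv
  have hs : SolvesTAE l (radialT l φ) fun r => z ^ 4 * φ r := by
    intro a b ha hab
    rw [hrep.solves a b ha hab]
    refine intervalIntegral_congr_half ?_ ha hab
    filter_upwards [Lp.coeFn_smul (z ^ 4) v, hvφ] with r h1 h2
    rw [h1, Pi.smul_apply, smul_eq_mul, h2]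
  obtain ⟨c, hc⟩ := exists_eq_sol h.degree h.ne_zero hrep.contDiffOn hs
  have hvc : v =ᵐ[volume.restrict (Ioi (0 : ℝ))] sol l z c 0 := by
    filter_upwards [hvφ, ae_restrict_mem measurableSet_Ioi] with r h1 hr
    exact h1.trans (hc r hr)
  obtain ⟨h0, h3⟩ := growing_coeff_eq_zero h.degree h.re_pos h.im_pos
    ((memLp_congr_ae hvc).1 (Lp.memLp v))
  have hb : BoundaryCondition l κ (sol l z c 0) :=
    hrep.boundary.congr one_pos h.degree fun r hr _ => (hc r hr).symm
  have hc0 := decaying_coeff_eq_zero h h0 h3 ((boundaryCondition_sol_iff h.degree).1 hb)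
  refine Lp.ext (hvc.trans ?_)
  refine EventuallyEq.trans ?_ (Lp.coeFn_zero ℂ 2 (volume.restrict (Ioi (0 : ℝ)))).symm
  exact Eventually.of_forall fun r => by simp [hc0, sol]

/-! ### The constituents and the kernel -/

theorem boundaryCondition_of_eq_sol {l : ℕ} (hl : l = 1 ∨ l = 2) {κ : ℝ} {z : ℂ}
    {c : Fin 4 → ℂ} (hc : BoundaryCoeff l κ z c) {f : ℝ → ℂ} {s : ℝ} (hs : 0 < s)
    (hf : ∀ r, 0 < r → r < s → f r = sol l z c 0 r) : BoundaryCondition l κ f :=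
  BoundaryCondition.congr hs hl ((boundaryCondition_sol_iff hl).2 hc) hf

theorem radialT_of_eq_sol {l : ℕ} (hl : l = 1 ∨ l = 2) {z w : ℂ} {c : Fin 4 → ℂ} {f : ℝ → ℂ}
    (hf : ∀ r, 0 < r → f r = sol l z c 0 r) (hw : tau z c = w • c) {r : ℝ} (hr : 0 < r) :
    radialT l f r = w * f r := by
  rw [(isJet_of_eq_sol hf 2).radialT_eq l le_rfl hr, sol_tau hl z c hr, hw, sol_smul, hf r hr]

theorem BoundaryCoeff.add {l : ℕ} {κ : ℝ} {z : ℂ} {c d : Fin 4 → ℂ} (hc : BoundaryCoeff l κ z c)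
    (hd : BoundaryCoeff l κ z d) : BoundaryCoeff l κ z (c + d) := by
  obtain ⟨c0, c1⟩ := hc
  obtain ⟨d0, d1⟩ := hd
  refine ⟨by rw [moment_add, c0, d0, add_zero], ?_⟩
  simp only [moment_add]
  split_ifs at c1 d1 ⊢
  · linear_combination c1 + d1
  · linear_combination c1 + d1

theorem Admissible.boundaryCondition_resolventKernel {l : ℕ} {κ : ℝ} {z : ℂ}
    (h : Admissible l κ z) {s : ℝ} (hs : 0 < s) :
    BoundaryCondition l κ (fun r => resolventKernel l κ z r s) := by
  have hphi := boundaryCoeff_phi h.degree h.den_ne_zero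
  exact boundaryCondition_of_eq_sol h.degree
    ((boundaryCoeff_smul _ (hphi 0)).add (boundaryCoeff_smul _ (hphi 1))) hs
    fun r hr hrs => resolventKernel_eq_lower h.degree κ z hr hrs.le

/-- The rate of decay `min (re z) (im z)` does not depend on `s`. -/
theorem Admissible.exists_decay {l : ℕ} {κ : ℝ} {z : ℂ} (h : Admissible l κ z) :
    ∃ c : ℝ, 0 < c ∧ ∀ s : ℝ, 0 < s →
      (fun r => resolventKernel l κ z r s) =O[atTop] (fun r => Real.exp (-(c * r))) := by
  obtain ⟨C, hC0, hC⟩ := norm_resolventKernel_le h.degree h.re_pos h.im_pos h.den_ne_zero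
  refine ⟨min z.re z.im, h.min_pos, fun s hs => ?_⟩
  refine Asymptotics.IsBigO.of_bound (C * Real.exp (min z.re z.im * s)) ?_
  filter_upwards [eventually_gt_atTop 0] with r hr
  refine (hC r s hr hs).trans ?_
  rw [Real.norm_of_nonneg (Real.exp_pos _).le, mul_assoc, ← Real.exp_add]
  gcongr
  have := mul_le_mul_of_nonneg_left (le_abs_self (r - s)) h.min_pos.le
  linarith

/-! ### The resolvent -/

/-- The integral operator with kernel `R` is bounded. -/
theorem Admissible.exists_hasKernel {l : ℕ} {κ : ℝ} {z : ℂ} (h : Admissible l κ z) :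
    ∃ G : HalfLineL2 →L[ℂ] HalfLineL2, HasKernel G (resolventKernel l κ z) := by
  obtain ⟨C, -, hC⟩ := norm_resolventKernel_le h.degree h.re_pos h.im_pos h.den_ne_zero
  refine ResKernel.exists_hasKernel h.min_pos (fun r hr => ?_) hC fun f => ?_
  · refine ((continuousOn_resolventKernel h.degree κ z hr).congr fun s _ =>
      resolventKernel_symm l κ z r s).aestronglyMeasurable measurableSet_Ioi
  · exact ((h.continuousOn_greenJet f id 0).congr fun r hr =>
      h.integral_resolventKernel f hr).aestronglyMeasurable measurableSet_Ioi

/-- The integral operator maps into the domain and solves `(T_{lκ}² - z⁴) u = f`. -/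
theorem Admissible.mem_graph {l : ℕ} {κ : ℝ} {z : ℂ} (h : Admissible l κ z)
    {G : HalfLineL2 →L[ℂ] HalfLineL2} (hG : HasKernel G (resolventKernel l κ z))
    (f : HalfLineL2) : (G f, z ^ 4 • G f + f) ∈ graphTSq l h.degree κ := by
  have hGf : G f =ᵐ[volume.restrict (Ioi (0 : ℝ))] greenJet l κ z f id 0 := by
    filter_upwards [(hG f).2, ae_restrict_mem measurableSet_Ioi] with r h1 hr
    rw [h1, h.integral_resolventKernel f hr]
  have hrep := h.isDomainRep_greenJet f
  refine ⟨greenJet l κ z f id 0, hGf, hrep.contDiffOn, fun a b ha hab => ?_, hrep.boundary⟩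
  rw [hrep.solves a b ha hab]
  refine intervalIntegral_congr_half ?_ ha hab
  filter_upwards [Lp.coeFn_add (z ^ 4 • G f) f, Lp.coeFn_smul (z ^ 4) (G f), hGf] with r h1 h2 h3
  rw [h1, Pi.add_apply, h2, Pi.smul_apply, smul_eq_mul, h3]

theorem Admissible.isResolventAt {l : ℕ} {κ : ℝ} {z : ℂ} (h : Admissible l κ z)
    {G : HalfLineL2 →L[ℂ] HalfLineL2} (hG : HasKernel G (resolventKernel l κ z)) :
    IsResolventAt (operatorTSq l h.degree κ) (z ^ 4) G := by
  constructor
  · intro f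
    have hm := h.mem_graph hG f
    rw [← operatorTSq_graph, LinearPMap.mem_graph_iff] at hm
    obtain ⟨⟨y, hy⟩, h1, h2⟩ := hm
    simp only at h1 h2
    subst h1
    exact ⟨hy, by rw [h2, add_sub_cancel_left]⟩
  · intro u
    have hu : ((u : HalfLineL2), operatorTSq l h.degree κ u) ∈ graphTSq l h.degree κ := by
      rw [← operatorTSq_graph]
      exact LinearPMap.mem_graph _ u
    have hm := (graphTSq l h.degree κ).sub_mem
      (h.mem_graph hG (operatorTSq l h.degree κ u - z ^ 4 • (u : HalfLineL2))) hu
    refine sub_eq_zero.mp (h.eq_zero_of_mem_graph ?_)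
    convert hm using 1
    rw [Prod.mk_sub_mk, smul_sub]
    congr 1
    abel

end

end ResKernel

theorem mainTheorem5 (l : ℕ) (hl : l = 1 ∨ l = 2) (κ : ℝ) (z : ℂ)
    (hz₀ : 0 < Complex.arg z) (hz₁ : Complex.arg z < Real.pi / 2)
    (hκ : 0 < κ → z ^ 4 ≠ -(κ : ℂ) ^ 4) :
    -- the coefficients are well defined
    ResKernel.coeffDen l κ z ≠ 0 ∧
    -- second order equations for the constituents, and the wronskians
    (∀ r : ℝ, 0 < r →
      ResKernel.radialT l (ResKernel.hTildePlus l κ z) r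
          + z ^ 2 * ResKernel.hTildePlus l κ z r = 0 ∧
      ResKernel.radialT l (ResKernel.gPlus l z) r + z ^ 2 * ResKernel.gPlus l z r = 0 ∧
      ResKernel.radialT l (ResKernel.hTildeMinus l κ z) r
          - z ^ 2 * ResKernel.hTildeMinus l κ z r = 0 ∧
      ResKernel.radialT l (ResKernel.gMinus l z) r - z ^ 2 * ResKernel.gMinus l z r = 0 ∧
      ResKernel.wronskian (ResKernel.hTildePlus l κ z) (ResKernel.gPlus l z) r
          = ResKernel.wPlus l z ∧
      ResKernel.wronskian (ResKernel.hTildeMinus l κ z) (ResKernel.gMinus l z) r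
          = ResKernel.wMinus l z) ∧
    -- boundary conditions for the constituents
    ResKernel.BoundaryCondition l κ (ResKernel.hPlus l κ z) ∧
    ResKernel.BoundaryCondition l κ (ResKernel.hMinus l κ z) ∧
    -- symmetry of the kernel
    (∀ r s : ℝ, 0 < r → 0 < s →
      ResKernel.resolventKernel l κ z r s = ResKernel.resolventKernel l κ z s r) ∧
    -- boundary conditions at zero in either argument
    (∀ s : ℝ, 0 < s →
      ResKernel.BoundaryCondition l κ (fun r => ResKernel.resolventKernel l κ z r s) ∧
      ResKernel.BoundaryCondition l κ (fun r => ResKernel.resolventKernel l κ z s r)) ∧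
    -- exponential decay at infinity in either argument
    (∃ c : ℝ, 0 < c ∧ ∀ s : ℝ, 0 < s →
      (fun r => ResKernel.resolventKernel l κ z r s) =O[atTop] (fun r => Real.exp (-(c * r))) ∧
      (fun r => ResKernel.resolventKernel l κ z s r) =O[atTop] (fun r => Real.exp (-(c * r)))) ∧
    -- the differential equation with the delta function
    (∀ s : ℝ, 0 < s →
      ResKernel.IsFundamentalSolution l (z ^ 4) s
        (fun r => ResKernel.resolventKernel l κ z r s)) ∧
    -- the kernel represents the resolvent of the operator at `z ^ 4`
    (∃ G : ResKernel.HalfLineL2 →L[ℂ] ResKernel.HalfLineL2,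
      ResKernel.HasKernel G (ResKernel.resolventKernel l κ z) ∧
      ResKernel.IsResolventAt (ResKernel.operatorTSq l hl κ) (z ^ 4) G) := by
  obtain ⟨hx, hy⟩ := ResKernel.pos_of_arg hz₀ hz₁
  have hd := ResKernel.coeffDen_ne_zero hl hx hy hκ
  have h : ResKernel.Admissible l κ z := ⟨hl, hx, hy, hd⟩
  have symm := ResKernel.resolventKernel_symm l κ z
  refine ⟨hd, fun r hr => ⟨?_, ?_, ?_, ?_, ?_, ?_⟩, ?_, ?_, fun r s _ _ => symm r s, ?_, ?_, ?_, ?_⟩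
  · rw [ResKernel.radialT_of_eq_sol (w := -z ^ 2) hl (fun _ => ResKernel.hTildePlus_eq hl κ z)
      (by funext j; fin_cases j <;> simp [ResKernel.tau, ResKernel.root]) hr]
    ring
  · rw [ResKernel.radialT_of_eq_sol (w := -z ^ 2) hl (fun _ => ResKernel.gPlus_eq hl z)
      (by funext j; fin_cases j <;> simp [ResKernel.tau, ResKernel.root, ResKernel.gPlusC]) hr]
    ring
  · rw [ResKernel.radialT_of_eq_sol (w := z ^ 2) hl (fun _ => ResKernel.hTildeMinus_eq hl κ z)
      (by funext j; fin_cases j <;> simp [ResKernel.tau, ResKernel.root, mul_pow]) hr]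
    ring
  · rw [ResKernel.radialT_of_eq_sol (w := z ^ 2) hl (fun _ => ResKernel.gMinus_eq hl z)
      (by
        funext j
        fin_cases j <;> simp [ResKernel.tau, ResKernel.root, ResKernel.gMinusC, mul_pow]) hr]
    ring
  · rw [ResKernel.wronskian_eq (fun _ => ResKernel.hTildePlus_eq hl κ z)
      (fun _ => ResKernel.gPlus_eq hl z) hr, ← ResKernel.jet_wronskian_plus hl z hr]
    simp only [ResKernel.sol, Fin.sum_univ_four, ResKernel.gPlusC, Matrix.cons_val]
    ring
  · rw [ResKernel.wronskian_eq (fun _ => ResKernel.hTildeMinus_eq hl κ z)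
      (fun _ => ResKernel.gMinus_eq hl z) hr, ← ResKernel.jet_wronskian_minus hl z hr]
    simp only [ResKernel.sol, Fin.sum_univ_four, ResKernel.gMinusC, Matrix.cons_val]
    ring
  · exact ResKernel.boundaryCondition_of_eq_sol hl (ResKernel.boundaryCoeff_hPlusC hl hd) one_pos
      fun r hr _ => ResKernel.hPlus_eq hl κ z hr
  · exact ResKernel.boundaryCondition_of_eq_sol hl (ResKernel.boundaryCoeff_hMinusC hl hd) one_pos
      fun r hr _ => ResKernel.hMinus_eq hl κ z hr
  · intro s hs
    have hb := h.boundaryCondition_resolventKernel hs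
    exact ⟨hb, by simpa only [symm s] using hb⟩
  · obtain ⟨c, hc, hO⟩ := h.exists_decay
    exact ⟨c, hc, fun s hs => ⟨hO s hs, by simpa only [symm s] using hO s hs⟩⟩
  · exact fun s hs => ResKernel.isFundamentalSolution_resolventKernel hl h.ne_zero hd hs
  · obtain ⟨G, hG⟩ := h.exists_hasKernel
    exact ⟨G, hG, h.isResolventAt hG⟩
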